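/- **Setting.** Let $d\ge 2$, $n=d-1$, $q=\frac{2d}{d-1}$, $\kappa\in\mathbb N$ with $\kappa>d$. Write $\xi=(\xi',\xi_d)\in\mathbb R^{n}\times\mathbb R=\mathbb R^d$, and let $B(0,R)$ be the Euclidean ball of $\mathbb R^d$. Let $\mathcal E g(\xi)=\int_{\mathbb R^{n}}e^{-i(\xi'\cdot x+\xi_d|x|^2)}g(x)\,dx$ be the Fourier extension operator of the paraboloid and let $U=[-\frac18,\frac18]^{n}$. *Smooth Alpert wavelets.* Let $L^2_{Q_0;\kappa}$ be the space of real functions on $Q_0=[0,1)^n$ that are polynomials of degree at most $\kappa-1$ on each of the $2^n$ dyadic children of $Q_0$ and satisfy $\int_{Q_0} g(x)\,x^\beta dx=0$ for $|\beta|<\kappa$; let $(h^a)_{a\in\Gamma}$ be an orthonormal basis of it, and for a cube $J=2^{-s}(j+[0,1)^n)+v$ let $h_J^a(x)=2^{sn/2}h^a(2^s(x-v)-j)$. Let $\phi\in C_c^\infty(B_{\mathbb R^n}(0,1))$ be real with $\int\phi=1$ and $\int\phi(x)x^\beta dx=0$ for $0<|\beta|<\kappa$, let $\phi_t(x)=t^{-n}\phi(x/t)$,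 and for $\eta>0$ put $h_J^{a,\eta}=h_J^a*\phi_{\eta\ell(J)}$, where $\ell(J)$ is the side length. *Grids.* Let $\mathcal D$ be the standard dyadic grid of $\mathbb R^n$ and $\mathbb G=\{\mathcal D+v: v\in[-1,1]^n\}$, with $\mathbb E_{\mathbb G}$ the average over $v\in[-1,1]^n$. For $\mathcal G\in\mathbb G$ let $T_{\mathcal G}F=\sum_{I\in\mathcal G,\,a\in\Gamma}\langle F,h_I^{a,\eta}\rangle h_I^{a,\eta}$ on $L^2(\mathbb R^n)$, and for $s\in\mathbb N$ let $\mathcal G_s[U]$ be the set of cubes $J\in\mathcal G$ of side $2^{-s}$ that meet $U$; $c_J$ is the centre of $J$. *Modulated pieces.* Let $\psi\in C^\infty_c(\mathbb R^n)$ be real with $\operatorname{supp}\psi\subset U$. For $s\in\mathbb N$, $N=2^s$, $m\in\mathbb R^{n}$ and $f\in L^q(U)$ (complex, extended by $0$ off $U$) put $$\varphi^m_J=\frac{e^{2\pi i\,2^sc_J\cdot 2^sm}}{(2N+1)^{n/2}},\qquad \langle\mathbf a^{f,\mathcal G},\varphi^m\rangle_a=\sum_{J\in\mathcal G_s[U]}\langle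 T_{\mathcal G}^{-1}f,h_J^{a,\eta}\rangle\,\overline{\varphi^m_J},\qquad g_{m,a}=\sum_{J\in\mathcal G_s[U]}\psi(c_J)\,\varphi^m_J\,h_J^{a,\eta},$$ and let $\langle\mathbf a^{f,\mathcal G},\varphi^m\rangle g_m$ and $\langle\mathbf a^{f,\mathcal G},\varphi^m\rangle\mathcal Eg_m$ stand for the sums over $a\in\Gamma$ of $\langle\mathbf a^{f,\mathcal G},\varphi^m\rangle_a\, g_{m,a}$ and $\langle\mathbf a^{f,\mathcal G},\varphi^m\rangle_a\,\mathcal Eg_{m,a}$. **Lemma.** For each $d\ge2$ there is a constant $C_d$, depending only on $d$, such that for all $\kappa$ and $\phi$ as above there is $\eta_0>0$ such that for every orthonormal basis $(h^a)$ as above and all $0<\eta<\eta_0$ the following hold. For every $\mathcal G\in\mathbb G$ the series defining $T_{\mathcal G}$ converges unconditionally in $L^2(\mathbb R^n)$ and $T_{\mathcal G}$ is a bounded invertible operator on $L^2(\mathbb R^n)$. For every $\psi$ as above there is a constant $C$ such that for all $0<\delta\le\frac12$, all $s\in\mathbb N$, all $m\in\mathbb R^{n}$ (in particular all $m$ in the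 lattice $\Gamma_s=2^{-s}\{-N,\dots,N\}^{n}$) and all $f\in L^q(U)$: 1. for every grid $\mathcal G\in\mathbb G$, $$\big\|\mathcal E\big(\langle\mathbf a^{f,\mathcal G},\varphi^m\rangle g_m\big)\big\|_{L^{q}\left(B(0,2^{\frac s{1-\delta}})\cap\{|\xi_d|\le2^{-ds}\}\right)}\le C\,\|f\|_{L^{q}(U)};$$ 2. for every $\xi\in\mathbb R^d$ the function $v\mapsto\langle\mathbf a^{f,\mathcal D+v},\varphi^m\rangle\mathcal Eg_m(\xi)$ is integrable over $[-1,1]^n$, and $$\big\|\mathbb E_{\mathbb G}\langle\mathbf a^{f,\mathcal G},\varphi^m\rangle\mathcal E g_m\big\|_{L^{q}\left(B(0,2^{\frac s{1-\delta}})\cap\{2^{(1-\delta)s}\le\xi_d\le2^{\frac s{1-\delta}}\}\right)}\le C\,2^{C_d\delta s}\,\|f\|_{L^{q}(U)}.$$ In particular both bounds are uniform in $m$. -/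

import Mathlib

open MeasureTheory Set
open scoped Convolution ContDiff

noncomputable section

namespace AlpertExtension

/-- The Euclidean space `ℝⁿ`; in the theorem `n = d - 1`, and `ℝᵈ` is `E (d - 1) × ℝ`,
a point being written `ξ = (ξ', ξ_d)`. -/
abbrev E (n : ℕ) : Type := EuclideanSpace ℝ (Fin n)

/-- Complex `L²(ℝⁿ)`. -/
abbrev L2 (n : ℕ) : Type := Lp ℂ 2 (volume : Measure (E n))

/-! ### Alpert wavelets on the unit cube -/

/-- The unit cube `Q₀ = [0,1)ⁿ`. -/
def unitCube (n : ℕ) : Set (E n) := {x | ∀ i, x i ∈ Ico (0 : ℝ) 1}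

/-- The `2ⁿ` dyadic children of `Q₀`, indexed by their corners. -/
def unitChild {n : ℕ} (c : Fin n → Fin 2) : Set (E n) :=
  {x | ∀ i, x i ∈ Ico (((c i : ℕ) : ℝ) / 2) ((((c i : ℕ) : ℝ) + 1) / 2)}

/-- The monomial `x ^ β`. -/
def mono {n : ℕ} (β : Fin n → ℕ) (x : E n) : ℝ := ∏ i, x i ^ β i

/-- The space `L²_{Q₀;κ}`: functions that are a polynomial of degree at most `κ - 1` on each
child of `Q₀`, vanish off `Q₀`, and have vanishing moments of all orders less than `κ`. -/
def alpertSpace (n κ : ℕ) : Set (E n → ℝ) :=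
  {g | (∃ p : (Fin n → Fin 2) → MvPolynomial (Fin n) ℝ,
          (∀ c, (p c).totalDegree < κ) ∧
          ∀ x, g x = ∑ c, (unitChild c).indicator
            (fun y : E n => MvPolynomial.eval (fun i => y i) (p c)) x) ∧
       ∀ β : Fin n → ℕ, ∑ i, β i < κ → ∫ x in unitCube n, g x * mono β x = 0}

/-- `(h a)_a` is an orthonormal basis of `L²_{Q₀;κ}`. -/
structure IsAlpertBasis {n : ℕ} (κ : ℕ) {M : ℕ} (h : Fin M → E n → ℝ) : Prop where
  orthonormal : ∀ a b, ∫ x, h a x * h b x = if a = b then 1 else 0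
  span_eq : (Submodule.span ℝ (range h) : Set (E n → ℝ)) = alpertSpace n κ

/-- `φ ∈ C_c^∞(B(0,1))` has integral one and vanishing moments of positive order less
than `κ`. -/
structure IsMollifier {n : ℕ} (κ : ℕ) (φ : E n → ℝ) : Prop where
  smooth : ContDiff ℝ ∞ φ
  tsupport_subset : tsupport φ ⊆ Metric.ball 0 1
  integral_eq_one : ∫ x, φ x = 1
  moment_eq_zero : ∀ β : Fin n → ℕ, 0 < ∑ i, β i → ∑ i, β i < κ → ∫ x, φ x * mono β x = 0

/-! ### The grid `𝓓 + v` and its (smooth) Alpert wavelets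

A cube of side `2⁻ˢ` (`s : ℤ`) of the translate `𝓓 + v` of the standard dyadic grid `𝓓` is
given by its index `j ∈ ℤⁿ`. -/

/-- The cube `2⁻ˢ (j + [0,1)ⁿ) + v`. -/
def gridCube {n : ℕ} (v : E n) (s : ℤ) (j : Fin n → ℤ) : Set (E n) :=
  {x | ∀ i, (2 : ℝ) ^ s * (x i - v i) - j i ∈ Ico (0 : ℝ) 1}

/-- The centre `c_J` of the cube `J = gridCube v s j`. -/
def gridCenter {n : ℕ} (v : E n) (s : ℤ) (j : Fin n → ℤ) : E n :=
  WithLp.toLp 2 fun i => v i + (2 : ℝ) ^ (-s) * ((j i : ℝ) + 1 / 2)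

/-- The Alpert wavelet of `J = gridCube v s j`: the `L²`-normalised translate and dilate of the
mother wavelet `h`. -/
def wavelet {n : ℕ} (h : E n → ℝ) (v : E n) (s : ℤ) (j : Fin n → ℤ) (x : E n) : ℝ :=
  (2 : ℝ) ^ ((s : ℝ) * n / 2) *
    h ((2 : ℝ) ^ s • (x - v) - WithLp.toLp 2 fun i => (j i : ℝ))

/-- `φ_t(x) = t⁻ⁿ φ(x / t)`. -/
def dilate {n : ℕ} (φ : E n → ℝ) (t : ℝ) (x : E n) : ℝ := (t ^ n)⁻¹ * φ (t⁻¹ • x)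

/-- The smooth Alpert wavelet `h_J^η = h_J * φ_{η ℓ(J)}`, `J = gridCube v s j`. -/
def smoothWavelet {n : ℕ} (φ h : E n → ℝ) (η : ℝ) (v : E n) (s : ℤ) (j : Fin n → ℤ) :
    E n → ℝ :=
  wavelet h v s j ⋆[ContinuousLinearMap.mul ℝ ℝ, volume] dilate φ (η * (2 : ℝ) ^ (-s))

open Classical in
/-- The class of `g` in `L²` (and `0` if `g` is not square integrable, which never happens for the
functions it is applied to: smooth wavelets are continuous with compact support, and
`L^{2d/(d-1)}(U) ⊆ L²(U)`). -/
def toL2 {n : ℕ} (g : E n → ℂ) : L2 n :=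
  if hg : MemLp g 2 (volume : Measure (E n)) then hg.toLp g else 0

/-- The smooth Alpert wavelet as an element of `L²`. -/
def smoothWaveletL2 {n : ℕ} (φ h : E n → ℝ) (η : ℝ) (v : E n) (s : ℤ) (j : Fin n → ℤ) : L2 n :=
  toL2 fun x => (smoothWavelet φ h η v s j x : ℂ)

/-! ### The operator `T_𝓖` -/

/-- The terms `⟨F, h_I^{a,η}⟩ h_I^{a,η}`, indexed by the cubes `I = (s, j)` of `𝓖 = 𝓓 + v`
of all sizes and by `a`. -/
def frameTerm {n M : ℕ} (φ : E n → ℝ) (h : Fin M → E n → ℝ) (η : ℝ) (v : E n) (F : L2 n)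
    (I : (ℤ × (Fin n → ℤ)) × Fin M) : L2 n :=
  inner ℂ (smoothWaveletL2 φ (h I.2) η v I.1.1 I.1.2) F •
    smoothWaveletL2 φ (h I.2) η v I.1.1 I.1.2

/-- `T_𝓖 F = ∑_{I, a} ⟨F, h_I^{a,η}⟩ h_I^{a,η}`. -/
def frameOp {n M : ℕ} (φ : E n → ℝ) (h : Fin M → E n → ℝ) (η : ℝ) (v : E n) (F : L2 n) : L2 n :=
  ∑' I, frameTerm φ h η v F I

/-- `T_𝓖⁻¹`. -/
def frameInv {n M : ℕ} (φ : E n → ℝ) (h : Fin M → E n → ℝ) (η : ℝ) (v : E n) : L2 n → L2 n :=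
  Function.invFun (frameOp φ h η v)

/-! ### The cube `U`, the cubes of `𝓖_s[U]`, and the modulated pieces -/

/-- The cube `U` of side `1/4` centred at the origin. -/
def cubeU (n : ℕ) : Set (E n) := {x | ∀ i, |x i| ≤ 1 / 8}

/-- The cubes of side `2⁻ˢ` of `𝓓 + v` that meet `U`; there are finitely many of them. -/
theorem finite_meeting {n : ℕ} (v : E n) (s : ℤ) :
    {j : Fin n → ℤ | (gridCube v s j ∩ cubeU n).Nonempty}.Finite := by
  refine (Set.Finite.pi (t := fun i : Fin n =>
    Icc ⌊(2 : ℝ) ^ s * (-1 / 8 - v i) - 1⌋ ⌈(2 : ℝ) ^ s * (1 / 8 - v i)⌉)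
    fun i => Set.finite_Icc _ _).subset ?_
  rintro j ⟨x, hx, hU⟩ i -
  have h1 := hx i
  have h2 := abs_le.1 (hU i)
  have hp : (0 : ℝ) < (2 : ℝ) ^ s := by positivity
  have h3 : (2 : ℝ) ^ s * (-1 / 8 - v i) ≤ (2 : ℝ) ^ s * (x i - v i) := by
    apply mul_le_mul_of_nonneg_left _ hp.le; linarith [h2.1]
  have h4 : (2 : ℝ) ^ s * (x i - v i) ≤ (2 : ℝ) ^ s * (1 / 8 - v i) := by
    apply mul_le_mul_of_nonneg_left _ hp.le; linarith [h2.2]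
  refine ⟨?_, ?_⟩
  · have : (⌊(2 : ℝ) ^ s * (-1 / 8 - v i) - 1⌋ : ℝ) ≤ j i := by
      refine (Int.floor_le _).trans ?_; linarith [h1.2]
    exact_mod_cast this
  · have : (j i : ℝ) ≤ ⌈(2 : ℝ) ^ s * (1 / 8 - v i)⌉ := by
      refine le_trans ?_ (Int.le_ceil _); linarith [h1.1]
    exact_mod_cast this

/-- The index set of `𝓖_s[U]`, `𝓖 = 𝓓 + v`. -/
def cubesMeeting {n : ℕ} (v : E n) (s : ℤ) : Finset (Fin n → ℤ) := (finite_meeting v s).toFinset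

/-- `φ_J^m = e^{2πi 2ˢ c_J · 2ˢ m} / (2N+1)^{n/2}`, `N = 2ˢ`, `J = gridCube v s j`. -/
def modulation {n : ℕ} (s : ℕ) (m v : E n) (j : Fin n → ℤ) : ℂ :=
  Complex.exp (2 * Real.pi * Complex.I *
      ((inner ℝ ((2 : ℝ) ^ s • gridCenter v s j) ((2 : ℝ) ^ s • m) : ℝ) : ℂ)) /
    ((2 * (2 : ℝ) ^ s + 1) ^ ((n : ℝ) / 2) : ℝ)

/-- `⟨𝐚, φ^m⟩`, where `𝐚_J = ⟨T_𝓖⁻¹ f, h_J^{a,η}⟩` for `J ∈ 𝓖_s[U]`, `𝓖 = 𝓓 + v`, and `f` is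
extended by zero off `U`; one number for each `a`. -/
def modCoeff {n M : ℕ} (φ : E n → ℝ) (h : Fin M → E n → ℝ) (η : ℝ) (s : ℕ) (m : E n)
    (f : E n → ℂ) (v : E n) (a : Fin M) : ℂ :=
  ∑ j ∈ cubesMeeting v s,
    inner ℂ (smoothWaveletL2 φ (h a) η v s j) (frameInv φ h η v (toL2 ((cubeU n).indicator f))) *
      (starRingEnd ℂ) (modulation s m v j)

/-- `g_m = ∑_{J ∈ 𝓖_s[U]} ψ(c_J) φ_J^m h_J^{a,η}`; one function for each `a`. -/
def modPiece {n M : ℕ} (φ : E n → ℝ) (h : Fin M → E n → ℝ) (η : ℝ) (ψ : E n → ℝ) (s : ℕ)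
    (m v : E n) (a : Fin M) (x : E n) : ℂ :=
  ∑ j ∈ cubesMeeting v s,
    (ψ (gridCenter v s j) : ℂ) * modulation s m v j * (smoothWavelet φ (h a) η v s j x : ℂ)

/-- The Fourier extension operator of the paraboloid,
`𝓔g(ξ) = ∫ e^{-i ξ · (x, |x|²)} g(x) dx`. -/
def ext {n : ℕ} (g : E n → ℂ) (ξ : E n × ℝ) : ℂ :=
  ∫ x, Complex.exp (-Complex.I * ((inner ℝ ξ.1 x + ξ.2 * ‖x‖ ^ 2 : ℝ) : ℂ)) * g x

/-- The Euclidean ball of radius `R` about the origin of `ℝ^{n+1} = ℝⁿ × ℝ`. -/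
def ball' (n : ℕ) (R : ℝ) : Set (E n × ℝ) := {ξ | Real.sqrt (‖ξ.1‖ ^ 2 + ξ.2 ^ 2) < R}

/-- The translation parameters `[-1,1]ⁿ` of the family of grids `𝔾 = {𝓓 + v}`; the expectation
over `𝔾` is the average over this cube. -/
def shifts (n : ℕ) : Set (E n) := {v | ∀ i, v i ∈ Icc (-1 : ℝ) 1}

/-- The exponent `2d/(d-1)`. -/
def qExp (d : ℕ) : ENNReal := ENNReal.ofReal (2 * d / ((d : ℝ) - 1))

end AlpertExtension

end

open AlpertExtension

/-! Write n = d - 1. The lemma rests on a perturbation argument in L² for the frame operators, and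
on three elementary bounds for 𝓔 of a modulated piece, interpolated on the slices of constant ξ_d.

Frame operators. The unsmoothed Alpert wavelets form a Hilbert basis. Orthogonality comes from the
vanishing moments and the nesting of dyadic cubes. For completeness, the normalised indicator of a
dyadic cube is, modulo wavelets, a polynomial on its k-th ancestor whose coefficients are
O(2^{-nk/2}); so a function orthogonal to all wavelets has mean zero over every dyadic cube and
vanishes. The smooth wavelets are the dilates and translates of g * φ_η, and the error k = g * φ_η -
g has mean zero and compact support, ‖k‖₂ = O(√η), and an L² modulus of continuity O(|y|^{1/2})
uniform in η. The modulus makes different scales interact by at most O(2^{-|s-t|/2})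
(`norm_sq_sum_all_scales_le`), so the errors are a Bessel family with bound O(√η)
(`exists_perturbation_bound`). A family this close to a Hilbert basis has an analysis operator that
is unitary up to a Neumann series, hence is a frame (`exists_frame_of_near_hilbertBasis`).
Translation by v conjugates T_𝓓 into T_{𝓓+v}, so every constant is the same for all grids.

Estimates. Cauchy–Schwarz bounds the coefficient by a multiple of ‖f‖₂, hence of ‖f‖_q, uniformly in
s, m and the grid. For the pieces, ‖g_m‖₁ = O(1) gives a sup bound; ‖g_m‖₂ = O(1) and Plancherel
bound the L² norm on each slice; and there is the dispersive bound |𝓔g_m(ξ)| = O(|ξ_d|^{-n/2})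
(`exists_ext_modPiece_le`). For the last one, Fourier inversion writes ψ as a superposition of
characters. A sum of smooth wavelets with character coefficients, taken over a sum of two index
boxes, is a convolution u * w, for which Cauchy–Schwarz and Plancherel give |𝓔(u * w)(ξ)|² ≤
(π/|ξ_d|)^n ‖u‖₂² ‖w‖₂².

On a slice, |F|^q ≤ (sup |F|)^{q-2} |F|². Since q - 2 = 2/n, the dispersive bound leaves dt/t, so
the large range contributes the logarithm of the ratio of its endpoints, which is at most 2^{4δs};
the small range has bounded length. All bounds hold grid by grid and pass to the average by the
triangle inequality and Cauchy–Schwarz. -/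

namespace AlpertExtension

/-! ### Frames close to a Hilbert basis -/

section Frames

variable {ι H : Type*} [NormedAddCommGroup H] [InnerProductSpace ℂ H]

/-- Duality: a bound for the synthesis operator gives one for the analysis operator. -/
theorem sum_sq_inner_le_of_synthesis {k : ι → H} {B : ℝ}
    (hk : ∀ (S : Finset ι) (c : ι → ℂ), ‖∑ i ∈ S, c i • k i‖ ^ 2 ≤ B ^ 2 * ∑ i ∈ S, ‖c i‖ ^ 2)
    (S : Finset ι) (F : H) : ∑ i ∈ S, ‖inner ℂ (k i) F‖ ^ 2 ≤ B ^ 2 * ‖F‖ ^ 2 := by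
  -- Synthesis tested on the coefficients ⟨k_i, F⟩ themselves gives σ² ≤ B² σ ‖F‖², and one factor σ
  -- cancels.
  set σ := ∑ i ∈ S, ‖inner ℂ (k i) F‖ ^ 2 with hσ
  have h0 : 0 ≤ σ := Finset.sum_nonneg fun i _ => by positivity
  have h1 : inner ℂ (∑ i ∈ S, inner ℂ (k i) F • k i) F = (σ : ℂ) := by
    rw [sum_inner, hσ]
    push_cast
    refine Finset.sum_congr rfl fun i _ => ?_
    rw [inner_smul_left, mul_comm, Complex.mul_conj, Complex.normSq_eq_norm_sq]
    norm_cast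
  have h2 : σ ≤ ‖∑ i ∈ S, inner ℂ (k i) F • k i‖ * ‖F‖ := by
    have := norm_inner_le_norm (𝕜 := ℂ) (∑ i ∈ S, inner ℂ (k i) F • k i) F
    rw [h1, Complex.norm_real, Real.norm_of_nonneg h0] at this
    exact this
  have h3 := hk S fun i => inner ℂ (k i) F
  rw [← hσ] at h3
  have h4 : σ ^ 2 ≤ (B ^ 2 * σ) * ‖F‖ ^ 2 := by
    calc σ ^ 2 ≤ (‖∑ i ∈ S, inner ℂ (k i) F • k i‖ * ‖F‖) ^ 2 := by gcongr
      _ = ‖∑ i ∈ S, inner ℂ (k i) F • k i‖ ^ 2 * ‖F‖ ^ 2 := by ring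
      _ ≤ _ := by gcongr
  rcases h0.eq_or_lt with h | h
  · rw [← h]; positivity
  · have : σ * σ ≤ (B ^ 2 * ‖F‖ ^ 2) * σ := by nlinarith
    exact le_of_mul_le_mul_right this h

/-- The analysis operator of a Bessel family. -/
theorem exists_analysis {k : ι → H} {B : ℝ} (hB : 0 ≤ B)
    (hk : ∀ (S : Finset ι) (F : H), ∑ i ∈ S, ‖inner ℂ (k i) F‖ ^ 2 ≤ B ^ 2 * ‖F‖ ^ 2) :
    ∃ A : H →L[ℂ] lp (fun _ : ι => ℂ) 2, (∀ F i, A F i = inner ℂ (k i) F) ∧ ‖A‖ ≤ B := by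
  have hp : (0 : ℝ) < (2 : ENNReal).toReal := by norm_num
  have hmem : ∀ F : H, Memℓp (fun i => inner ℂ (k i) F : ι → ℂ) 2 := fun F => by
    refine memℓp_gen' (C := B ^ 2 * ‖F‖ ^ 2) fun S => ?_
    simpa using hk S F
  let A₀ : H →ₗ[ℂ] lp (fun _ : ι => ℂ) 2 :=
    { toFun := fun F => ⟨fun i => inner ℂ (k i) F, hmem F⟩
      map_add' := fun F G => by
        ext i
        exact inner_add_right _ _ _
      map_smul' := fun c F => by
        ext i
        exact inner_smul_right _ _ _ }
  have hA : ∀ F, ‖A₀ F‖ ≤ B * ‖F‖ := fun F => by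
    refine lp.norm_le_of_forall_sum_le hp (by positivity) fun S => ?_
    have := hk S F
    simp only [ENNReal.toReal_ofNat, Real.rpow_ofNat]
    rw [mul_pow]
    exact this
  exact ⟨A₀.mkContinuous B hA, fun F i => rfl, A₀.mkContinuous_norm_le hB hA⟩

/-- A family which is close to a Hilbert basis is a frame. -/
theorem exists_frame_of_near_hilbertBasis [CompleteSpace H] (b : HilbertBasis ι ℂ H) {x : ι → H}
    {ε : ℝ} (hε0 : 0 ≤ ε) (hε : ε < 1)
    (hx : ∀ (S : Finset ι) (c : ι → ℂ),
      ‖∑ i ∈ S, c i • (x i - b i)‖ ^ 2 ≤ ε ^ 2 * ∑ i ∈ S, ‖c i‖ ^ 2) :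
    ∃ T : H ≃L[ℂ] H, ∀ F, HasSum (fun i => inner ℂ (x i) F • x i) (T F) := by
  classical
  obtain ⟨R, hR, hRε⟩ := exists_analysis hε0 (sum_sq_inner_le_of_synthesis hx)
  -- The analysis operator of `x` is that of `b` plus `R`, that is (1 + V) ∘ b.repr with ‖V‖ ≤ ε <
  -- 1, so a Neumann series inverts it.
  let V : lp (fun _ : ι => ℂ) 2 →L[ℂ] lp (fun _ : ι => ℂ) 2 :=
    R ∘L (b.repr.symm.toContinuousLinearEquiv : lp (fun _ : ι => ℂ) 2 →L[ℂ] H)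
  have hV : ‖-V‖ < 1 := by
    rw [norm_neg]
    refine lt_of_le_of_lt ?_ hε
    refine ContinuousLinearMap.opNorm_le_bound _ hε0 fun y => ?_
    calc ‖R (b.repr.symm y)‖ ≤ ‖R‖ * ‖b.repr.symm y‖ := R.le_opNorm _
      _ = ‖R‖ * ‖y‖ := by rw [LinearIsometryEquiv.norm_map]
      _ ≤ ε * ‖y‖ := by gcongr
  let u := Units.oneSub (-V) hV
  let A : H ≃L[ℂ] lp (fun _ : ι => ℂ) 2 :=
    b.repr.toContinuousLinearEquiv.trans (ContinuousLinearEquiv.unitsEquiv ℂ _ u)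
  have hA : ∀ F i, A F i = inner ℂ (x i) F := fun F i => by
    have : A F = b.repr F + R F := by
      change (1 - -V) (b.repr F) = _
      simp [V]
    rw [this, lp.coeFn_add, Pi.add_apply, hR, b.repr_apply_apply, ← inner_add_left]
    congr 1
    abel
  -- The adjoint sends the i-th unit vector to `x i`, so the frame operator is A* A; it is
  -- invertible because the adjoint of A⁻¹ inverts A*.
  let A' : lp (fun _ : ι => ℂ) 2 →L[ℂ] H := ContinuousLinearMap.adjoint (A : H →L[ℂ] _)
  have hA' : ∀ i, A' (lp.single 2 i 1) = x i := fun i => by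
    refine ext_inner_right ℂ fun F => ?_
    rw [ContinuousLinearMap.adjoint_inner_left, lp.inner_single_left]
    simp [hA]
  let A₁ : H →L[ℂ] lp (fun _ : ι => ℂ) 2 := A
  let A₂ : lp (fun _ : ι => ℂ) 2 →L[ℂ] H := A.symm
  have h12 : A₁ ∘L A₂ = .id ℂ _ := by ext1 y; simp [A₁, A₂]
  have h21 : A₂ ∘L A₁ = .id ℂ _ := by ext1 y; simp [A₁, A₂]
  let B : lp (fun _ : ι => ℂ) 2 ≃L[ℂ] H := ContinuousLinearEquiv.equivOfInverse A'
    (ContinuousLinearMap.adjoint A₂)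
    (fun y => by
      refine ext_inner_right ℂ fun z => ?_
      rw [ContinuousLinearMap.adjoint_inner_left, ContinuousLinearMap.adjoint_inner_left]
      exact congrArg _ (DFunLike.congr_fun h12 z))
    (fun y => by
      refine ext_inner_right ℂ fun z => ?_
      rw [ContinuousLinearMap.adjoint_inner_left, ContinuousLinearMap.adjoint_inner_left]
      exact congrArg _ (DFunLike.congr_fun h21 z))
  refine ⟨A.trans B, fun F => ?_⟩
  have h1 := (lp.hasSum_single (p := 2) (by norm_num) (A F)).mapL A'
  change HasSum _ (A' (A F))
  convert h1 using 1
  funext i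
  have : lp.single (E := fun _ : ι => ℂ) 2 i (A F i) = (A F i) • lp.single 2 i (1 : ℂ) := by
    rw [← lp.single_smul]; simp
  rw [this, map_smul, hA', hA]

/-- Coefficients with respect to the canonical dual frame. -/
theorem sum_sq_inner_frame_inv_le {x : ι → H} (T : H ≃L[ℂ] H)
    (hT : ∀ F, HasSum (fun i => inner ℂ (x i) F • x i) (T F)) (S : Finset ι) (F : H) :
    ∑ i ∈ S, ‖inner ℂ (x i) (T.symm F)‖ ^ 2 ≤ ‖(T.symm : H →L[ℂ] H)‖ * ‖F‖ ^ 2 := by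
  -- Pairing the expansion of T(T⁻¹F) = F with T⁻¹F turns the sum of squares into ⟨T⁻¹F, F⟩, which
  -- costs a single power of ‖T⁻¹‖.
  have h1 := (hT (T.symm F)).mapL (innerSL ℂ (T.symm F))
  simp only [ContinuousLinearEquiv.apply_symm_apply, innerSL_apply_apply, inner_smul_right] at h1
  have h2 := (Complex.hasSum_iff _ _).1 h1 |>.1
  have h3 : ∀ i, (inner ℂ (x i) (T.symm F) * inner ℂ (T.symm F) (x i)).re =
      ‖inner ℂ (x i) (T.symm F)‖ ^ 2 := fun i => by
    rw [← inner_conj_symm (T.symm F) (x i), Complex.mul_conj, Complex.normSq_eq_norm_sq,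
      Complex.ofReal_re]
  simp only [h3] at h2
  calc _ ≤ (inner ℂ (T.symm F) F).re := sum_le_hasSum S (fun i _ => by positivity) h2
    _ ≤ ‖inner ℂ (T.symm F) F‖ := Complex.re_le_norm _
    _ ≤ ‖T.symm F‖ * ‖F‖ := norm_inner_le_norm _ _
    _ ≤ (‖(T.symm : H →L[ℂ] H)‖ * ‖F‖) * ‖F‖ := by
        gcongr; exact (T.symm : H →L[ℂ] H).le_opNorm F
    _ = _ := by ring

/-! ### Almost orthogonality across scales -/

theorem sum_geom_half_le (S : Finset ℕ) : ∑ m ∈ S, (2 : ℝ) ^ (-(m : ℝ) / 2) ≤ 4 := by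
  set q : ℝ := (2 : ℝ) ^ (-(1 / 2) : ℝ) with hq
  have hq0 : 0 < q := by positivity
  have hq2 : q * q = 1 / 2 := by
    rw [hq, ← Real.rpow_add (by norm_num)]; norm_num [Real.rpow_neg_one]
  have hq1 : q ≤ 3 / 4 := by nlinarith
  have h : ∀ m : ℕ, (2 : ℝ) ^ (-(m : ℝ) / 2) = q ^ m := fun m => by
    rw [hq, ← Real.rpow_natCast, ← Real.rpow_mul (by norm_num)]; congr 1; ring
  simp only [h]
  calc ∑ m ∈ S, q ^ m ≤ ∑' m, q ^ m :=
        (summable_geometric_of_lt_one hq0.le (by linarith)).sum_le_tsum _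
          (fun m _ => by positivity)
    _ = (1 - q)⁻¹ := tsum_geometric_of_lt_one hq0.le (by linarith)
    _ ≤ (1 / 4)⁻¹ := by gcongr; linarith
    _ = 4 := by norm_num

theorem sum_geom_abs_sub_le (S : Finset ℤ) (s : ℤ) :
    ∑ t ∈ S, (2 : ℝ) ^ (-|(s : ℝ) - t| / 2) ≤ 8 := by
  -- On either side of `s` the distance to `s` determines `t`, so each half is dominated by a
  -- one-sided geometric series.
  have key : ∀ S' : Finset ℤ, Set.InjOn (fun t => (s - t).natAbs) S' →
      ∑ t ∈ S', (2 : ℝ) ^ (-|(s : ℝ) - t| / 2) ≤ 4 := fun S' h => by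
    refine le_trans (le_of_eq ?_) (sum_geom_half_le (S'.image fun t => (s - t).natAbs))
    rw [Finset.sum_image h]
    refine Finset.sum_congr rfl fun t _ => ?_
    rw [Nat.cast_natAbs]
    push_cast
    rfl
  rw [← Finset.sum_filter_add_sum_filter_not S fun t => s ≤ t]
  have h1 := key (S.filter fun t => s ≤ t) fun a ha b hb hab => by
    simp at ha hb hab; omega
  have h2 := key (S.filter fun t => ¬ s ≤ t) fun a ha b hb hab => by
    simp at ha hb hab; omega
  linarith

/-- Families whose interaction between scales decays geometrically are Bessel families. -/
theorem norm_sq_sum_le_of_scale_decay {J : Type*} {k : ℤ × J → H} {B : ℝ}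
    (hB : 0 ≤ B)
    (hk : ∀ (s t : ℤ) (c : J → ℂ) (S S' : Finset J), s ≤ t →
      ∑ j ∈ S', ‖inner ℂ (∑ i ∈ S, c i • k (s, i)) (k (t, j))‖ ^ 2 ≤
        (B * (2 : ℝ) ^ (-((t : ℝ) - s) / 2)) ^ 2 * ∑ i ∈ S, ‖c i‖ ^ 2)
    (S : Finset (ℤ × J)) (c : ℤ × J → ℂ) :
    ‖∑ I ∈ S, c I • k I‖ ^ 2 ≤ 8 * B * ∑ I ∈ S, ‖c I‖ ^ 2 := by
  classical
  -- Extending the coefficients by zero to a product set lets the sum be grouped by scale.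
  wlog hS : ∃ (S₁ : Finset ℤ) (S₂ : Finset J), S = S₁ ×ˢ S₂ generalizing S c
  · have hsub : S ⊆ S.image Prod.fst ×ˢ S.image Prod.snd := fun I hI =>
      Finset.mem_product.2 ⟨Finset.mem_image_of_mem _ hI, Finset.mem_image_of_mem _ hI⟩
    have := this (S.image Prod.fst ×ˢ S.image Prod.snd) (fun I => if I ∈ S then c I else 0)
      ⟨_, _, rfl⟩
    have e1 : ∑ I ∈ S, c I • k I =
        ∑ I ∈ S.image Prod.fst ×ˢ S.image Prod.snd, (if I ∈ S then c I else 0) • k I := by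
      rw [← Finset.sum_subset hsub fun I _ hI => by rw [if_neg hI, zero_smul]]
      exact Finset.sum_congr rfl fun I hI => by rw [if_pos hI]
    have e2 : ∑ I ∈ S, ‖c I‖ ^ 2 =
        ∑ I ∈ S.image Prod.fst ×ˢ S.image Prod.snd, ‖if I ∈ S then c I else 0‖ ^ 2 := by
      rw [← Finset.sum_subset hsub fun I _ hI => by rw [if_neg hI, norm_zero]; norm_num]
      exact Finset.sum_congr rfl fun I hI => by rw [if_pos hI]
    rw [e1, e2]
    exact this
  obtain ⟨S₁, S₂, rfl⟩ := hS
  rw [Finset.sum_product, Finset.sum_product]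
  set f : ℤ → H := fun s => ∑ j ∈ S₂, c (s, j) • k (s, j) with hf
  set a : ℤ → ℝ := fun s => ∑ j ∈ S₂, ‖c (s, j)‖ ^ 2 with ha
  have ha0 : ∀ s, 0 ≤ a s := fun s => Finset.sum_nonneg fun _ _ => by positivity
  -- The whole coarse function is tested against the individual fine elements; Cauchy–Schwarz in `j`
  -- and the inequality of arithmetic and geometric means do the rest.
  have hle : ∀ s t : ℤ, s ≤ t → ‖inner ℂ (f s) (f t)‖ ≤
      B * (2 : ℝ) ^ (-|(s : ℝ) - t| / 2) * ((a s + a t) / 2) := fun s t hst => by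
    have hst' : (s : ℝ) ≤ t := by exact_mod_cast hst
    have h1 := hk s t (fun j => c (s, j)) S₂ S₂ hst
    have h2 : ‖inner ℂ (f s) (f t)‖ ≤ ∑ j ∈ S₂, ‖c (t, j)‖ * ‖inner ℂ (f s) (k (t, j))‖ := by
      rw [hf]
      simp only [inner_sum (𝕜 := ℂ) S₂ _ (∑ j ∈ S₂, c (s, j) • k (s, j)), inner_smul_right]
      exact (norm_sum_le _ _).trans (le_of_eq (by simp only [norm_mul]))
    have h3 := Finset.sum_mul_sq_le_sq_mul_sq S₂ (fun j => ‖c (t, j)‖)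
      (fun j => ‖inner ℂ (f s) (k (t, j))‖)
    rw [abs_sub_comm, abs_of_nonneg (sub_nonneg.2 hst')]
    set Q := B * (2 : ℝ) ^ (-((t : ℝ) - s) / 2) with hQ
    have hQ0 : 0 ≤ Q := by positivity
    refine h2.trans (abs_le_of_sq_le_sq' ?_ (by have := ha0 s; have := ha0 t; positivity)).2
    calc _ ≤ _ := h3
      _ ≤ a t * (Q ^ 2 * a s) := by gcongr
      _ = Q ^ 2 * (a s * a t) := by ring
      _ ≤ Q ^ 2 * (((a s + a t) / 2) ^ 2) := by
          gcongr; nlinarith [sq_nonneg (a s - a t)]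
      _ = _ := by ring
  have hall : ∀ s t : ℤ, ‖inner ℂ (f s) (f t)‖ ≤
      B * (2 : ℝ) ^ (-|(s : ℝ) - t| / 2) * ((a s + a t) / 2) := fun s t => by
    rcases le_total s t with h | h
    · exact hle s t h
    · rw [norm_inner_symm, abs_sub_comm, add_comm]; exact hle t s h
  have hexp : ‖∑ s ∈ S₁, f s‖ ^ 2 ≤ ∑ s ∈ S₁, ∑ t ∈ S₁, ‖inner ℂ (f s) (f t)‖ := by
    rw [← @inner_self_eq_norm_sq ℂ, sum_inner]
    refine (Complex.re_le_norm _).trans ((norm_sum_le _ _).trans ?_)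
    refine Finset.sum_le_sum fun s _ => ?_
    rw [inner_sum]
    exact norm_sum_le _ _
  refine hexp.trans ?_
  calc _ ≤ ∑ s ∈ S₁, ∑ t ∈ S₁, B * (2 : ℝ) ^ (-|(s : ℝ) - t| / 2) * ((a s + a t) / 2) :=
        Finset.sum_le_sum fun s _ => Finset.sum_le_sum fun t _ => hall s t
    _ = ∑ s ∈ S₁, ∑ t ∈ S₁, (B / 2 * a s) * (2 : ℝ) ^ (-|(s : ℝ) - t| / 2) +
        ∑ s ∈ S₁, ∑ t ∈ S₁, (B / 2 * a t) * (2 : ℝ) ^ (-|(s : ℝ) - t| / 2) := by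
        rw [← Finset.sum_add_distrib]
        refine Finset.sum_congr rfl fun s _ => ?_
        rw [← Finset.sum_add_distrib]
        exact Finset.sum_congr rfl fun t _ => by ring
    _ = 2 * ∑ s ∈ S₁, ∑ t ∈ S₁, (B / 2 * a s) * (2 : ℝ) ^ (-|(s : ℝ) - t| / 2) := by
        rw [two_mul]
        congr 1
        rw [Finset.sum_comm]
        simp_rw [abs_sub_comm]
    -- Schur's test: every row of the matrix 2^{-|s-t|/2} sums to at most 8.
    _ ≤ 2 * ∑ s ∈ S₁, (B / 2 * a s) * 8 := by
        gcongr with s hs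
        rw [← Finset.mul_sum]
        have := ha0 s
        gcongr
        exact sum_geom_abs_sub_le S₁ s
    _ = _ := by rw [← Finset.sum_mul, ← Finset.mul_sum]; ring

end Frames

/-! ### Square integrable functions -/

section SquareIntegrable

variable {n : ℕ}

/-- `∫ |f|²`. -/
noncomputable def l2sq {F : Type*} [ENorm F] (f : E n → F) : ENNReal := ∫⁻ x, ‖f x‖ₑ ^ 2

theorem sq_lintegral_mul_le {α : Type*} [MeasurableSpace α] {μ : Measure α} {f g : α → ENNReal}
    (hf : AEMeasurable f μ) (hg : AEMeasurable g μ) :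
    (∫⁻ x, f x * g x ∂μ) ^ 2 ≤ (∫⁻ x, f x ^ 2 ∂μ) * ∫⁻ x, g x ^ 2 ∂μ := by
  have h := ENNReal.lintegral_mul_le_Lp_mul_Lq μ Real.HolderConjugate.two_two hf hg
  simp only [Pi.mul_apply, ENNReal.rpow_ofNat] at h
  calc _ ≤ ((∫⁻ x, f x ^ 2 ∂μ) ^ (1 / 2 : ℝ) * (∫⁻ x, g x ^ 2 ∂μ) ^ (1 / 2 : ℝ)) ^ 2 := by
        gcongr
    _ = _ := by
        rw [mul_pow, ← ENNReal.rpow_natCast, ← ENNReal.rpow_natCast, ← ENNReal.rpow_mul,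
          ← ENNReal.rpow_mul]
        norm_num

theorem eLpNorm_two_sq {α F : Type*} [MeasurableSpace α] {μ : Measure α} [NormedAddCommGroup F]
    (f : α → F) : eLpNorm f 2 μ ^ 2 = ∫⁻ x, ‖f x‖ₑ ^ 2 ∂μ := by
  have := eLpNorm_nnreal_pow_eq_lintegral (μ := μ) (f := f) (p := 2) (by norm_num)
  simpa using this

theorem toL2_eq {g : E n → ℂ} (hg : MemLp g 2) : toL2 g = hg.toLp g := by
  rw [toL2, dif_pos hg]

theorem coeFn_toL2 {g : E n → ℂ} (hg : MemLp g 2) : toL2 g =ᵐ[volume] g := by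
  rw [toL2_eq hg]; exact hg.coeFn_toLp

theorem ofReal_norm_toL2_sq {g : E n → ℂ} (hg : MemLp g 2) :
    ENNReal.ofReal (‖toL2 g‖ ^ 2) = l2sq g := by
  rw [toL2_eq hg, l2sq, ← eLpNorm_two_sq, ← Lp.enorm_toLp hg, ENNReal.ofReal_pow (norm_nonneg _),
    ofReal_norm]

theorem toL2_add {f g : E n → ℂ} (hf : MemLp f 2) (hg : MemLp g 2) :
    toL2 (fun x => f x + g x) = toL2 f + toL2 g := by
  rw [toL2_eq hf, toL2_eq hg, ← MemLp.toLp_add, ← toL2_eq (hf.add hg)]; rfl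

theorem toL2_sub {f g : E n → ℂ} (hf : MemLp f 2) (hg : MemLp g 2) :
    toL2 (fun x => f x - g x) = toL2 f - toL2 g := by
  rw [toL2_eq hf, toL2_eq hg, ← MemLp.toLp_sub, ← toL2_eq (hf.sub hg)]; rfl

theorem toL2_const_mul {f : E n → ℂ} (hf : MemLp f 2) (c : ℂ) :
    toL2 (fun x => c * f x) = c • toL2 f := by
  rw [toL2_eq hf, ← MemLp.toLp_const_smul, ← toL2_eq (hf.const_smul c)]; rfl

theorem toL2_zero : toL2 (fun _ : E n => (0 : ℂ)) = 0 := by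
  have := toL2_const_mul (n := n) (f := fun _ => (0 : ℂ)) MemLp.zero' 0
  simpa using this

theorem toL2_sum {ι : Type*} (S : Finset ι) (c : ι → ℂ) {f : ι → E n → ℂ}
    (hf : ∀ i ∈ S, MemLp (f i) 2) :
    toL2 (fun x => ∑ i ∈ S, c i * f i x) = ∑ i ∈ S, c i • toL2 (f i) := by
  classical
  induction S using Finset.induction_on with
  | empty => simpa using toL2_zero
  | insert a S ha ih =>
    have h1 : MemLp (fun x => c a * f a x) 2 :=
      (hf a (Finset.mem_insert_self a S)).const_mul (c a)
    have h2 : MemLp (fun x => ∑ i ∈ S, c i * f i x) 2 :=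
      memLp_finsetSum S fun i hi => (hf i (Finset.mem_insert_of_mem hi)).const_mul (c i)
    simp only [Finset.sum_insert ha]
    rw [toL2_add h1 h2, ih fun i hi => hf i (Finset.mem_insert_of_mem hi),
      toL2_const_mul (hf a (Finset.mem_insert_self a S))]

theorem inner_toL2 {f g : E n → ℂ} (hf : MemLp f 2) (hg : MemLp g 2) :
    inner ℂ (toL2 f) (toL2 g) = ∫ x, (starRingEnd ℂ) (f x) * g x := by
  rw [L2.inner_def]
  refine integral_congr_ae ?_
  filter_upwards [coeFn_toL2 hf, coeFn_toL2 hg] with x h1 h2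
  rw [h1, h2, RCLike.inner_apply, mul_comm]

/-- A real function in `L²`. -/
noncomputable abbrev realL2 (u : E n → ℝ) : L2 n := toL2 fun x => (u x : ℂ)

theorem memLp_ofReal {u : E n → ℝ} {p : ENNReal} (hu : MemLp u p) :
    MemLp (fun x => (u x : ℂ)) p := hu.ofReal

theorem inner_realL2 {f g : E n → ℝ} (hf : MemLp f 2) (hg : MemLp g 2) :
    inner ℂ (realL2 f) (realL2 g) = ((∫ x, f x * g x : ℝ) : ℂ) := by
  rw [realL2, realL2, inner_toL2 (memLp_ofReal hf) (memLp_ofReal hg), ← integral_complex_ofReal]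
  simp

theorem l2sq_ofReal (u : E n → ℝ) : l2sq (fun x => (u x : ℂ)) = l2sq u := by
  simp only [l2sq, enorm_eq_nnnorm, Complex.nnnorm_real]

theorem ofReal_norm_realL2_sq {u : E n → ℝ} (hu : MemLp u 2) :
    ENNReal.ofReal (‖realL2 u‖ ^ 2) = l2sq u := by
  rw [realL2, ofReal_norm_toL2_sq (memLp_ofReal hu), l2sq_ofReal]

end SquareIntegrable

/-! ### Dilations and translations of a mother function -/

section Wavelets

variable {n : ℕ}

/-- The integer vector `j` as a point of `ℝⁿ`. -/
noncomputable abbrev latticePt (j : Fin n → ℤ) : E n := WithLp.toLp 2 fun i => (j i : ℝ)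

/-- The cube `{|x i| ≤ R}`. -/
def box (n : ℕ) (R : ℝ) : Set (E n) := {x | ∀ i, |x i| ≤ R}

theorem map_affine_volume (s : ℤ) (b : E n) :
    Measure.map (fun x : E n => (2 : ℝ) ^ s • x - b) volume =
      ENNReal.ofReal (((2 : ℝ) ^ s) ^ n)⁻¹ • volume := by
  have h2 : (0 : ℝ) < 2 ^ s := by positivity
  have h1 : (fun x : E n => (2 : ℝ) ^ s • x - b) = (fun x => x - b) ∘ fun x => (2 : ℝ) ^ s • x :=
    rfl
  rw [h1, ← Measure.map_map (measurable_sub_const b) (measurable_const_smul _),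
    Measure.map_addHaar_smul _ h2.ne', Measure.map_smul, map_sub_right_eq_self]
  rw [finrank_euclideanSpace_fin, abs_of_pos (by positivity)]

theorem integral_comp_affine {F : Type*} [NormedAddCommGroup F] [NormedSpace ℝ F] (f : E n → F)
    (s : ℤ) (b : E n) :
    ∫ x, f ((2 : ℝ) ^ s • x - b) = (((2 : ℝ) ^ s) ^ n)⁻¹ • ∫ x, f x := by
  have h2 : (0 : ℝ) < 2 ^ s := by positivity
  rw [Measure.integral_comp_smul volume (fun x => f (x - b)), integral_sub_right_eq_self,
    finrank_euclideanSpace_fin, abs_of_pos (by positivity)]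

theorem memLp_comp_affine {F : Type*} [NormedAddCommGroup F] {f : E n → F} {p : ENNReal}
    (hf : MemLp f p) (s : ℤ) (b : E n) : MemLp (fun x => f ((2 : ℝ) ^ s • x - b)) p := by
  have hm : Measurable fun x : E n => (2 : ℝ) ^ s • x - b := by fun_prop
  have h : MemLp f p (Measure.map (fun x : E n => (2 : ℝ) ^ s • x - b) volume) := by
    rw [map_affine_volume]
    exact hf.smul_measure ENNReal.ofReal_ne_top
  exact (memLp_map_measure_iff h.1 hm.aemeasurable).1 h

theorem wavelet_zero_eq (u : E n → ℝ) (s : ℤ) (j : Fin n → ℤ) :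
    wavelet u 0 s j = fun x => (2 : ℝ) ^ ((s : ℝ) * n / 2) * u ((2 : ℝ) ^ s • x - latticePt j) := by
  funext x
  rw [wavelet, sub_zero]

theorem wavelet_eq_translate (u : E n → ℝ) (v : E n) (s : ℤ) (j : Fin n → ℤ) (x : E n) :
    wavelet u v s j x = wavelet u 0 s j (x - v) := by
  simp [wavelet]

theorem memLp_wavelet {u : E n → ℝ} {p : ENNReal} (hu : MemLp u p) (s : ℤ) (j : Fin n → ℤ) :
    MemLp (wavelet u 0 s j) p := by
  rw [wavelet_zero_eq]
  exact (memLp_comp_affine hu s _).const_mul _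

theorem wavelet_smul (u : E n → ℝ) (s t : ℤ) (j : Fin n → ℤ) (x : E n) :
    wavelet u 0 s j ((2 : ℝ) ^ (-t) • x) =
      (2 : ℝ) ^ ((t : ℝ) * n / 2) * wavelet u 0 (s - t) j x := by
  simp only [wavelet_zero_eq]
  rw [← mul_assoc, ← Real.rpow_add (by norm_num), smul_smul,
    ← zpow_add₀ (by norm_num)]
  push_cast
  ring_nf

theorem two_rpow_half_sq (t : ℤ) :
    (2 : ℝ) ^ ((t : ℝ) * n / 2) * (2 : ℝ) ^ ((t : ℝ) * n / 2) = ((2 : ℝ) ^ t) ^ n := by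
  rw [← Real.rpow_add (by norm_num), ← Real.rpow_intCast, ← Real.rpow_mul_natCast (by norm_num)]
  ring_nf

/-- Dilation by a power of two is unitary and shifts all scales together, so one of the two scales
can be normalised to zero. -/
theorem integral_wavelet_mul (u w : E n → ℝ) (s t r : ℤ) (i j : Fin n → ℤ) :
    ∫ x, wavelet u 0 s i x * wavelet w 0 t j x =
      ∫ x, wavelet u 0 (s - r) i x * wavelet w 0 (t - r) j x := by
  have h := integral_comp_affine (fun x => wavelet u 0 s i x * wavelet w 0 t j x) (-r) (0 : E n)
  simp only [sub_zero, wavelet_smul, smul_eq_mul] at h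
  have h2 : (((2 : ℝ) ^ (-r)) ^ n)⁻¹ = ((2 : ℝ) ^ r) ^ n := by
    rw [zpow_neg, inv_pow, inv_inv]
  have h3 : (0 : ℝ) < ((2 : ℝ) ^ r) ^ n := by positivity
  rw [h2, ← two_rpow_half_sq] at h
  rw [← two_rpow_half_sq] at h3
  refine mul_left_cancel₀ h3.ne' ?_
  rw [← h, ← integral_const_mul]
  congr 1
  funext x
  ring

theorem inner_wavelet {u w : E n → ℝ} (hu : MemLp u 2) (hw : MemLp w 2) (s t r : ℤ)
    (i j : Fin n → ℤ) :
    inner ℂ (realL2 (wavelet u 0 s i)) (realL2 (wavelet w 0 t j)) =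
      inner ℂ (realL2 (wavelet u 0 (s - r) i)) (realL2 (wavelet w 0 (t - r) j)) := by
  rw [inner_realL2 (memLp_wavelet hu s i) (memLp_wavelet hw t j),
    inner_realL2 (memLp_wavelet hu _ i) (memLp_wavelet hw _ j), integral_wavelet_mul u w s t r]

/-- The Gram matrix of wavelets of one scale does not depend on that scale. -/
theorem norm_sum_wavelet {u : E n → ℝ} (hu : MemLp u 2) (s t : ℤ) (S : Finset (Fin n → ℤ))
    (c : (Fin n → ℤ) → ℂ) :
    ‖∑ j ∈ S, c j • realL2 (wavelet u 0 s j)‖ = ‖∑ j ∈ S, c j • realL2 (wavelet u 0 t j)‖ := by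
  rw [@norm_eq_sqrt_re_inner ℂ, @norm_eq_sqrt_re_inner ℂ]
  simp only [sum_inner, inner_sum, inner_smul_left, inner_smul_right]
  congr 3
  simp_rw [inner_wavelet hu hu s s (s - t), sub_sub_cancel]

theorem card_lattice_le (R : ℕ) (x : E n) (S : Finset (Fin n → ℤ))
    (hS : ∀ j ∈ S, x - latticePt j ∈ box n R) : S.card ≤ (2 * R + 1) ^ n := by
  have hsub : S ⊆ Fintype.piFinset fun i => Finset.Icc ⌈x i - R⌉ ⌊x i + R⌋ := fun j hj => by
    rw [Fintype.mem_piFinset]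
    intro i
    have := abs_le.1 (hS j hj i)
    simp only [PiLp.sub_apply] at this
    rw [Finset.mem_Icc, Int.ceil_le, Int.le_floor]
    constructor <;> linarith [this.1, this.2]
  refine (Finset.card_le_card hsub).trans ?_
  rw [Fintype.card_piFinset]
  refine (Finset.prod_le_pow_card _ _ (2 * R + 1) fun i _ => ?_).trans (by simp)
  rw [Int.card_Icc]
  have h1 : (⌊x i + R⌋ : ℝ) ≤ x i + R := Int.floor_le _
  have h2 : x i - R ≤ (⌈x i - R⌉ : ℝ) := Int.le_ceil _
  have h3 : (⌊x i + R⌋ : ℝ) - ⌈x i - R⌉ ≤ 2 * R := by linarith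
  have h4 : ⌊x i + R⌋ - ⌈x i - R⌉ ≤ 2 * R := by exact_mod_cast h3
  omega

/-- Integer translates of a compactly supported function have bounded overlap. -/
theorem norm_sq_sum_wavelet_le {u : E n → ℝ} (hu : MemLp u 2) {R : ℕ}
    (hR : Function.support u ⊆ box n R) (s : ℤ) (S : Finset (Fin n → ℤ))
    (c : (Fin n → ℤ) → ℂ) :
    ‖∑ j ∈ S, c j • realL2 (wavelet u 0 s j)‖ ^ 2 ≤
      (2 * R + 1) ^ n * ‖realL2 u‖ ^ 2 * ∑ j ∈ S, ‖c j‖ ^ 2 := by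
  classical
  rw [norm_sum_wavelet hu s 0]
  have hw : ∀ j, wavelet u 0 0 j = fun x => u (x - latticePt j) := fun j => by
    rw [wavelet_zero_eq]; simp
  have hm : ∀ j ∈ S, MemLp (fun x => (wavelet u 0 0 j x : ℂ)) 2 := fun j _ =>
    (memLp_wavelet hu 0 j).ofReal
  rw [← toL2_sum S c hm]
  rw [← ENNReal.ofReal_le_ofReal_iff (by positivity), ofReal_norm_toL2_sq
    (memLp_finsetSum S fun i hi => (hm i hi).const_mul (c i))]
  have hpt : ∀ x, ‖∑ j ∈ S, c j * (wavelet u 0 0 j x : ℂ)‖ₑ ^ 2 ≤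
      ∑ j ∈ S, ENNReal.ofReal ((2 * R + 1) ^ n * ‖c j‖ ^ 2) * ‖u (x - latticePt j)‖ₑ ^ 2 :=
    fun x => by
    -- At each point at most (2R+1)^n translates are nonzero, which is all that Cauchy–Schwarz
    -- costs.
    set S' := S.filter fun j => u (x - latticePt j) ≠ 0
    have hS' : (S'.card : ℝ) ≤ (2 * R + 1) ^ n := by
      have := card_lattice_le R x S' fun j hj => hR (Finset.mem_filter.1 hj).2
      exact_mod_cast this
    have e1 : ∑ j ∈ S, c j * (wavelet u 0 0 j x : ℂ) =
        ∑ j ∈ S', c j * (u (x - latticePt j) : ℂ) := by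
      rw [Finset.sum_filter]
      refine Finset.sum_congr rfl fun j _ => ?_
      rw [hw]
      split_ifs with h
      · rfl
      · simp [not_not.1 h]
    have h1 : ‖∑ j ∈ S', c j * (u (x - latticePt j) : ℂ)‖ ^ 2 ≤
        ∑ j ∈ S, ((2 * R + 1) ^ n * ‖c j‖ ^ 2) * ‖u (x - latticePt j)‖ ^ 2 := by
      calc _ ≤ (∑ j ∈ S', ‖c j * (u (x - latticePt j) : ℂ)‖) ^ 2 := by
            gcongr; exact norm_sum_le _ _
        _ ≤ S'.card * ∑ j ∈ S', ‖c j * (u (x - latticePt j) : ℂ)‖ ^ 2 :=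
            sq_sum_le_card_mul_sum_sq
        _ ≤ (2 * R + 1) ^ n * ∑ j ∈ S, ‖c j * (u (x - latticePt j) : ℂ)‖ ^ 2 := by
            gcongr
            exact Finset.filter_subset _ _
        _ = _ := by
            rw [Finset.mul_sum]
            refine Finset.sum_congr rfl fun j _ => ?_
            rw [norm_mul, Complex.norm_real]; ring
    rw [e1]
    calc _ = ENNReal.ofReal (‖∑ j ∈ S', c j * (u (x - latticePt j) : ℂ)‖ ^ 2) := by
          rw [ENNReal.ofReal_pow (norm_nonneg _), ofReal_norm]
      _ ≤ _ := ENNReal.ofReal_le_ofReal h1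
      _ = _ := by
          rw [ENNReal.ofReal_sum_of_nonneg fun j _ => by positivity]
          refine Finset.sum_congr rfl fun j _ => ?_
          rw [ENNReal.ofReal_mul (by positivity), ENNReal.ofReal_pow (norm_nonneg (u _)),
            ofReal_norm]
  refine (lintegral_mono hpt).trans (le_of_eq ?_)
  have hmeas : ∀ j, AEMeasurable fun x => ‖u (x - latticePt j)‖ₑ ^ 2 := fun j => by
    have := (memLp_wavelet hu 0 j).1
    rw [hw] at this
    exact (this.enorm).pow_const 2
  rw [lintegral_finsetSum' _ fun j _ => (hmeas j).const_mul _]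
  have h3 : ∀ j, ∫⁻ x, ENNReal.ofReal ((2 * R + 1) ^ n * ‖c j‖ ^ 2) * ‖u (x - latticePt j)‖ₑ ^ 2 =
      ENNReal.ofReal ((2 * R + 1) ^ n * ‖realL2 u‖ ^ 2 * ‖c j‖ ^ 2) := fun j => by
    rw [lintegral_const_mul' _ _ ENNReal.ofReal_ne_top]
    rw [lintegral_sub_right_eq_self (fun x => ‖u x‖ₑ ^ 2)]
    change _ * l2sq u = _
    rw [← ofReal_norm_realL2_sq hu, ← ENNReal.ofReal_mul (by positivity)]
    congr 1; ring
  simp only [h3]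
  rw [← ENNReal.ofReal_sum_of_nonneg fun j _ => by positivity, Finset.mul_sum]

end Wavelets

/-! ### Interaction of different scales -/

section CrossScale

variable {n : ℕ}

theorem volume_pi_Icc_euclidean (t : Fin n → Set ℝ) :
    volume {x : E n | ∀ i, x i ∈ t i} = ∏ i, volume (t i) := by
  have h := (EuclideanSpace.volume_preserving_symm_measurableEquiv_toLp (Fin n)).measure_preimage_equiv
    (Set.univ.pi t)
  rw [volume_pi_pi] at h
  rw [← h]
  congr 1
  ext x
  simp only [Set.mem_ofPred_eq, mem_preimage, mem_univ_pi]
  rfl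

theorem measurableSet_coord {t : Fin n → Set ℝ} (ht : ∀ i, MeasurableSet (t i)) :
    MeasurableSet {x : E n | ∀ i, x i ∈ t i} := by
  have : {x : E n | ∀ i, x i ∈ t i} = ⋂ i, (fun x : E n => x i) ⁻¹' t i := by ext; simp
  rw [this]
  exact MeasurableSet.iInter fun i => (by fun_prop : Measurable fun x : E n => x i) (ht i)

theorem volume_box {R : ℝ} : volume (box n R) = ENNReal.ofReal (2 * R) ^ n := by
  have : box n R = {x : E n | ∀ i, x i ∈ Icc (-R) R} := by
    ext x; simp [box, abs_le]
  rw [this, volume_pi_Icc_euclidean fun _ => Icc (-R) R]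
  simp [Real.volume_Icc, two_mul]

theorem measurableSet_box {R : ℝ} : MeasurableSet (box n R) := by
  have : box n R = {x : E n | ∀ i, x i ∈ Icc (-R) R} := by
    ext x; simp [box, abs_le]
  rw [this]
  exact measurableSet_coord fun _ => measurableSet_Icc

theorem volume_unitCube : volume (unitCube n) = 1 := by
  rw [unitCube, volume_pi_Icc_euclidean fun _ => Ico (0 : ℝ) 1]
  simp

theorem measurableSet_unitCube : MeasurableSet (unitCube n) :=
  measurableSet_coord fun _ => measurableSet_Ico

theorem disjoint_unitCube_translates {i j : Fin n → ℤ} (hij : i ≠ j) :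
    Disjoint {x : E n | x - latticePt i ∈ unitCube n} {x | x - latticePt j ∈ unitCube n} := by
  rw [Set.disjoint_left]
  intro x hi hj
  refine hij (funext fun l => ?_)
  have h1 := hi l
  have h2 := hj l
  simp only [PiLp.sub_apply, mem_Ico, sub_nonneg] at h1 h2
  have h3 : (i l : ℝ) < j l + 1 := by linarith
  have h4 : (j l : ℝ) < i l + 1 := by linarith
  norm_cast at h3 h4
  omega

/-- Testing a function against integer translates of a mean zero function is controlled by its
modulus of continuity. -/
theorem sum_sq_inner_translate_le {k : E n → ℝ} (hk : MemLp k 2) (hk1 : Integrable k) {R : ℕ}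
    (hR : Function.support k ⊆ box n R) (hmean : ∫ x, k x = 0) {f : E n → ℂ} (hfm : Measurable f)
    (hf : MemLp f 2) {σ : ENNReal}
    (hσ : ∀ z ∈ box n (R + 1), l2sq (fun y => f (y + z) - f y) ≤ σ) (S : Finset (Fin n → ℤ)) :
    ∑ j ∈ S, ‖inner ℂ (toL2 f) (realL2 (wavelet k 0 0 j))‖ₑ ^ 2 ≤
      (2 * R + 2) ^ n * l2sq k * σ := by
  have hw : ∀ j, wavelet k 0 0 j = fun x => k (x - latticePt j) := fun j => by
    rw [wavelet_zero_eq]; simp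
  set Φ : E n → ENNReal := fun y => ∫⁻ z in box n (R + 1), ‖f (y + z) - f y‖ₑ ^ 2 with hΦ
  have hmeas : Measurable fun p : E n × E n => ‖f (p.1 + p.2) - f p.1‖ₑ ^ 2 := by
    have h1 : Measurable fun p : E n × E n => f (p.1 + p.2) := hfm.comp (by fun_prop)
    have h2 : Measurable fun p : E n × E n => f p.1 := hfm.comp (by fun_prop)
    exact ((h1.sub h2).enorm).pow_const 2
  -- As `k` has mean zero, the constant f(y) may be subtracted for any y. Averaging later over the
  -- unit cube of index `j` turns the pairing into differences of f.
  have hkey : ∀ j, ∀ y, y - latticePt j ∈ unitCube n →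
      ‖inner ℂ (toL2 f) (realL2 (wavelet k 0 0 j))‖ₑ ^ 2 ≤ l2sq k * Φ y := fun j y hy => by
    have hkj : MemLp (fun x => (k (x - latticePt j) : ℂ)) 2 := by
      have := memLp_ofReal (memLp_wavelet hk 0 j)
      rwa [hw] at this
    have hkj1 : Integrable fun x => (k (x - latticePt j) : ℂ) := (hk1.comp_sub_right _).ofReal
    have hmean' : ∫ x, (k (x - latticePt j) : ℂ) = 0 := by
      rw [integral_complex_ofReal, integral_sub_right_eq_self, hmean]; simp
    have hconj : MemLp (fun x => (starRingEnd ℂ) (f x)) 2 :=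
      hf.star
    have e1 : inner ℂ (toL2 f) (realL2 (wavelet k 0 0 j)) =
        ∫ x, (starRingEnd ℂ) (f x - f y) * (k (x - latticePt j) : ℂ) := by
      have hi : Integrable fun x => (starRingEnd ℂ) (f x) * (k (x - latticePt j) : ℂ) :=
        hconj.integrable_mul hkj
      rw [hw, realL2, inner_toL2 hf hkj]
      have : ∀ x, (starRingEnd ℂ) (f x - f y) * (k (x - latticePt j) : ℂ) =
          (starRingEnd ℂ) (f x) * (k (x - latticePt j) : ℂ) -
          (starRingEnd ℂ) (f y) * (k (x - latticePt j) : ℂ) := fun x => by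
        rw [map_sub]; ring
      simp_rw [this]
      rw [integral_sub hi (hkj1.const_mul _), integral_const_mul, hmean', mul_zero, sub_zero]
    rw [e1]
    -- The indicator keeps the support of `k` on the side of f in Cauchy–Schwarz; with y in the unit
    -- cube of `j` it confines x - y to the box of radius R + 1.
    set ind : E n → ENNReal := (box n R).indicator 1 with hind
    have h2 : ‖∫ x, (starRingEnd ℂ) (f x - f y) * (k (x - latticePt j) : ℂ)‖ₑ ≤
        ∫⁻ x, (ind (x - latticePt j) * ‖f x - f y‖ₑ) * ‖k (x - latticePt j)‖ₑ := by
      refine (enorm_integral_le_lintegral_enorm _).trans (lintegral_mono fun x => ?_)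
      rw [enorm_mul]
      have a1 : ‖(starRingEnd ℂ) (f x - f y)‖ₑ = ‖f x - f y‖ₑ := by
        rw [← ofReal_norm, ← ofReal_norm, RCLike.norm_conj]
      have a2 : ‖(k (x - latticePt j) : ℂ)‖ₑ = ‖k (x - latticePt j)‖ₑ := by
        rw [← ofReal_norm, ← ofReal_norm, Complex.norm_real]
      rw [a1, a2]
      by_cases hx : k (x - latticePt j) = 0
      · simp [hx]
      · have : ind (x - latticePt j) = 1 := by
          rw [hind, indicator_of_mem (hR hx)]; rfl
        rw [this, one_mul]
    have hindm : Measurable ind := measurable_one.indicator measurableSet_box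
    have hm1 : AEMeasurable fun x => ind (x - latticePt j) * ‖f x - f y‖ₑ := by
      have : Measurable fun x => ind (x - latticePt j) := hindm.comp (by fun_prop)
      exact (this.mul (hfm.sub_const _).enorm).aemeasurable
    have hm2 : AEMeasurable fun x => ‖k (x - latticePt j)‖ₑ := (hk1.comp_sub_right _).1.enorm
    have h3 := sq_lintegral_mul_le hm1 hm2
    refine (pow_le_pow_left' h2 2).trans (h3.trans ?_)
    rw [mul_comm, lintegral_sub_right_eq_self (fun x => ‖k x‖ₑ ^ 2)]
    refine mul_le_mul' le_rfl ?_
    rw [← lintegral_add_left_eq_self _ y]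
    simp only [hΦ]
    rw [← lintegral_indicator measurableSet_box]
    refine lintegral_mono fun z => ?_
    by_cases hz : z ∈ box n (R + 1)
    · rw [indicator_of_mem hz]
      have : ind (y + z - latticePt j) ≤ 1 := by
        rw [hind]; exact indicator_le_self' (by simp) _
      calc _ ≤ (1 * ‖f (y + z) - f y‖ₑ) ^ 2 := by gcongr
        _ = _ := by rw [one_mul]
    · have : ind (y + z - latticePt j) = 0 := by
        rw [hind]
        refine indicator_of_notMem (fun hmem => hz fun i => ?_) _
        have h1 := abs_le.1 (hmem i)
        have h2 := hy i
        simp only [PiLp.sub_apply, PiLp.add_apply, mem_Ico] at h1 h2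
        rw [abs_le]
        constructor <;> linarith [h1.1, h1.2, h2.1, h2.2]
      simp [this]
  have hΦm : Measurable Φ := hmeas.lintegral_prod_right'
  have hcm : ∀ j : Fin n → ℤ, MeasurableSet {x : E n | x - latticePt j ∈ unitCube n} := fun j =>
    (by fun_prop : Measurable fun x : E n => x - latticePt j) measurableSet_unitCube
  have hcv : ∀ j : Fin n → ℤ, volume {x : E n | x - latticePt j ∈ unitCube n} = 1 := fun j => by
    have := (measurePreserving_sub_right (volume : Measure (E n)) (latticePt j)).measure_preimage
      (measurableSet_unitCube (n := n)).nullMeasurableSet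
    rw [volume_unitCube] at this
    exact this
  have hstep : ∀ j ∈ S, ‖inner ℂ (toL2 f) (realL2 (wavelet k 0 0 j))‖ₑ ^ 2 ≤
      l2sq k * ∫⁻ y in {x : E n | x - latticePt j ∈ unitCube n}, Φ y := fun j _ => by
    rw [← lintegral_const_mul _ hΦm]
    calc _ = ∫⁻ y in {x : E n | x - latticePt j ∈ unitCube n},
          ‖inner ℂ (toL2 f) (realL2 (wavelet k 0 0 j))‖ₑ ^ 2 := by
          rw [setLIntegral_const, hcv, mul_one]
      _ ≤ _ := setLIntegral_mono' (hcm j) fun y hy => hkey j y hy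
  -- The unit cubes are disjoint, so the sum over `j` is at most one integral over y; Fubini then
  -- brings out the L² moduli, integrated over a box of volume (2R+2)^n.
  refine (Finset.sum_le_sum hstep).trans ?_
  rw [← Finset.mul_sum, ← lintegral_biUnion_finset
    (fun i _ j _ hij => disjoint_unitCube_translates hij) fun j _ => hcm j]
  calc _ ≤ l2sq k * ∫⁻ y, Φ y := mul_le_mul' le_rfl (setLIntegral_le_lintegral _ _)
    _ = l2sq k * ∫⁻ z in box n (R + 1), l2sq (fun y => f (y + z) - f y) := by
        rw [hΦ, lintegral_lintegral_swap hmeas.aemeasurable]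
        rfl
    _ ≤ l2sq k * ∫⁻ z in box n (R + 1), σ := by
        gcongr 1
        exact setLIntegral_mono' measurableSet_box hσ
    _ = _ := by
        rw [setLIntegral_const, volume_box]
        have : ENNReal.ofReal (2 * ((R : ℝ) + 1)) = 2 * R + 2 := by
          rw [show (2 * ((R : ℝ) + 1)) = ((2 * R + 2 : ℕ) : ℝ) by push_cast; ring,
            ENNReal.ofReal_natCast]
          push_cast; rfl
        rw [this]; ring

theorem norm_le_of_mem_box {R : ℝ} (hR : 0 ≤ R) {x : E n} (hx : x ∈ box n R) :
    ‖x‖ ≤ n * R := by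
  rw [EuclideanSpace.norm_eq]
  refine Real.sqrt_le_iff.2 ⟨by positivity, ?_⟩
  calc ∑ i, ‖x i‖ ^ 2 ≤ ∑ _i : Fin n, R ^ 2 := by
        gcongr with i; exact hx i
    _ = n * R ^ 2 := by simp
    _ ≤ (n : ℝ) ^ 2 * R ^ 2 := by
        gcongr; exact_mod_cast Nat.le_self_pow two_ne_zero n
    _ = _ := by ring

/-- A mean zero compactly supported function with `L²` modulus of continuity `O(|y|^{1/2})`
generates a Bessel family under dyadic dilations and translations. -/
theorem norm_sq_sum_all_scales_le {k : E n → ℝ} (hkm : Measurable k) (hk : MemLp k 2)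
    (hk1 : Integrable k) {R : ℕ} (hR : Function.support k ⊆ box n R) (hmean : ∫ x, k x = 0)
    {A : ℝ} (hA : 0 ≤ A)
    (hmod : ∀ y, l2sq (fun x => k (x + y) - k x) ≤ ENNReal.ofReal (A * ‖y‖))
    (S : Finset (ℤ × (Fin n → ℤ))) (c : ℤ × (Fin n → ℤ) → ℂ) :
    ‖∑ I ∈ S, c I • realL2 (wavelet k 0 I.1 I.2)‖ ^ 2 ≤
      8 * (Real.sqrt ((2 * R + 2) ^ n * (4 * R + 3) ^ n * (n * (R + 1)) * A) * ‖realL2 k‖) *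
        ∑ I ∈ S, ‖c I‖ ^ 2 := by
  set D : ℝ := (2 * R + 2) ^ n * (4 * R + 3) ^ n * (n * (R + 1)) * A with hD
  have hD0 : 0 ≤ D := by positivity
  refine norm_sq_sum_le_of_scale_decay (k := fun I => realL2 (wavelet k 0 I.1 I.2))
    (by positivity) (fun s t c S S' hst => ?_) S c
  -- After rescaling by 2^t the fine scale is zero and `f` is the coarse function, at scale s - t ≤
  -- 0.
  set f : E n → ℂ := fun x => ∑ i ∈ S, c i * (wavelet k 0 (s - t) i x : ℂ) with hf
  have hkw : ∀ r j, MemLp (fun x => (wavelet k 0 r j x : ℂ)) 2 := fun r j =>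
    memLp_ofReal (memLp_wavelet hk r j)
  have hf2 : MemLp f 2 := memLp_finsetSum S fun i _ => (hkw _ i).const_mul (c i)
  have hfm : Measurable f := by
    refine Finset.measurable_sum S fun i _ => ?_
    have : Measurable (wavelet k 0 (s - t) i) := by
      rw [wavelet_zero_eq]
      exact (hkm.comp (by fun_prop)).const_mul _
    exact (Complex.measurable_ofReal.comp this).const_mul _
  have hinner : ∀ j, inner ℂ (∑ i ∈ S, c i • realL2 (wavelet k 0 s i)) (realL2 (wavelet k 0 t j)) =
      inner ℂ (toL2 f) (realL2 (wavelet k 0 0 j)) := fun j => by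
    rw [hf, toL2_sum S c fun i _ => hkw (s - t) i, sum_inner, sum_inner]
    refine Finset.sum_congr rfl fun i _ => ?_
    rw [inner_smul_left, inner_smul_left, inner_wavelet hk hk s t t, sub_self]
  simp_rw [hinner]
  set Q : ℝ := (2 : ℝ) ^ ((s : ℝ) - t) with hQ
  have hQ1 : Q ≤ 1 := Real.rpow_le_one_of_one_le_of_nonpos (by norm_num)
    (by have : (s : ℝ) ≤ t := by exact_mod_cast hst
        linarith)
  have hQ0 : 0 < Q := by positivity
  have hQz : (2 : ℝ) ^ (s - t) = Q := by
    rw [hQ, ← Real.rpow_intCast]; push_cast; rfl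
  set a : ℝ := ∑ i ∈ S, ‖c i‖ ^ 2 with ha
  have ha0 : 0 ≤ a := Finset.sum_nonneg fun _ _ => by positivity
  have hmodf : ∀ z ∈ box n (R + 1), l2sq (fun y => f (y + z) - f y) ≤
      ENNReal.ofReal ((4 * R + 3) ^ n * (A * (Q * (n * (R + 1)))) * a) := fun z hz => by
    -- Translating `f` by z translates the mother function by Q z only, where Q = 2^{s-t} ≤ 1. The
    -- increment of `f` is thus a combination of wavelets of `w`, whose squared norm gains the
    -- factor Q; the support of `w` has radius 2R + 1, hence the overlap (4R+3)^n.
    set w : E n → ℝ := fun x => k (x + Q • z) - k x with hw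
    have hw2 : MemLp w 2 := (hk.comp_measurePreserving (measurePreserving_add_right _ _)).sub hk
    have hwR : Function.support w ⊆ box n (2 * R + 1 : ℕ) := fun x hx i => by
      have hzi := abs_le.1 (hz i)
      have : k (x + Q • z) ≠ 0 ∨ k x ≠ 0 := by
        by_contra h
        push Not at h
        exact hx (by simp [hw, h.1, h.2])
      push_cast
      rcases this with h | h
      · have h1 := abs_le.1 (hR h i)
        simp only [PiLp.add_apply, PiLp.smul_apply, smul_eq_mul] at h1
        have h2 : |Q * z i| ≤ R + 1 := by
          rw [abs_mul, abs_of_pos hQ0]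
          calc Q * |z i| ≤ 1 * (R + 1) := by gcongr; exact hz i
            _ = _ := one_mul _
        have h3 := abs_le.1 h2
        rw [abs_le]; constructor <;> linarith [h1.1, h1.2, h3.1, h3.2]
      · have h1 := hR h i
        have : (0 : ℝ) ≤ R := by positivity
        linarith
    have e1 : (fun y => f (y + z) - f y) = fun y => ∑ i ∈ S, c i * (wavelet w 0 (s - t) i y : ℂ) := by
      funext y
      simp only [hf]
      rw [← Finset.sum_sub_distrib]
      refine Finset.sum_congr rfl fun i _ => ?_
      rw [← mul_sub, wavelet_zero_eq, wavelet_zero_eq]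
      simp only [hw]
      rw [smul_add, hQz, add_sub_right_comm]
      push_cast
      ring
    have hww : ∀ i ∈ S, MemLp (fun x => (wavelet w 0 (s - t) i x : ℂ)) 2 := fun i _ =>
      memLp_ofReal (memLp_wavelet hw2 _ i)
    rw [e1, ← ofReal_norm_toL2_sq (memLp_finsetSum S fun i hi => (hww i hi).const_mul (c i)),
      toL2_sum S c hww]
    refine ENNReal.ofReal_le_ofReal ((norm_sq_sum_wavelet_le hw2 hwR (s - t) S c).trans ?_)
    have hwn : ‖realL2 w‖ ^ 2 ≤ A * (Q * (n * (R + 1))) := by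
      rw [← ENNReal.ofReal_le_ofReal_iff (by positivity), ofReal_norm_realL2_sq hw2]
      refine (hmod (Q • z)).trans (ENNReal.ofReal_le_ofReal ?_)
      rw [norm_smul, Real.norm_of_nonneg hQ0.le]
      gcongr
      exact norm_le_of_mem_box (by positivity) hz
    have e2 : (2 * ((2 * R + 1 : ℕ) : ℝ) + 1) = 4 * R + 3 := by push_cast; ring
    rw [e2]
    gcongr
  have h := sum_sq_inner_translate_le hk hk1 hR hmean hfm hf2 hmodf S'
  have hQs : ((2 : ℝ) ^ (-((t : ℝ) - s) / 2)) ^ 2 = Q := by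
    rw [hQ, ← Real.rpow_natCast, ← Real.rpow_mul (by norm_num)]
    congr 1; push_cast; ring
  rw [← ENNReal.ofReal_le_ofReal_iff (by positivity),
    ENNReal.ofReal_sum_of_nonneg fun _ _ => by positivity]
  simp_rw [ENNReal.ofReal_pow (norm_nonneg _), ofReal_norm]
  refine h.trans (le_of_eq ?_)
  have e3 : ((2 * R + 2) ^ n : ENNReal) = ENNReal.ofReal ((2 * R + 2) ^ n) := by
    rw [show ((2 * (R : ℝ) + 2) ^ n) = (((2 * R + 2) ^ n : ℕ) : ℝ) by push_cast; ring,
      ENNReal.ofReal_natCast]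
    push_cast; rfl
  rw [e3, ← ofReal_norm_realL2_sq hk, ← ENNReal.ofReal_mul (by positivity),
    ← ENNReal.ofReal_mul (by positivity)]
  congr 1
  rw [mul_pow, mul_pow, hQs, Real.sq_sqrt hD0, hD]
  ring

end CrossScale

/-! ### Regularity of piecewise polynomial functions -/

section Modulus

variable {n : ℕ}

/-- Evaluation of a polynomial at a point of `ℝⁿ`. -/
noncomputable abbrev polyEval (p : MvPolynomial (Fin n) ℝ) (x : E n) : ℝ :=
  MvPolynomial.eval (fun i => x i) p

theorem contDiff_polyEval (p : MvPolynomial (Fin n) ℝ) : ContDiff ℝ 1 (polyEval p) := by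
  induction p using MvPolynomial.induction_on with
  | C a =>
    have : polyEval (n := n) (MvPolynomial.C a) = fun _ => a := by
      funext x; simp [polyEval]
    rw [this]; exact contDiff_const
  | add p q hp hq =>
    have : polyEval (p + q) = fun x => polyEval p x + polyEval q x := by
      funext x; simp [polyEval]
    rw [this]; exact hp.add hq
  | mul_X p i hp =>
    have : polyEval (p * MvPolynomial.X i) = fun x => polyEval p x * x i := by
      funext x; simp [polyEval]
    rw [this]; exact hp.mul (by fun_prop)

theorem continuous_polyEval (p : MvPolynomial (Fin n) ℝ) : Continuous (polyEval p) :=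
  (contDiff_polyEval p).continuous

theorem unitCube_subset_closedBall : unitCube n ⊆ Metric.closedBall 0 n := fun x hx => by
  rw [mem_closedBall_zero_iff]
  have := norm_le_of_mem_box (R := 1) zero_le_one (x := x) fun i => by
    have := hx i
    rw [abs_le]; constructor <;> linarith [this.1, this.2]
  simpa using this

/-- A point that leaves the rectangle when moved by y has a coordinate within ‖y‖ of an end of its
interval. This puts it in one of n pairs of slabs, each slab of thickness ‖y‖ and with other sides
at most 1. -/
theorem volume_coord_shift_le {a b : Fin n → ℝ} (hab : ∀ i, b i - a i ≤ 1) (y : E n) :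
    volume {x : E n | (∀ i, x i ∈ Ico (a i) (b i)) ∧ ¬ ∀ i, (x + y) i ∈ Ico (a i) (b i)} ≤
      ENNReal.ofReal (n * (2 * ‖y‖)) := by
  have hsub : {x : E n | (∀ i, x i ∈ Ico (a i) (b i)) ∧ ¬ ∀ i, (x + y) i ∈ Ico (a i) (b i)} ⊆
      ⋃ i, {x : E n | ∀ l, x l ∈ if l = i then Ico (b i - ‖y‖) (b i) ∪ Ico (a i) (a i + ‖y‖)
        else Ico (a l) (b l)} := by
    rintro x ⟨h1, h2⟩
    push Not at h2
    obtain ⟨i, hi⟩ := h2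
    refine mem_iUnion.2 ⟨i, fun l => ?_⟩
    split_ifs with h
    · subst h
      have hy := abs_le.1 (PiLp.norm_apply_le y l)
      have := h1 l
      simp only [PiLp.add_apply, mem_Ico, not_and, not_lt] at hi this
      by_cases h3 : a l ≤ x l + y l
      · left
        exact ⟨by linarith [hi h3, hy.2], this.2⟩
      · right
        push Not at h3
        exact ⟨this.1, by linarith [hy.1]⟩
    · exact h1 l
  refine (measure_mono hsub).trans ((measure_iUnion_fintype_le _ _).trans ?_)
  have hi : ∀ i, volume {x : E n | ∀ l, x l ∈ if l = i then
      Ico (b i - ‖y‖) (b i) ∪ Ico (a i) (a i + ‖y‖) else Ico (a l) (b l)} ≤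
      ENNReal.ofReal (2 * ‖y‖) := fun i => by
    rw [volume_pi_Icc_euclidean fun l => if l = i then
      Ico (b i - ‖y‖) (b i) ∪ Ico (a i) (a i + ‖y‖) else Ico (a l) (b l),
      ← Finset.mul_prod_erase _ _ (Finset.mem_univ i), if_pos rfl]
    refine (mul_le_mul' (measure_union_le _ _) (Finset.prod_le_one' fun l hl => ?_)).trans ?_
    · rw [if_neg (Finset.ne_of_mem_erase hl), Real.volume_Ico]
      exact ENNReal.ofReal_le_one.2 (hab l)
    · rw [mul_one, Real.volume_Ico, Real.volume_Ico, ← ENNReal.ofReal_add]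
      · exact ENNReal.ofReal_le_ofReal (by linarith)
      · simp
      · simp
  refine (Finset.sum_le_sum fun i _ => hi i).trans (le_of_eq ?_)
  rw [Finset.sum_const, Finset.card_univ, Fintype.card_fin, ENNReal.ofReal_mul (by positivity)]
  simp

/-- The `L²` modulus of continuity of a polynomial cut off to a rectangle. -/
theorem exists_modulus_indicator (p : MvPolynomial (Fin n) ℝ) {a b : Fin n → ℝ}
    (ha : ∀ i, 0 ≤ a i) (hb : ∀ i, b i ≤ 1) :
    ∃ A : ℝ, 0 ≤ A ∧ ∀ y : E n,
      l2sq (fun x => {x : E n | ∀ i, x i ∈ Ico (a i) (b i)}.indicator (polyEval p) (x + y) -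
        {x : E n | ∀ i, x i ∈ Ico (a i) (b i)}.indicator (polyEval p) x) ≤
      ENNReal.ofReal (A * ‖y‖) := by
  set Q : Set (E n) := {x : E n | ∀ i, x i ∈ Ico (a i) (b i)} with hQ
  have hQm : MeasurableSet Q := measurableSet_coord fun _ => measurableSet_Ico
  have hQu : Q ⊆ unitCube n := fun x hx i => ⟨(ha i).trans (hx i).1, (hx i).2.trans_le (hb i)⟩
  have hQb : Q ⊆ Metric.closedBall 0 n := hQu.trans unitCube_subset_closedBall
  obtain ⟨L, hL⟩ := (contDiff_polyEval p).contDiffOn.exists_lipschitzOnWith one_ne_zero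
    (convex_closedBall (0 : E n) n) (isCompact_closedBall (0 : E n) n)
  obtain ⟨B, hB⟩ := (isCompact_closedBall (0 : E n) n).exists_bound_of_continuousOn
    (continuous_polyEval p).continuousOn
  set T : E n → Set (E n) := fun y => {x | x ∈ Q ∧ ¬ (x + y) ∈ Q} with hT
  have hTv : ∀ y, volume (T y) ≤ ENNReal.ofReal (n * (2 * ‖y‖)) := fun y =>
    volume_coord_shift_le (fun i => by linarith [ha i, hb i]) y
  have hTm : ∀ y, MeasurableSet (T y) := fun y =>
    hQm.inter ((measurable_add_const y) hQm).compl
  refine ⟨L ^ 2 * (2 * n) + 2 * (B ^ 2 * (n * 2)), by positivity, fun y => ?_⟩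
  set c₁ : ENNReal := ENNReal.ofReal (L ^ 2 * (2 * n) * ‖y‖)
  set c₂ : ENNReal := ENNReal.ofReal (B ^ 2)
  have hpt : ∀ x, ‖Q.indicator (polyEval p) (x + y) - Q.indicator (polyEval p) x‖ₑ ^ 2 ≤
      Q.indicator (fun _ => c₁) x + (T y).indicator (fun _ => c₂) x +
        (T (-y)).indicator (fun _ => c₂) (x + y) := fun x => by
    have hsq : ∀ r : ℝ, ‖r‖ₑ ^ 2 = ENNReal.ofReal (‖r‖ ^ 2) := fun r => by
      rw [ENNReal.ofReal_pow (norm_nonneg _), ofReal_norm]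
    by_cases h1 : x ∈ Q
    · by_cases h2 : x + y ∈ Q
      · rw [indicator_of_mem h1, indicator_of_mem h2]
        refine le_trans ?_ (le_trans (le_of_eq (indicator_of_mem h1 fun _ => c₁).symm)
          (by rw [add_assoc]; exact le_self_add))
        rw [hsq]
        refine ENNReal.ofReal_le_ofReal ?_
        have h3 := hL.norm_sub_le (hQb h2) (hQb h1)
        rw [add_sub_cancel_left] at h3
        -- When both points lie in `Q` the Lipschitz bound is quadratic in ‖y‖; the bounded diameter
        -- trades one factor, so as to match the linear bound from the boundary.
        have h4 : ‖y‖ ≤ 2 * n := by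
          have e : y = (x + y) - x := by abel
          rw [e]
          have h5 := mem_closedBall_zero_iff.1 (hQb h1)
          have h6 := mem_closedBall_zero_iff.1 (hQb h2)
          linarith [norm_sub_le (x + y) x]
        calc _ ≤ (L * ‖y‖) ^ 2 := by gcongr
          _ = L ^ 2 * ‖y‖ * ‖y‖ := by ring
          _ ≤ L ^ 2 * (2 * n) * ‖y‖ := by gcongr
      · rw [indicator_of_mem h1, indicator_of_notMem h2, zero_sub]
        have h3 : x ∈ T y := ⟨h1, h2⟩
        refine le_trans ?_ (le_trans (le_of_eq (indicator_of_mem h3 fun _ => c₂).symm)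
          (by rw [add_right_comm]; exact le_add_self))
        rw [hsq, norm_neg]
        exact ENNReal.ofReal_le_ofReal (by gcongr; exact hB x (hQb h1))
    · by_cases h2 : x + y ∈ Q
      · rw [indicator_of_notMem h1, indicator_of_mem h2, sub_zero]
        have h3 : x + y ∈ T (-y) := ⟨h2, by simpa using h1⟩
        refine le_trans ?_ (le_trans (le_of_eq (indicator_of_mem h3 fun _ => c₂).symm)
          le_add_self)
        rw [hsq]
        exact ENNReal.ofReal_le_ofReal (by gcongr; exact hB _ (hQb h2))
      · rw [indicator_of_notMem h1, indicator_of_notMem h2]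
        simp
  refine (lintegral_mono hpt).trans ?_
  have m1 : Measurable (Q.indicator fun _ => c₁) := measurable_const.indicator hQm
  have m2 : ∀ z, Measurable ((T z).indicator fun _ => c₂) := fun z =>
    measurable_const.indicator (hTm z)
  have m12 : Measurable fun x => Q.indicator (fun _ => c₁) x + (T y).indicator (fun _ => c₂) x :=
    m1.add (m2 y)
  rw [lintegral_add_left m12, lintegral_add_left m1,
    lintegral_add_right_eq_self (fun x => (T (-y)).indicator (fun _ => c₂) x),
    lintegral_indicator_const hQm, lintegral_indicator_const (hTm _),
    lintegral_indicator_const (hTm _)]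
  have v1 : volume Q ≤ 1 := (measure_mono hQu).trans volume_unitCube.le
  calc _ ≤ c₁ * 1 + c₂ * ENNReal.ofReal (n * (2 * ‖y‖)) +
        c₂ * ENNReal.ofReal (n * (2 * ‖-y‖)) := by
        gcongr
        · exact hTv y
        · exact hTv (-y)
    _ = _ := by
        rw [norm_neg, mul_one, ← ENNReal.ofReal_mul (by positivity),
          ← ENNReal.ofReal_add (by positivity) (by positivity),
          ← ENNReal.ofReal_add (by positivity) (by positivity)]
        congr 1; ring

theorem two_mul_ofReal_add {a b : ℝ} (ha : 0 ≤ a) (hb : 0 ≤ b) :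
    2 * ENNReal.ofReal a + 2 * ENNReal.ofReal b = ENNReal.ofReal (2 * a + 2 * b) := by
  rw [show (2 : ENNReal) = ENNReal.ofReal 2 by simp, ← ENNReal.ofReal_mul (by norm_num),
    ← ENNReal.ofReal_mul (by norm_num), ← ENNReal.ofReal_add (by positivity) (by positivity)]

theorem l2sq_add_le {F : Type*} [NormedAddCommGroup F] {f g : E n → F}
    (hf : AEStronglyMeasurable f) : l2sq (fun x => f x + g x) ≤ 2 * l2sq f + 2 * l2sq g := by
  have h : ∀ x, ‖f x + g x‖ₑ ^ 2 ≤ 2 * ‖f x‖ₑ ^ 2 + 2 * ‖g x‖ₑ ^ 2 := fun x => by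
    have h1 : ‖f x + g x‖ ^ 2 ≤ 2 * ‖f x‖ ^ 2 + 2 * ‖g x‖ ^ 2 := by
      have h2 : ‖f x + g x‖ ^ 2 ≤ (‖f x‖ + ‖g x‖) ^ 2 := by gcongr; exact norm_add_le _ _
      nlinarith [sq_nonneg (‖f x‖ - ‖g x‖)]
    have h3 := ENNReal.ofReal_le_ofReal h1
    rw [ENNReal.ofReal_add (by positivity) (by positivity), ENNReal.ofReal_mul (by norm_num),
      ENNReal.ofReal_mul (by norm_num), ENNReal.ofReal_pow (norm_nonneg _),
      ENNReal.ofReal_pow (norm_nonneg _), ENNReal.ofReal_pow (norm_nonneg _)] at h3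
    simpa using h3
  refine (lintegral_mono h).trans ?_
  rw [lintegral_add_left' ((hf.enorm.pow_const 2).const_mul 2),
    lintegral_const_mul' _ _ (by norm_num), lintegral_const_mul' _ _ (by norm_num)]
  rfl

theorem l2sq_sub_le {F : Type*} [NormedAddCommGroup F] {f g : E n → F}
    (hf : AEStronglyMeasurable f) : l2sq (fun x => f x - g x) ≤ 2 * l2sq f + 2 * l2sq g := by
  have := l2sq_add_le (g := fun x => - g x) hf
  simpa [sub_eq_add_neg, l2sq] using this

theorem exists_modulus_sum {ι : Type*} (S : Finset ι) {u : ι → E n → ℝ}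
    (hm : ∀ i, Measurable (u i))
    (hu : ∀ i, ∃ A : ℝ, 0 ≤ A ∧ ∀ y, l2sq (fun x => u i (x + y) - u i x) ≤
      ENNReal.ofReal (A * ‖y‖)) :
    ∃ A : ℝ, 0 ≤ A ∧ ∀ y, l2sq (fun x => ∑ i ∈ S, u i (x + y) - ∑ i ∈ S, u i x) ≤
      ENNReal.ofReal (A * ‖y‖) := by
  classical
  induction S using Finset.induction_on with
  | empty => exact ⟨0, le_rfl, fun y => by simp [l2sq]⟩
  | insert a S ha ih =>
    obtain ⟨A, hA, h⟩ := ih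
    obtain ⟨A', hA', h'⟩ := hu a
    refine ⟨2 * A' + 2 * A, by positivity, fun y => ?_⟩
    have e : (fun x => ∑ i ∈ insert a S, u i (x + y) - ∑ i ∈ insert a S, u i x) =
        fun x => (u a (x + y) - u a x) + (∑ i ∈ S, u i (x + y) - ∑ i ∈ S, u i x) := by
      funext x
      rw [Finset.sum_insert ha, Finset.sum_insert ha]; ring
    rw [e]
    have hma : Measurable fun x => u a (x + y) - u a x :=
      ((hm a).comp (measurable_add_const y)).sub (hm a)
    refine (l2sq_add_le hma.aestronglyMeasurable).trans ?_
    calc _ ≤ 2 * ENNReal.ofReal (A' * ‖y‖) + 2 * ENNReal.ofReal (A * ‖y‖) := by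
          gcongr
          · exact h' y
          · exact h y
      _ = _ := by
          rw [two_mul_ofReal_add (by positivity) (by positivity)]
          congr 1; ring

end Modulus

/-! ### Functions in the Alpert space -/

section AlpertSpace

variable {n κ : ℕ}

theorem measurableSet_unitChild (c : Fin n → Fin 2) : MeasurableSet (unitChild c) :=
  measurableSet_coord fun _ => measurableSet_Ico

theorem unitChild_subset (c : Fin n → Fin 2) : unitChild c ⊆ unitCube n := fun x hx i => by
  have h := hx i
  have h0 : (0 : ℝ) ≤ ((c i : ℕ) : ℝ) := by positivity
  have h1 : ((c i : ℕ) : ℝ) ≤ 1 := by exact_mod_cast Nat.lt_succ_iff.1 (c i).2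
  rw [mem_Ico] at h ⊢
  constructor <;> linarith [h.1, h.2]

theorem measurable_of_mem_alpertSpace {g : E n → ℝ} (hg : g ∈ alpertSpace n κ) : Measurable g := by
  obtain ⟨⟨p, -, hp⟩, -⟩ := hg
  rw [funext hp]
  exact Finset.measurable_sum _ fun c _ =>
    (continuous_polyEval (p c)).measurable.indicator (measurableSet_unitChild c)

theorem support_of_mem_alpertSpace {g : E n → ℝ} (hg : g ∈ alpertSpace n κ) :
    Function.support g ⊆ unitCube n := by
  obtain ⟨⟨p, -, hp⟩, -⟩ := hg
  refine Function.support_subset_iff'.2 fun x hx => ?_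
  rw [hp]
  exact Finset.sum_eq_zero fun c _ => indicator_of_notMem (fun h => hx (unitChild_subset c h)) _

theorem exists_bound_of_mem_alpertSpace {g : E n → ℝ} (hg : g ∈ alpertSpace n κ) :
    ∃ B : ℝ, 0 ≤ B ∧ ∀ x, ‖g x‖ ≤ B := by
  obtain ⟨⟨p, -, hp⟩, -⟩ := hg
  choose B hB using fun c : Fin n → Fin 2 =>
    (isCompact_closedBall (0 : E n) n).exists_bound_of_continuousOn
      (continuous_polyEval (p c)).continuousOn
  refine ⟨∑ c, |B c|, by positivity, fun x => ?_⟩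
  rw [hp]
  refine (norm_sum_le _ _).trans (Finset.sum_le_sum fun c _ => ?_)
  by_cases hx : x ∈ unitChild c
  · rw [indicator_of_mem hx]
    exact (hB c x (unitCube_subset_closedBall (unitChild_subset c hx))).trans (le_abs_self _)
  · rw [indicator_of_notMem hx]; simp

theorem memLp_of_mem_alpertSpace {g : E n → ℝ} (hg : g ∈ alpertSpace n κ) (p : ENNReal) :
    MemLp g p := by
  obtain ⟨B, -, hB⟩ := exists_bound_of_mem_alpertSpace hg
  have h1 : MemLp g p (volume.restrict (unitCube n)) := by
    have : IsFiniteMeasure ((volume : Measure (E n)).restrict (unitCube n)) :=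
      ⟨by rw [Measure.restrict_apply_univ, volume_unitCube]; exact ENNReal.one_lt_top⟩
    exact MemLp.of_bound (measurable_of_mem_alpertSpace hg).aestronglyMeasurable B
      (Filter.Eventually.of_forall hB)
  have h2 := (memLp_indicator_iff_restrict measurableSet_unitCube).2 h1
  rwa [indicator_eq_self.2 (support_of_mem_alpertSpace hg)] at h2

theorem integral_of_mem_alpertSpace (hκ : 0 < κ) {g : E n → ℝ} (hg : g ∈ alpertSpace n κ) :
    ∫ x, g x = 0 := by
  have := hg.2 0 (by simpa using hκ)
  rw [← setIntegral_eq_integral_of_forall_compl_eq_zero (s := unitCube n)]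
  · simpa [mono] using this
  · exact fun x hx => Function.notMem_support.1 fun h => hx (support_of_mem_alpertSpace hg h)

/-- Jumps across the faces of the children are what limits the modulus to order |y|^{1/2}; that is
still enough for geometric decay between scales. -/
theorem exists_modulus_of_mem_alpertSpace {g : E n → ℝ} (hg : g ∈ alpertSpace n κ) :
    ∃ A : ℝ, 0 ≤ A ∧ ∀ y, l2sq (fun x => g (x + y) - g x) ≤ ENNReal.ofReal (A * ‖y‖) := by
  obtain ⟨⟨p, -, hp⟩, -⟩ := hg
  have := exists_modulus_sum Finset.univ
    (u := fun c : Fin n → Fin 2 => (unitChild c).indicator (polyEval (p c)))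
    (fun c => (continuous_polyEval (p c)).measurable.indicator (measurableSet_unitChild c))
    fun c => exists_modulus_indicator (p c) (fun i => by positivity) fun i => by
      have h1 : ((c i : ℕ) : ℝ) ≤ 1 := by exact_mod_cast Nat.lt_succ_iff.1 (c i).2
      linarith
  obtain ⟨A, hA, h⟩ := this
  refine ⟨A, hA, fun y => ?_⟩
  simp only [hp]
  exact h y

end AlpertSpace

/-! ### Smoothing -/

section Smoothing

variable {n κ : ℕ}

/-- Minkowski's inequality for averages. -/
theorem l2sq_integral_mul_le {Φ : E n → ℝ} (hΦ : Measurable Φ) {G : E n → E n → ℝ}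
    (hG : Measurable (Function.uncurry G)) {L σ : ENNReal} (hL : ∫⁻ t, ‖Φ t‖ₑ ≤ L)
    (hσ : ∀ t, Φ t ≠ 0 → l2sq (fun x => G x t) ≤ σ) :
    l2sq (fun x => ∫ t, Φ t * G x t) ≤ L ^ 2 * σ := by
  have hG1 : ∀ x, Measurable fun t => G x t := fun x => hG.comp measurable_prodMk_left
  have hpt : ∀ x, ‖∫ t, Φ t * G x t‖ₑ ^ 2 ≤ L * ∫⁻ t, ‖Φ t‖ₑ * ‖G x t‖ₑ ^ 2 := fun x => by
    have hr : ∀ a : ENNReal, a ^ (1 / 2 : ℝ) * a ^ (1 / 2 : ℝ) = a := fun a => by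
      rw [← ENNReal.rpow_add_of_nonneg _ _ (by norm_num) (by norm_num)]; norm_num
    -- Cauchy–Schwarz with the weight |Φ| split evenly between the two factors.
    have h1 : ‖∫ t, Φ t * G x t‖ₑ ≤
        ∫⁻ t, ‖Φ t‖ₑ ^ (1 / 2 : ℝ) * (‖Φ t‖ₑ ^ (1 / 2 : ℝ) * ‖G x t‖ₑ) := by
      refine (enorm_integral_le_lintegral_enorm _).trans (le_of_eq ?_)
      congr 1; funext t
      rw [enorm_mul, ← mul_assoc, hr]
    have hm1 : Measurable fun t => ‖Φ t‖ₑ ^ (1 / 2 : ℝ) := hΦ.enorm.pow_const _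
    have h2 := sq_lintegral_mul_le (μ := volume) hm1.aemeasurable
      (hm1.mul (hG1 x).enorm).aemeasurable
    refine (pow_le_pow_left' h1 2).trans (h2.trans ?_)
    have e1 : ∀ t, (‖Φ t‖ₑ ^ (1 / 2 : ℝ)) ^ 2 = ‖Φ t‖ₑ := fun t => by rw [sq, hr]
    have e2 : ∀ t, (((fun t => ‖Φ t‖ₑ ^ (1 / 2 : ℝ)) * fun t => ‖G x t‖ₑ) t) ^ 2 =
        ‖Φ t‖ₑ * ‖G x t‖ₑ ^ 2 := fun t => by
      rw [Pi.mul_apply, mul_pow, e1]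
    simp_rw [e1, e2]
    gcongr
  have hjm : Measurable (Function.uncurry fun x t => ‖Φ t‖ₑ * ‖G x t‖ₑ ^ 2) :=
    ((hΦ.comp measurable_snd).enorm).mul (hG.enorm.pow_const 2)
  refine (lintegral_mono hpt).trans ?_
  have hjm' : Measurable fun x => ∫⁻ t, ‖Φ t‖ₑ * ‖G x t‖ₑ ^ 2 := hjm.lintegral_prod_right'
  rw [lintegral_const_mul _ hjm', lintegral_lintegral_swap hjm.aemeasurable]
  calc _ ≤ L * ∫⁻ t, ‖Φ t‖ₑ * σ := by
        gcongr with t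
        have hm : Measurable fun x => G x t := hG.comp measurable_prodMk_right
        rw [lintegral_const_mul _ (hm.enorm.pow_const 2)]
        by_cases h : Φ t = 0
        · simp [h]
        · gcongr; exact hσ t h
    _ = (L * ∫⁻ t, ‖Φ t‖ₑ) * σ := by rw [lintegral_mul_const _ hΦ.enorm]; ring
    _ ≤ (L * L) * σ := by gcongr
    _ = _ := by ring

/-- The mother function of the smooth wavelets. -/
noncomputable def smoothing (φ g : E n → ℝ) (η : ℝ) : E n → ℝ :=
  g ⋆[ContinuousLinearMap.mul ℝ ℝ, volume] dilate φ η

theorem dilate_mul_zpow (φ : E n → ℝ) (η : ℝ) (s : ℤ) (x : E n) :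
    dilate φ (η * (2 : ℝ) ^ (-s)) x = ((2 : ℝ) ^ s) ^ n * dilate φ η ((2 : ℝ) ^ s • x) := by
  have h2 : (0 : ℝ) < 2 ^ s := by positivity
  simp only [dilate]
  rw [zpow_neg, mul_pow, mul_inv, mul_inv, inv_inv, inv_pow, inv_inv, smul_smul]
  ring

/-- Convolution commutes with dilations and translations, and the mollification width is
proportional to the side of the cube. Hence all smooth wavelets come from the single mother function
`smoothing φ g η`. -/
theorem smoothWavelet_eq (φ g : E n → ℝ) (η : ℝ) (v : E n) (s : ℤ) (j : Fin n → ℤ) :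
    smoothWavelet φ g η v s j = wavelet (smoothing φ g η) v s j := by
  have h2 : (0 : ℝ) < 2 ^ s := by positivity
  have h2n : (0 : ℝ) < ((2 : ℝ) ^ s) ^ n := by positivity
  funext x
  simp only [smoothWavelet, wavelet, smoothing, convolution_def, ContinuousLinearMap.mul_apply']
  have h := integral_comp_affine (fun r : E n => (2 : ℝ) ^ ((s : ℝ) * n / 2) * g r *
    (((2 : ℝ) ^ s) ^ n * dilate φ η ((2 : ℝ) ^ s • (x - v) - latticePt j - r))) s
    ((2 : ℝ) ^ s • v + latticePt j)
  have e : ∀ t : E n, (2 : ℝ) ^ s • (x - v) - latticePt j -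
      ((2 : ℝ) ^ s • t - ((2 : ℝ) ^ s • v + latticePt j)) = (2 : ℝ) ^ s • (x - t) := fun t => by
    rw [smul_sub, smul_sub]; abel
  have e2 : ∀ t : E n, (2 : ℝ) ^ s • t - ((2 : ℝ) ^ s • v + latticePt j) =
      (2 : ℝ) ^ s • (t - v) - latticePt j := fun t => by rw [smul_sub]; abel
  simp only [e] at h
  simp only [e2, ← dilate_mul_zpow] at h
  rw [h, ← integral_const_mul, smul_eq_mul, ← integral_const_mul]
  congr 1
  funext r
  field_simp

variable {φ : E n → ℝ} {η : ℝ}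

theorem contDiff_dilate (hφ : IsMollifier κ φ) : ContDiff ℝ ∞ (dilate φ η) :=
  contDiff_const.mul (hφ.smooth.comp (contDiff_const_smul _))

theorem continuous_dilate (hφ : IsMollifier κ φ) : Continuous (dilate φ η) :=
  (contDiff_dilate hφ).continuous

theorem norm_le_of_dilate_ne_zero (hφ : IsMollifier κ φ) (hη : 0 < η) {x : E n}
    (hx : dilate φ η x ≠ 0) : ‖x‖ ≤ η := by
  have h1 : φ (η⁻¹ • x) ≠ 0 := fun h => hx (by simp [dilate, h])
  have h2 := mem_ball_zero_iff.1 (hφ.tsupport_subset (subset_tsupport φ h1))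
  rw [norm_smul, norm_inv, Real.norm_of_nonneg hη.le, inv_mul_lt_iff₀ hη, mul_one] at h2
  exact h2.le

theorem hasCompactSupport_dilate (hφ : IsMollifier κ φ) (hη : 0 < η) :
    HasCompactSupport (dilate φ η) :=
  HasCompactSupport.of_support_subset_isCompact (isCompact_closedBall 0 η) fun x hx => by
    rw [mem_closedBall_zero_iff]
    exact norm_le_of_dilate_ne_zero hφ hη hx

theorem integrable_dilate (hφ : IsMollifier κ φ) (hη : 0 < η) : Integrable (dilate φ η) :=
  (continuous_dilate hφ).integrable_of_hasCompactSupport (hasCompactSupport_dilate hφ hη)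

theorem integral_dilate (hφ : IsMollifier κ φ) (hη : 0 < η) : ∫ x, dilate φ η x = 1 := by
  simp only [dilate]
  rw [integral_const_mul, Measure.integral_comp_smul, hφ.integral_eq_one, finrank_euclideanSpace_fin,
    abs_of_pos (by positivity)]
  have : 0 < η ^ n := by positivity
  simp only [inv_pow, inv_inv, smul_eq_mul, mul_one]
  field_simp

theorem lintegral_enorm_dilate (hφ : IsMollifier κ φ) (hη : 0 < η) :
    ∫⁻ x, ‖dilate φ η x‖ₑ = ENNReal.ofReal (∫ x, ‖φ x‖) := by
  rw [← ofReal_integral_norm_eq_lintegral_enorm (integrable_dilate hφ hη)]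
  congr 1
  simp only [dilate, norm_mul]
  rw [integral_const_mul, Measure.integral_comp_smul volume (fun x => ‖φ x‖),
    finrank_euclideanSpace_fin, abs_of_pos (by positivity), Real.norm_of_nonneg (by positivity)]
  have : 0 < η ^ n := by positivity
  simp only [inv_pow, inv_inv, smul_eq_mul]
  field_simp

variable {g : E n → ℝ}

theorem integrable_of_mem_alpertSpace (hg : g ∈ alpertSpace n κ) : Integrable g :=
  memLp_one_iff_integrable.1 (memLp_of_mem_alpertSpace hg 1)

theorem continuous_smoothing (hφ : IsMollifier κ φ) (hη : 0 < η) (hg : g ∈ alpertSpace n κ) :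
    Continuous (smoothing φ g η) :=
  (hasCompactSupport_dilate hφ hη).continuous_convolution_right _
    (integrable_of_mem_alpertSpace hg).locallyIntegrable (continuous_dilate hφ)

theorem contDiff_smoothing (hφ : IsMollifier κ φ) (hη : 0 < η) (hg : g ∈ alpertSpace n κ) :
    ContDiff ℝ ∞ (smoothing φ g η) :=
  (hasCompactSupport_dilate hφ hη).contDiff_convolution_right _
    (integrable_of_mem_alpertSpace hg).locallyIntegrable (contDiff_dilate hφ)

theorem support_smoothing_subset (hφ : IsMollifier κ φ) (hη : 0 < η) (hη1 : η ≤ 1)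
    (hg : g ∈ alpertSpace n κ) : Function.support (smoothing φ g η) ⊆ box n (2 : ℕ) := by
  intro x hx
  obtain ⟨a, ha, b, hb, rfl⟩ := support_convolution_subset _ hx
  intro i
  have h1 := support_of_mem_alpertSpace hg ha i
  have h2 := abs_le.1 ((PiLp.norm_apply_le b i).trans
    ((norm_le_of_dilate_ne_zero hφ hη hb).trans hη1))
  simp only [PiLp.add_apply, mem_Ico, Nat.cast_ofNat] at h1 h2 ⊢
  rw [abs_le]
  constructor <;> linarith [h1.1, h1.2, h2.1, h2.2]

theorem box_subset_closedBall {R : ℝ} (hR : 0 ≤ R) : box n R ⊆ Metric.closedBall 0 (n * R) :=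
  fun _ hx => mem_closedBall_zero_iff.2 (norm_le_of_mem_box hR hx)

theorem hasCompactSupport_of_box {f : E n → ℝ} {R : ℝ} (hR : 0 ≤ R)
    (hf : Function.support f ⊆ box n R) : HasCompactSupport f :=
  HasCompactSupport.of_support_subset_isCompact (isCompact_closedBall 0 (n * R))
    (hf.trans (box_subset_closedBall hR))

theorem hasCompactSupport_smoothing (hφ : IsMollifier κ φ) (hη : 0 < η) (hη1 : η ≤ 1)
    (hg : g ∈ alpertSpace n κ) : HasCompactSupport (smoothing φ g η) :=
  hasCompactSupport_of_box (by positivity) (support_smoothing_subset hφ hη hη1 hg)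

theorem memLp_smoothing (hφ : IsMollifier κ φ) (hη : 0 < η) (hη1 : η ≤ 1)
    (hg : g ∈ alpertSpace n κ) (p : ENNReal) : MemLp (smoothing φ g η) p :=
  (continuous_smoothing hφ hη hg).memLp_of_hasCompactSupport
    (hasCompactSupport_smoothing hφ hη hη1 hg)

theorem integral_smoothing (hκ : 0 < κ) (hφ : IsMollifier κ φ) (hη : 0 < η)
    (hg : g ∈ alpertSpace n κ) : ∫ x, smoothing φ g η x = 0 := by
  rw [smoothing, integral_convolution _ (integrable_of_mem_alpertSpace hg)
    (integrable_dilate hφ hη), integral_of_mem_alpertSpace hκ hg]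
  simp

theorem smoothing_sub_eq (hφ : IsMollifier κ φ) (hη : 0 < η) (hg : g ∈ alpertSpace n κ) (x : E n) :
    smoothing φ g η x - g x = ∫ t, dilate φ η t * (g (x - t) - g x) := by
  obtain ⟨B, -, hB⟩ := exists_bound_of_mem_alpertSpace hg
  have hgm := measurable_of_mem_alpertSpace hg
  have h1 : Integrable fun t => dilate φ η t * g (x - t) :=
    (integrable_dilate hφ hη).mul_bdd (hgm.comp (by fun_prop : Measurable fun t => x - t)).aestronglyMeasurable
      (Filter.Eventually.of_forall fun t => hB _)
  simp_rw [mul_sub]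
  rw [integral_sub h1 ((integrable_dilate hφ hη).mul_const _), integral_mul_const,
    integral_dilate hφ hη, one_mul, smoothing, convolution_eq_swap]
  congr 2
  funext t
  rw [ContinuousLinearMap.mul_apply', mul_comm]

/-- Smoothing is a small perturbation of the whole family of dilates and translates. -/
theorem exists_perturbation_bound (hκ : 0 < κ) (hφ : IsMollifier κ φ) (hg : g ∈ alpertSpace n κ) :
    ∃ C : ℝ, 0 ≤ C ∧ ∀ η : ℝ, 0 < η → η ≤ 1 →
      ∀ (S : Finset (ℤ × (Fin n → ℤ))) (c : ℤ × (Fin n → ℤ) → ℂ),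
        ‖∑ I ∈ S, c I • (realL2 (smoothWavelet φ g η 0 I.1 I.2) - realL2 (wavelet g 0 I.1 I.2))‖ ^ 2 ≤
          C * Real.sqrt η * ∑ I ∈ S, ‖c I‖ ^ 2 := by
  obtain ⟨A, hA, hmod⟩ := exists_modulus_of_mem_alpertSpace hg
  set L : ℝ := ∫ x, ‖φ x‖ with hL
  have hL0 : 0 ≤ L := integral_nonneg fun _ => norm_nonneg _
  set D : ℝ := (2 * (2 : ℕ) + 2) ^ n * (4 * (2 : ℕ) + 3) ^ n * (n * ((2 : ℕ) + 1)) *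
    (L ^ 2 * (4 * A)) with hD
  refine ⟨8 * (Real.sqrt D * Real.sqrt (L ^ 2 * A)), by positivity, fun η hη hη1 S c => ?_⟩
  have hgm := measurable_of_mem_alpertSpace hg
  set k : E n → ℝ := fun x => smoothing φ g η x - g x with hk
  have hkm : Measurable k := (continuous_smoothing hφ hη hg).measurable.sub hgm
  have hkp : ∀ p, MemLp k p := fun p =>
    (memLp_smoothing hφ hη hη1 hg p).sub (memLp_of_mem_alpertSpace hg p)
  have hk1 : Integrable k := memLp_one_iff_integrable.1 (hkp 1)
  have hkR : Function.support k ⊆ box n (2 : ℕ) := fun x hx i => by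
    have : smoothing φ g η x ≠ 0 ∨ g x ≠ 0 := by
      by_contra h
      push Not at h
      exact hx (by simp [hk, h.1, h.2])
    rcases this with h | h
    · exact support_smoothing_subset hφ hη hη1 hg h i
    · have := support_of_mem_alpertSpace hg h i
      rw [abs_le]
      push_cast
      constructor <;> linarith [this.1, this.2]
  have hmean : ∫ x, k x = 0 := by
    rw [hk, integral_sub (memLp_one_iff_integrable.1 (memLp_smoothing hφ hη hη1 hg 1))
      (integrable_of_mem_alpertSpace hg), integral_smoothing hκ hφ hη hg,
      integral_of_mem_alpertSpace hκ hg, sub_zero]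
  have hkeq : k = fun x => ∫ t, dilate φ η t * (g (x - t) - g x) := by
    funext x; exact smoothing_sub_eq hφ hη hg x
  have hgsub : ∀ t, l2sq (fun x => g (x - t) - g x) ≤ ENNReal.ofReal (A * ‖t‖) := fun t => by
    have := hmod (-t)
    rw [norm_neg] at this
    simpa [sub_eq_add_neg] using this
  have hdm : Measurable (dilate φ η) := (continuous_dilate hφ).measurable
  -- The smallness in η enters here: only translations by ‖t‖ ≤ η occur, and the modulus of g is
  -- linear in ‖t‖.
  have hkn : ‖realL2 k‖ ≤ Real.sqrt (L ^ 2 * A) * Real.sqrt η := by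
    rw [← Real.sqrt_mul (by positivity)]
    refine Real.le_sqrt_of_sq_le ?_
    rw [← ENNReal.ofReal_le_ofReal_iff (by positivity), ofReal_norm_realL2_sq (hkp 2), hkeq]
    refine (l2sq_integral_mul_le hdm (G := fun x t => g (x - t) - g x)
      ((hgm.comp (by fun_prop)).sub (hgm.comp (by fun_prop)))
      (lintegral_enorm_dilate hφ hη).le (σ := ENNReal.ofReal (A * η)) fun t ht => ?_).trans ?_
    · refine (hgsub t).trans (ENNReal.ofReal_le_ofReal ?_)
      gcongr
      exact norm_le_of_dilate_ne_zero hφ hη ht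
    · rw [← ENNReal.ofReal_pow hL0, ← ENNReal.ofReal_mul (by positivity)]
      exact ENNReal.ofReal_le_ofReal (by rw [hL]; linarith)
  have hint : ∀ x, Integrable fun t => dilate φ η t * (g (x - t) - g x) := fun x => by
    obtain ⟨B, -, hB⟩ := exists_bound_of_mem_alpertSpace hg
    have hm : Measurable fun t => g (x - t) - g x := (hgm.comp (by fun_prop)).sub_const _
    exact (integrable_dilate hφ hη).mul_bdd hm.aestronglyMeasurable
      (Filter.Eventually.of_forall fun t => (norm_sub_le _ _).trans (add_le_add (hB _) (hB _)))
  -- The modulus of `k` is merely bounded uniformly in η. That suffices, because the Bessel bound is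
  -- the product of ‖k‖ with the square root of the modulus constant.
  have hkmod : ∀ y, l2sq (fun x => k (x + y) - k x) ≤ ENNReal.ofReal ((L ^ 2 * (4 * A)) * ‖y‖) :=
    fun y => by
    have e : (fun x => k (x + y) - k x) = fun x => ∫ t, dilate φ η t *
        ((g (x - t + y) - g (x - t)) - (g (x + y) - g x)) := by
      funext x
      rw [hkeq]
      simp only
      rw [← integral_sub (hint _) (hint _)]
      congr 1; funext t
      rw [sub_add_eq_add_sub]; ring
    rw [e]
    refine (l2sq_integral_mul_le hdm
      (G := fun x t => (g (x - t + y) - g (x - t)) - (g (x + y) - g x))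
      (((hgm.comp (by fun_prop)).sub (hgm.comp (by fun_prop))).sub
        ((hgm.comp (by fun_prop)).sub (hgm.comp (by fun_prop))))
      (lintegral_enorm_dilate hφ hη).le (σ := ENNReal.ofReal (4 * A * ‖y‖)) fun t _ => ?_).trans ?_
    · have hm : Measurable fun x => g (x - t + y) - g (x - t) :=
        (hgm.comp (by fun_prop)).sub (hgm.comp (by fun_prop))
      refine (l2sq_sub_le hm.aestronglyMeasurable).trans ?_
      have e2 : l2sq (fun x => g (x - t + y) - g (x - t)) = l2sq fun x => g (x + y) - g x :=
        lintegral_sub_right_eq_self (fun x => ‖g (x + y) - g x‖ₑ ^ 2) t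
      rw [e2]
      calc _ ≤ 2 * ENNReal.ofReal (A * ‖y‖) + 2 * ENNReal.ofReal (A * ‖y‖) := by
            gcongr <;> exact hmod y
        _ = _ := by
            rw [two_mul_ofReal_add (by positivity) (by positivity)]
            congr 1; ring
    · rw [← ENNReal.ofReal_pow hL0, ← ENNReal.ofReal_mul (by positivity)]
      exact ENNReal.ofReal_le_ofReal (by rw [hL]; linarith)
  have h := norm_sq_sum_all_scales_le hkm (hkp 2) hk1 hkR hmean (A := L ^ 2 * (4 * A))
    (by positivity) hkmod S c
  have hsub : ∀ I : ℤ × (Fin n → ℤ), realL2 (smoothWavelet φ g η 0 I.1 I.2) -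
      realL2 (wavelet g 0 I.1 I.2) = realL2 (wavelet k 0 I.1 I.2) := fun I => by
    rw [smoothWavelet_eq, realL2, realL2, ← toL2_sub
      (memLp_ofReal (memLp_wavelet (memLp_smoothing hφ hη hη1 hg 2) _ _))
      (memLp_ofReal (memLp_wavelet (memLp_of_mem_alpertSpace hg 2) _ _))]
    congr 1
    funext x
    simp only [wavelet, hk]
    push_cast
    ring
  simp_rw [hsub]
  refine h.trans ?_
  have ha0 : 0 ≤ ∑ I ∈ S, ‖c I‖ ^ 2 := Finset.sum_nonneg fun _ _ => by positivity
  calc _ ≤ 8 * (Real.sqrt D * (Real.sqrt (L ^ 2 * A) * Real.sqrt η)) * ∑ I ∈ S, ‖c I‖ ^ 2 := by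
        gcongr
    _ = _ := by ring

end Smoothing

/-! ### Piecewise polynomials on dyadic cubes -/

section Polynomials

variable {n κ : ℕ}

theorem exists_affine_comp (p : MvPolynomial (Fin n) ℝ) (hp : p.totalDegree < κ) (a : ℝ)
    (b : E n) : ∃ q : MvPolynomial (Fin n) ℝ, q.totalDegree < κ ∧
      ∀ x, polyEval q x = polyEval p (a • x + b) := by
  let y : Fin n → MvPolynomial (Fin n) ℝ := fun i =>
    MvPolynomial.C a * MvPolynomial.X i + MvPolynomial.C (b i)
  have hy : ∀ i, (y i).totalDegree ≤ 1 := fun i => by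
    refine (MvPolynomial.totalDegree_add _ _).trans (max_le ?_ ?_)
    · refine (MvPolynomial.totalDegree_mul _ _).trans ?_
      rw [MvPolynomial.totalDegree_C, MvPolynomial.totalDegree_X]
    · rw [MvPolynomial.totalDegree_C]; exact zero_le_one
  refine ⟨MvPolynomial.aeval y p, lt_of_le_of_lt ?_ hp, fun x => ?_⟩
  · rw [MvPolynomial.aeval_def, MvPolynomial.eval₂_eq']
    refine MvPolynomial.totalDegree_finsetSum_le fun d hd => ?_
    refine (MvPolynomial.totalDegree_mul _ _).trans ?_
    have h1 : ((algebraMap ℝ (MvPolynomial (Fin n) ℝ)) (MvPolynomial.coeff d p)).totalDegree = 0 :=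
      MvPolynomial.totalDegree_C _
    rw [h1, zero_add]
    refine (MvPolynomial.totalDegree_finsetProd _ _).trans ?_
    calc _ ≤ ∑ i, d i := Finset.sum_le_sum fun i _ => by
          refine (MvPolynomial.totalDegree_pow _ _).trans ?_
          calc d i * (y i).totalDegree ≤ d i * 1 := Nat.mul_le_mul_left _ (hy i)
            _ = d i := mul_one _
      _ = d.sum fun _ e => e := (Finsupp.sum_fintype d (fun _ e => e) fun _ => rfl).symm
      _ ≤ p.totalDegree := MvPolynomial.le_totalDegree hd
  · have hC : (MvPolynomial.eval fun i => x i).comp (algebraMap ℝ (MvPolynomial (Fin n) ℝ)) =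
        RingHom.id ℝ := by
      ext r; simp
    have hyx : (fun i => MvPolynomial.eval (fun i => x i) (y i)) = fun i => (a • x + b) i := by
      funext i; simp [y]
    rw [polyEval, MvPolynomial.map_aeval, hC, hyx]
    rfl

/-- A polynomial cut off to the unit cube. -/
noncomputable def cutoff (p : MvPolynomial (Fin n) ℝ) : E n → ℝ :=
  (unitCube n).indicator (polyEval p)

theorem measurable_cutoff (p : MvPolynomial (Fin n) ℝ) : Measurable (cutoff p) :=
  (continuous_polyEval p).measurable.indicator measurableSet_unitCube

theorem exists_bound_cutoff (p : MvPolynomial (Fin n) ℝ) : ∃ B : ℝ, 0 ≤ B ∧ ∀ x, ‖cutoff p x‖ ≤ B := by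
  obtain ⟨B, hB⟩ := (isCompact_closedBall (0 : E n) n).exists_bound_of_continuousOn
    (continuous_polyEval p).continuousOn
  refine ⟨|B|, abs_nonneg _, fun x => ?_⟩
  by_cases hx : x ∈ unitCube n
  · rw [cutoff, indicator_of_mem hx]
    exact (hB x (unitCube_subset_closedBall hx)).trans (le_abs_self _)
  · rw [cutoff, indicator_of_notMem hx]; simp

theorem memLp_cutoff (p : MvPolynomial (Fin n) ℝ) (r : ENNReal) : MemLp (cutoff p) r := by
  obtain ⟨B, -, hB⟩ := exists_bound_cutoff p
  have h1 : MemLp (cutoff p) r (volume.restrict (unitCube n)) := by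
    have : IsFiniteMeasure ((volume : Measure (E n)).restrict (unitCube n)) :=
      ⟨by rw [Measure.restrict_apply_univ, volume_unitCube]; exact ENNReal.one_lt_top⟩
    exact MemLp.of_bound (measurable_cutoff p).aestronglyMeasurable B (Filter.Eventually.of_forall hB)
  have h2 := (memLp_indicator_iff_restrict measurableSet_unitCube).2 h1
  have h3 : (unitCube n).indicator (cutoff p) = cutoff p :=
    indicator_eq_self.2 support_indicator_subset
  rwa [h3] at h2

theorem polyEval_eq_sum_mono (p : MvPolynomial (Fin n) ℝ) (x : E n) :
    polyEval p x = ∑ d ∈ p.support, p.coeff d * mono d x := by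
  rw [polyEval, MvPolynomial.eval_eq']; rfl

theorem sum_lt_of_mem_support {p : MvPolynomial (Fin n) ℝ} (hp : p.totalDegree < κ)
    {d : Fin n →₀ ℕ} (hd : d ∈ p.support) : ∑ i, d i < κ := by
  have h := MvPolynomial.le_totalDegree hd
  rw [Finsupp.sum_fintype _ _ fun _ => rfl] at h
  exact h.trans_lt hp

theorem continuous_mono (β : Fin n → ℕ) : Continuous (mono β : E n → ℝ) := by
  unfold mono; fun_prop

theorem integrable_mul_polyEval {g : E n → ℝ} (hg : g ∈ alpertSpace n κ)
    {f : E n → ℝ} (hf : Continuous f) : Integrable fun x => g x * f x := by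
  obtain ⟨B, hB⟩ := (isCompact_closedBall (0 : E n) n).exists_bound_of_continuousOn hf.continuousOn
  refine Integrable.mono' ((integrable_of_mem_alpertSpace hg).norm.mul_const B)
    ((measurable_of_mem_alpertSpace hg).mul hf.measurable).aestronglyMeasurable
    (Filter.Eventually.of_forall fun x => ?_)
  by_cases hx : g x = 0
  · simp [hx]
  · rw [norm_mul]
    gcongr
    exact hB x (unitCube_subset_closedBall (support_of_mem_alpertSpace hg hx))

theorem integral_mul_polyEval {g : E n → ℝ} (hg : g ∈ alpertSpace n κ)
    {p : MvPolynomial (Fin n) ℝ} (hp : p.totalDegree < κ) : ∫ x, g x * polyEval p x = 0 := by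
  simp_rw [polyEval_eq_sum_mono, Finset.mul_sum]
  rw [integral_finsetSum _ fun d _ => integrable_mul_polyEval hg
    (f := fun x => p.coeff d * mono d x) (continuous_const.mul (continuous_mono d))]
  refine Finset.sum_eq_zero fun d hd => ?_
  have h := hg.2 d (sum_lt_of_mem_support hp hd)
  rw [setIntegral_eq_integral_of_forall_compl_eq_zero fun x hx => by
    rw [Function.notMem_support.1 fun h => hx (support_of_mem_alpertSpace hg h), zero_mul]] at h
  calc ∫ x, g x * (p.coeff d * mono d x) = p.coeff d * ∫ x, g x * mono d x := by
        rw [← integral_const_mul]; congr 1; funext x; ring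
    _ = 0 := by rw [h, mul_zero]

/-- Wavelets are orthogonal to polynomials on dyadic cubes which are not smaller. -/
theorem integral_wavelet_mul_cutoff {g : E n → ℝ} (hg : g ∈ alpertSpace n κ)
    {p : MvPolynomial (Fin n) ℝ} (hp : p.totalDegree < κ) {s t : ℤ} (hts : t ≤ s)
    (i j : Fin n → ℤ) : ∫ x, wavelet g 0 s j x * wavelet (cutoff p) 0 t i x = 0 := by
  rw [integral_wavelet_mul _ _ s t s, sub_self]
  obtain ⟨m, hm⟩ := Int.eq_ofNat_of_zero_le (sub_nonneg.2 hts)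
  have hts' : t - s = -(m : ℤ) := by omega
  rw [hts', wavelet_zero_eq, wavelet_zero_eq]
  simp only [zpow_zero, one_smul]
  rw [← integral_add_right_eq_self _ (latticePt j)]
  simp only [add_sub_cancel_right]
  set a : ℝ := (2 : ℝ) ^ (-(m : ℤ)) with ha
  have ha0 : 0 < a := by positivity
  obtain ⟨q, hq, hqe⟩ := exists_affine_comp p hp a (a • latticePt j - latticePt i)
  have hx : ∀ x : E n, a • (x + latticePt j) - latticePt i =
      a • x + (a • latticePt j - latticePt i) := fun x => by rw [smul_add]; abel
  -- Dyadic nesting: after rescaling, the unit cube of index `j` lies inside the larger cube or is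
  -- disjoint from it, according to an integer condition independent of x.
  have hmem : ∀ x ∈ unitCube n, (a • (x + latticePt j) - latticePt i ∈ unitCube n ↔
      ∀ l, i l * 2 ^ m ≤ j l ∧ j l < (i l + 1) * 2 ^ m) := fun x hx => by
    refine forall_congr' fun l => ?_
    have hl := hx l
    have hp : (0 : ℝ) < 2 ^ m := by positivity
    have e : (a • (x + latticePt j) - latticePt i) l = (x l + j l - i l * 2 ^ m) / 2 ^ m := by
      simp only [PiLp.sub_apply, PiLp.smul_apply, PiLp.add_apply, smul_eq_mul, ha, zpow_neg,
        zpow_natCast]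
      field_simp
    rw [e, mem_Ico, le_div_iff₀ hp, div_lt_iff₀ hp, zero_mul, one_mul]
    rw [mem_Ico] at hl
    constructor
    · rintro ⟨h1, h2⟩
      have h3 : (i l : ℝ) * 2 ^ m < j l + 1 := by linarith
      have h4 : (j l : ℝ) < (i l + 1) * 2 ^ m := by linarith
      have h3' : i l * 2 ^ m < j l + 1 := by exact_mod_cast h3
      have h4' : j l < (i l + 1) * 2 ^ m := by exact_mod_cast h4
      exact ⟨by omega, h4'⟩
    · rintro ⟨h1, h2⟩
      have h2' : j l + 1 ≤ (i l + 1) * 2 ^ m := by omega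
      have h3 : (i l : ℝ) * 2 ^ m ≤ j l := by exact_mod_cast h1
      have h4 : (j l : ℝ) + 1 ≤ (i l + 1) * 2 ^ m := by exact_mod_cast h2'
      constructor <;> linarith
  by_cases hc : ∀ l, i l * 2 ^ m ≤ j l ∧ j l < (i l + 1) * 2 ^ m
  · have : ∀ x, (2 : ℝ) ^ (((0 : ℤ) : ℝ) * n / 2) * g x *
        ((2 : ℝ) ^ (((-(m : ℤ) : ℤ) : ℝ) * n / 2) * cutoff p (a • (x + latticePt j) - latticePt i)) =
        ((2 : ℝ) ^ (((0 : ℤ) : ℝ) * n / 2) * (2 : ℝ) ^ (((-(m : ℤ) : ℤ) : ℝ) * n / 2)) *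
          (g x * polyEval q x) := fun x => by
      by_cases hgx : g x = 0
      · simp [hgx]
      · have hxu := support_of_mem_alpertSpace hg hgx
        rw [cutoff, indicator_of_mem ((hmem x hxu).2 hc), hqe, hx]
        ring
    simp_rw [this]
    rw [integral_const_mul, integral_mul_polyEval hg hq, mul_zero]
  · have : ∀ x, (2 : ℝ) ^ (((0 : ℤ) : ℝ) * n / 2) * g x *
        ((2 : ℝ) ^ (((-(m : ℤ) : ℤ) : ℝ) * n / 2) * cutoff p (a • (x + latticePt j) - latticePt i)) =
        0 := fun x => by
      by_cases hgx : g x = 0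
      · simp [hgx]
      · have hxu := support_of_mem_alpertSpace hg hgx
        rw [cutoff, indicator_of_notMem (mt (hmem x hxu).1 hc)]
        ring
    simp_rw [this]
    simp

/-- The corner of a child of the unit cube, as an integer vector. -/
def childIdx (c : Fin n → Fin 2) : Fin n → ℤ := fun l => ((c l : ℕ) : ℤ)

theorem mem_unitChild_iff (c : Fin n → Fin 2) (x : E n) :
    x ∈ unitChild c ↔ (2 : ℝ) • x - latticePt (childIdx c) ∈ unitCube n := by
  refine forall_congr' fun l => ?_
  simp only [PiLp.sub_apply, PiLp.smul_apply, smul_eq_mul, mem_Ico, childIdx, Int.cast_natCast]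
  constructor <;> rintro ⟨h1, h2⟩ <;> constructor <;> linarith

/-- Two-scale relation. -/
theorem wavelet_two_scale (u : E n → ℝ) (s : ℤ) (i k : Fin n → ℤ) (x : E n) :
    wavelet u 0 (s + 1) (fun l => 2 * i l + k l) x =
      (2 : ℝ) ^ ((n : ℝ) / 2) * wavelet (fun y => u ((2 : ℝ) • y - latticePt k)) 0 s i x := by
  simp only [wavelet_zero_eq]
  rw [← mul_assoc, ← Real.rpow_add (by norm_num)]
  congr 2
  · push_cast; ring
  · ext l
    simp only [PiLp.sub_apply, PiLp.smul_apply, smul_eq_mul]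
    rw [zpow_add₀ (by norm_num)]
    push_cast
    ring

theorem exists_child_cutoff (p : MvPolynomial (Fin n) ℝ) (hp : p.totalDegree < κ)
    (c : Fin n → Fin 2) : ∃ q : MvPolynomial (Fin n) ℝ, q.totalDegree < κ ∧
      (unitChild c).indicator (polyEval p) = fun x => cutoff q ((2 : ℝ) • x - latticePt (childIdx c)) := by
  obtain ⟨q, hq, hqe⟩ := exists_affine_comp p hp (1 / 2) ((1 / 2 : ℝ) • latticePt (childIdx c))
  refine ⟨q, hq, funext fun x => ?_⟩
  by_cases hx : x ∈ unitChild c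
  · rw [indicator_of_mem hx, cutoff, indicator_of_mem ((mem_unitChild_iff c x).1 hx), hqe]
    congr 1
    rw [smul_sub, smul_smul]; norm_num
  · rw [indicator_of_notMem hx, cutoff, indicator_of_notMem (mt (mem_unitChild_iff c x).2 hx)]

theorem exists_cutoff_child (p : MvPolynomial (Fin n) ℝ) (hp : p.totalDegree < κ)
    (c : Fin n → Fin 2) : ∃ q : MvPolynomial (Fin n) ℝ, q.totalDegree < κ ∧
      (fun x => cutoff p ((2 : ℝ) • x - latticePt (childIdx c))) =
        (unitChild c).indicator (polyEval q) := by
  obtain ⟨q, hq, hqe⟩ := exists_affine_comp p hp 2 (-latticePt (childIdx c))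
  refine ⟨q, hq, funext fun x => ?_⟩
  by_cases hx : x ∈ unitChild c
  · rw [indicator_of_mem hx, cutoff, indicator_of_mem ((mem_unitChild_iff c x).1 hx), hqe,
      sub_eq_add_neg]
  · rw [indicator_of_notMem hx, cutoff, indicator_of_notMem (mt (mem_unitChild_iff c x).2 hx)]

/-- Wavelets of different scales are orthogonal. -/
theorem integral_wavelet_mul_wavelet_of_lt {g h : E n → ℝ} (hg : g ∈ alpertSpace n κ)
    (hh : h ∈ alpertSpace n κ) {s t : ℤ} (hts : t < s) (i j : Fin n → ℤ) :
    ∫ x, wavelet g 0 s j x * wavelet h 0 t i x = 0 := by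
  obtain ⟨⟨p, hpd, hp⟩, -⟩ := hh
  choose q hqd hq using fun c => exists_child_cutoff (p c) (hpd c) c
  -- The coarser wavelet is a sum of polynomials on cubes of scale t + 1 ≤ s, to which the finer one
  -- is orthogonal.
  have e : ∀ x, wavelet h 0 t i x = ∑ c, (2 : ℝ) ^ (-((n : ℝ) / 2)) *
      wavelet (cutoff (q c)) 0 (t + 1) (fun l => 2 * i l + childIdx c l) x := fun x => by
    simp_rw [wavelet_two_scale, ← mul_assoc, ← Real.rpow_add (by norm_num : (0 : ℝ) < 2)]
    rw [neg_add_cancel, Real.rpow_zero]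
    simp only [one_mul, wavelet_zero_eq]
    rw [hp, Finset.mul_sum]
    refine Finset.sum_congr rfl fun c _ => ?_
    exact congrArg _ (congrFun (hq c) _)
  simp_rw [e, Finset.mul_sum]
  rw [integral_finsetSum]
  · refine Finset.sum_eq_zero fun c _ => ?_
    have h1 := integral_wavelet_mul_cutoff hg (hqd c) (show t + 1 ≤ s by omega)
      (fun l => 2 * i l + childIdx c l) j
    have : ∀ x, wavelet g 0 s j x * ((2 : ℝ) ^ (-((n : ℝ) / 2)) *
        wavelet (cutoff (q c)) 0 (t + 1) (fun l => 2 * i l + childIdx c l) x) =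
        (2 : ℝ) ^ (-((n : ℝ) / 2)) * (wavelet g 0 s j x *
        wavelet (cutoff (q c)) 0 (t + 1) (fun l => 2 * i l + childIdx c l) x) := fun x => by ring
    simp_rw [this]
    rw [integral_const_mul, h1, mul_zero]
  · intro c _
    exact (memLp_wavelet (memLp_of_mem_alpertSpace hg 2) s j).integrable_mul
      ((memLp_wavelet (memLp_cutoff (q c) 2) _ _).const_mul _)

end Polynomials

/-! ### Completeness of the Alpert wavelets -/

section Completeness

variable {n κ : ℕ}

theorem cutoff_add (p q : MvPolynomial (Fin n) ℝ) : cutoff (p + q) = cutoff p + cutoff q := by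
  rw [cutoff, cutoff, cutoff, ← indicator_add']
  congr 1; funext x; simp [polyEval]

theorem cutoff_smul (a : ℝ) (p : MvPolynomial (Fin n) ℝ) : cutoff (a • p) = a • cutoff p := by
  funext x
  by_cases hx : x ∈ unitCube n
  · simp [cutoff, indicator_of_mem hx, polyEval]
  · simp [cutoff, indicator_of_notMem hx]

/-- Gram–Schmidt for the range of a linear map. -/
theorem exists_orthonormal_range {V H : Type*} [AddCommGroup V] [Module ℝ V]
    [Module.Finite ℝ V] [NormedAddCommGroup H] [InnerProductSpace ℝ H] (L : V →ₗ[ℝ] H) :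
    ∃ (D : ℕ) (e : Fin D → V), (∀ l m, inner ℝ (L (e l)) (L (e m)) = if l = m then 1 else 0) ∧
      ∀ P, L P = ∑ l, inner ℝ (L (e l)) (L P) • L (e l) := by
  let b := stdOrthonormalBasis ℝ (LinearMap.range L)
  choose e he using fun l => (b l).2
  refine ⟨_, e, fun l m => ?_, fun P => ?_⟩
  · rw [he, he, ← Submodule.coe_inner, orthonormal_iff_ite.1 b.orthonormal]
  · have h := congrArg Subtype.val (b.sum_repr' ⟨L P, LinearMap.mem_range_self L P⟩)
    rw [Submodule.coe_sum] at h
    conv_lhs => rw [← show _ = L P from h]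
    refine Finset.sum_congr rfl fun l _ => ?_
    rw [Submodule.coe_smul, he, Submodule.coe_inner]

/-- Polynomials of degree less than `κ` on the unit cube have an orthonormal basis. -/
theorem exists_orthonormal_polynomials (n : ℕ) (hκ : 0 < κ) :
    ∃ (D : ℕ) (e : Fin D → MvPolynomial (Fin n) ℝ), (∀ l, (e l).totalDegree < κ) ∧
      (∀ l m, ∫ x, cutoff (e l) x * cutoff (e m) x = if l = m then 1 else 0) ∧
      ∀ u : E n → ℝ, MemLp u 2 → ∀ p : MvPolynomial (Fin n) ℝ, p.totalDegree < κ →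
        ∫ x, (u x - ∑ l, (∫ y, cutoff (e l) y * u y) * cutoff (e l) x) * cutoff p x = 0 := by
  let V := MvPolynomial.restrictTotalDegree (Fin n) ℝ (κ - 1)
  have hV : ∀ p : MvPolynomial (Fin n) ℝ, p ∈ V ↔ p.totalDegree < κ := fun p => by
    rw [MvPolynomial.mem_restrictTotalDegree]; omega
  -- Gram–Schmidt is carried out in the range of `L` and lifted back to polynomials, so injectivity
  -- of the cutoff need not be known.
  let L : V →ₗ[ℝ] Lp ℝ 2 (volume : Measure (E n)) :=
    { toFun := fun p => (memLp_cutoff p.1 2).toLp (cutoff p.1)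
      map_add' := fun p q => by
        rw [← MemLp.toLp_add]
        exact MemLp.toLp_congr _ _ (Filter.EventuallyEq.of_eq (cutoff_add p.1 q.1))
      map_smul' := fun a p => by
        rw [RingHom.id_apply, ← MemLp.toLp_const_smul]
        exact MemLp.toLp_congr _ _ (Filter.EventuallyEq.of_eq (cutoff_smul a p.1)) }
  obtain ⟨D, e, heo, hes⟩ := exists_orthonormal_range L
  have hinner : ∀ (p : V) (u : E n → ℝ) (hu : MemLp u 2),
      inner ℝ (L p) (hu.toLp u) = ∫ x, cutoff p.1 x * u x := fun p u hu => by
    rw [L2.inner_def]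
    refine integral_congr_ae ?_
    filter_upwards [(memLp_cutoff p.1 2).coeFn_toLp, hu.coeFn_toLp] with x h1 h2
    change inner ℝ (((memLp_cutoff p.1 2).toLp (cutoff p.1)) x) _ = _
    rw [h1, h2]
    simp [mul_comm]
  refine ⟨D, fun l => (e l).1, fun l => (hV _).1 (e l).2, fun l m => ?_, fun u hu p hp => ?_⟩
  · rw [← hinner (e l) _ (memLp_cutoff (e m).1 2)]
    exact heo l m
  · obtain ⟨P, rfl⟩ : ∃ P : V, P.1 = p := ⟨⟨p, (hV p).2 hp⟩, rfl⟩
    have hw := hes P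
    -- Parseval for the polynomial P against u; rearranged, it says that u minus its projection is
    -- orthogonal to P.
    have h1 : inner ℝ (L P) (hu.toLp u) =
        ∑ l, inner ℝ (L (e l)) (L P) * inner ℝ (L (e l)) (hu.toLp u) := by
      conv_lhs => rw [hw]
      rw [sum_inner]
      exact Finset.sum_congr rfl fun l _ => by rw [inner_smul_left]; rfl
    have hip : ∀ f g : E n → ℝ, MemLp f 2 → MemLp g 2 → Integrable fun x => f x * g x :=
      fun f g hf hg => hf.integrable_mul hg
    have h2 : ∀ l, inner ℝ (L (e l)) (L P) = ∫ x, cutoff (e l).1 x * cutoff P.1 x := fun l =>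
      hinner (e l) _ (memLp_cutoff P.1 2)
    rw [hinner P u hu] at h1
    simp_rw [h2, hinner _ u hu] at h1
    simp_rw [sub_mul, Finset.sum_mul]
    rw [integral_sub (hip _ _ hu (memLp_cutoff P.1 2)), integral_finsetSum]
    · have h3 : ∀ l, ∫ x, (∫ y, cutoff (e l).1 y * u y) * cutoff (e l).1 x * cutoff P.1 x =
          (∫ x, cutoff (e l).1 x * cutoff P.1 x) * ∫ y, cutoff (e l).1 y * u y := fun l => by
        simp_rw [mul_assoc]
        rw [integral_const_mul, mul_comm]
      simp_rw [h3]
      rw [← h1, sub_eq_zero]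
      congr 1; funext x; rw [mul_comm]
    · intro l _
      simp_rw [mul_assoc]
      exact (hip _ _ (memLp_cutoff _ 2) (memLp_cutoff P.1 2)).const_mul _
    · refine integrable_finsetSum _ fun l _ => ?_
      simp_rw [mul_assoc]
      exact (hip _ _ (memLp_cutoff _ 2) (memLp_cutoff P.1 2)).const_mul _

/-- Functions that are polynomials on the children of the unit cube. -/
def piecewisePoly (n κ : ℕ) : Set (E n → ℝ) :=
  {g | ∃ p : (Fin n → Fin 2) → MvPolynomial (Fin n) ℝ, (∀ c, (p c).totalDegree < κ) ∧
    ∀ x, g x = ∑ c, (unitChild c).indicator (polyEval (p c)) x}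

theorem exists_mem_unitChild {x : E n} (hx : x ∈ unitCube n) :
    ∃ c, x ∈ unitChild c ∧ ∀ c', x ∈ unitChild c' → c' = c := by
  have h : ∀ i, ∃ b : Fin 2, x i ∈ Ico (((b : ℕ) : ℝ) / 2) ((((b : ℕ) : ℝ) + 1) / 2) ∧
      ∀ b' : Fin 2, x i ∈ Ico (((b' : ℕ) : ℝ) / 2) ((((b' : ℕ) : ℝ) + 1) / 2) → b' = b := fun i => by
    have h1 := hx i
    rw [mem_Ico] at h1
    by_cases h2 : x i < 1 / 2
    · refine ⟨0, ⟨by simpa using h1.1, by simpa using h2⟩, fun b' hb => ?_⟩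
      fin_cases b'
      · rfl
      · simp at hb; linarith [hb.1]
    · push Not at h2
      refine ⟨1, ⟨by simpa using h2, by norm_num; exact h1.2⟩, fun b' hb => ?_⟩
      fin_cases b'
      · simp at hb; linarith [hb.2]
      · rfl
  choose c hc hc' using h
  exact ⟨c, hc, fun c' h' => funext fun i => hc' i _ (h' i)⟩

theorem cutoff_eq_sum_children (p : MvPolynomial (Fin n) ℝ) (x : E n) :
    cutoff p x = ∑ c, (unitChild c).indicator (polyEval p) x := by
  by_cases hx : x ∈ unitCube n
  · obtain ⟨c, hc, hc'⟩ := exists_mem_unitChild hx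
    rw [cutoff, indicator_of_mem hx, Finset.sum_eq_single c, indicator_of_mem hc]
    · exact fun c' _ h => indicator_of_notMem (fun h' => h (hc' c' h')) _
    · simp
  · rw [cutoff, indicator_of_notMem hx]
    exact (Finset.sum_eq_zero fun c _ =>
      indicator_of_notMem (fun h => hx (unitChild_subset c h)) _).symm

theorem cutoff_mem_piecewisePoly {p : MvPolynomial (Fin n) ℝ} (hp : p.totalDegree < κ) :
    cutoff p ∈ piecewisePoly n κ :=
  ⟨fun _ => p, fun _ => hp, cutoff_eq_sum_children p⟩

theorem childCutoff_mem_piecewisePoly {p : MvPolynomial (Fin n) ℝ} (hp : p.totalDegree < κ)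
    (c : Fin n → Fin 2) :
    (fun x => cutoff p ((2 : ℝ) • x - latticePt (childIdx c))) ∈ piecewisePoly n κ := by
  classical
  obtain ⟨q, hq, hqe⟩ := exists_cutoff_child p hp c
  have h0 : (0 : MvPolynomial (Fin n) ℝ).totalDegree < κ := by
    rw [MvPolynomial.totalDegree_zero]; omega
  refine ⟨fun c' => if c' = c then q else 0, fun c' => by beta_reduce; split_ifs <;> assumption, fun x => ?_⟩
  rw [hqe, Finset.sum_eq_single c]
  · simp
  · intro c' _ h
    simp [h, polyEval, indicator]
  · simp

theorem totalDegree_monomial_lt {β : Fin n → ℕ} (hβ : ∑ i, β i < κ) :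
    (MvPolynomial.monomial (Finsupp.equivFunOnFinite.symm β) (1 : ℝ)).totalDegree < κ := by
  refine (MvPolynomial.totalDegree_monomial_le _ _).trans_lt ?_
  rw [Finsupp.sum_fintype _ _ fun _ => rfl]
  simpa using hβ

theorem polyEval_monomial (β : Fin n → ℕ) (x : E n) :
    polyEval (MvPolynomial.monomial (Finsupp.equivFunOnFinite.symm β) (1 : ℝ)) x = mono β x := by
  rw [polyEval, MvPolynomial.eval_monomial, one_mul, Finsupp.prod_fintype _ _ (by simp)]
  rfl

/-- Splitting off the polynomial part of a piecewise polynomial leaves a combination of Alpert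
wavelets. -/
theorem exists_sub_mem_alpertSpace {D : ℕ} {e : Fin D → MvPolynomial (Fin n) ℝ}
    (hdeg : ∀ l, (e l).totalDegree < κ)
    (hproj : ∀ u : E n → ℝ, MemLp u 2 → ∀ p : MvPolynomial (Fin n) ℝ, p.totalDegree < κ →
        ∫ x, (u x - ∑ l, (∫ y, cutoff (e l) y * u y) * cutoff (e l) x) * cutoff p x = 0)
    {u : E n → ℝ} (hu : u ∈ piecewisePoly n κ) (hu2 : MemLp u 2) :
    ∃ α : Fin D → ℝ, (fun x => u x - ∑ l, α l * cutoff (e l) x) ∈ alpertSpace n κ := by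
  obtain ⟨p, hp, hpe⟩ := hu
  set α : Fin D → ℝ := fun l => ∫ y, cutoff (e l) y * u y with hα
  refine ⟨α, ⟨fun c => p c - ∑ l, α l • e l, fun c => ?_, fun x => ?_⟩, fun β hβ => ?_⟩
  · have hκ : 0 < κ := (Nat.zero_le _).trans_lt (hp c)
    refine (MvPolynomial.totalDegree_sub _ _).trans_lt (max_lt (hp c) ?_)
    refine lt_of_le_of_lt (MvPolynomial.totalDegree_finsetSum_le (d := κ - 1) fun l _ => ?_)
      (by omega)
    exact (MvPolynomial.totalDegree_smul_le _ _).trans (by have := hdeg l; omega)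
  · beta_reduce
    rw [hpe]
    simp_rw [cutoff_eq_sum_children, Finset.mul_sum]
    rw [Finset.sum_comm, ← Finset.sum_sub_distrib]
    refine Finset.sum_congr rfl fun c _ => ?_
    by_cases hx : x ∈ unitChild c
    · simp only [indicator_of_mem hx, polyEval, map_sub, map_sum, MvPolynomial.smul_eval]
    · simp only [indicator_of_notMem hx]
      simp
  · rw [← hproj u hu2 _ (totalDegree_monomial_lt hβ), ← integral_indicator measurableSet_unitCube]
    congr 1
    funext x
    by_cases hx : x ∈ unitCube n
    · rw [indicator_of_mem hx, cutoff, indicator_of_mem hx, polyEval_monomial]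
    · rw [indicator_of_notMem hx, cutoff, indicator_of_notMem hx, mul_zero]

theorem realL2_wavelet_add {f g : E n → ℝ} (hf : MemLp f 2) (hg : MemLp g 2) (s : ℤ)
    (j : Fin n → ℤ) : realL2 (wavelet (fun x => f x + g x) 0 s j) =
      realL2 (wavelet f 0 s j) + realL2 (wavelet g 0 s j) := by
  rw [realL2, realL2, realL2, ← toL2_add (memLp_ofReal (memLp_wavelet hf s j))
    (memLp_ofReal (memLp_wavelet hg s j))]
  congr 1; funext x; simp only [wavelet]; push_cast; ring

theorem realL2_wavelet_sum {ι : Type*} (S : Finset ι) (α : ι → ℝ) {f : ι → E n → ℝ}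
    (hf : ∀ i, MemLp (f i) 2) (s : ℤ) (j : Fin n → ℤ) :
    realL2 (wavelet (fun x => ∑ i ∈ S, α i * f i x) 0 s j) =
      ∑ i ∈ S, (α i : ℂ) • realL2 (wavelet (f i) 0 s j) := by
  rw [realL2, ← toL2_sum S (fun i => (α i : ℂ)) fun i _ => memLp_ofReal (memLp_wavelet (hf i) s j)]
  congr 1; funext x; simp only [wavelet]; push_cast; rw [Finset.mul_sum]
  exact Finset.sum_congr rfl fun i _ => by ring

variable {M : ℕ} {h : Fin M → E n → ℝ}

theorem IsAlpertBasis.mem (hh : IsAlpertBasis κ h) (a : Fin M) : h a ∈ alpertSpace n κ := by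
  rw [← hh.span_eq]; exact Submodule.subset_span (mem_range_self a)

theorem IsAlpertBasis.memLp (hh : IsAlpertBasis κ h) (a : Fin M) : MemLp (h a) 2 :=
  memLp_of_mem_alpertSpace (hh.mem a) 2

theorem IsAlpertBasis.exists_sum (hh : IsAlpertBasis κ h) {g : E n → ℝ}
    (hg : g ∈ alpertSpace n κ) : ∃ α : Fin M → ℝ, g = fun x => ∑ a, α a * h a x := by
  rw [← hh.span_eq, SetLike.mem_coe, Submodule.mem_span_range_iff_exists_fun] at hg
  obtain ⟨α, rfl⟩ := hg
  exact ⟨α, by funext x; simp⟩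

/-- The span of the wavelets of the cubes of side at most `2⁻ᵗ`. -/
noncomputable def waveletSpan (h : Fin M → E n → ℝ) (t : ℤ) : Submodule ℂ (L2 n) :=
  Submodule.span ℂ {F | ∃ t' ≥ t, ∃ i a, F = realL2 (wavelet (h a) 0 t' i)}

theorem waveletSpan_anti {t t' : ℤ} (ht : t ≤ t') : waveletSpan h t' ≤ waveletSpan h t :=
  Submodule.span_mono fun _ ⟨r, hr, hF⟩ => ⟨r, le_trans ht hr, hF⟩

theorem IsAlpertBasis.wavelet_mem_waveletSpan (hh : IsAlpertBasis κ h) {g : E n → ℝ}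
    (hg : g ∈ alpertSpace n κ) (t : ℤ) (i : Fin n → ℤ) :
    realL2 (wavelet g 0 t i) ∈ waveletSpan h t := by
  obtain ⟨α, rfl⟩ := hh.exists_sum hg
  rw [realL2_wavelet_sum _ _ hh.memLp]
  exact Submodule.sum_mem _ fun a _ => Submodule.smul_mem _ _
    (Submodule.subset_span ⟨t, le_rfl, i, a, rfl⟩)

/-- The polynomials on one dyadic cube. -/
noncomputable def polySpan {D : ℕ} (e : Fin D → MvPolynomial (Fin n) ℝ) (t : ℤ) (i : Fin n → ℤ) :
    Submodule ℂ (L2 n) :=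
  Submodule.span ℂ (range fun l => realL2 (wavelet (cutoff (e l)) 0 t i))

variable {D : ℕ} {e : Fin D → MvPolynomial (Fin n) ℝ}

/-- One multiresolution step: removing the polynomial projection from a piecewise polynomial leaves
an element of the Alpert space, and the splitting rescales to any cube. -/
theorem IsAlpertBasis.piecewise_mem (hh : IsAlpertBasis κ h) (hdeg : ∀ l, (e l).totalDegree < κ)
    (hproj : ∀ u : E n → ℝ, MemLp u 2 → ∀ p : MvPolynomial (Fin n) ℝ, p.totalDegree < κ →
        ∫ x, (u x - ∑ l, (∫ y, cutoff (e l) y * u y) * cutoff (e l) x) * cutoff p x = 0)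
    {u : E n → ℝ} (hu : u ∈ piecewisePoly n κ) (hu2 : MemLp u 2) (t : ℤ) (i : Fin n → ℤ) :
    realL2 (wavelet u 0 t i) ∈ polySpan e t i ⊔ waveletSpan h t := by
  obtain ⟨α, hα⟩ := exists_sub_mem_alpertSpace hdeg hproj hu hu2
  have e1 : u = fun x => ∑ l, α l * cutoff (e l) x + (u x - ∑ l, α l * cutoff (e l) x) := by
    funext x; ring
  rw [e1, realL2_wavelet_add (memLp_finsetSum _ fun l _ => (memLp_cutoff (e l) 2).const_mul _)
    (memLp_of_mem_alpertSpace hα 2), realL2_wavelet_sum _ _ fun l => memLp_cutoff (e l) 2]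
  refine Submodule.add_mem_sup ?_ (hh.wavelet_mem_waveletSpan hα t i)
  exact Submodule.sum_mem _ fun l _ => Submodule.smul_mem _ _
    (Submodule.subset_span (mem_range_self l))

/-- A polynomial on a cube is piecewise polynomial on the parent, whose index is the floor of i / 2.
Iteration climbs to ever larger cubes at the expense of wavelets. -/
theorem IsAlpertBasis.polySpan_le (hh : IsAlpertBasis κ h) (hdeg : ∀ l, (e l).totalDegree < κ)
    (hproj : ∀ u : E n → ℝ, MemLp u 2 → ∀ p : MvPolynomial (Fin n) ℝ, p.totalDegree < κ →
        ∫ x, (u x - ∑ l, (∫ y, cutoff (e l) y * u y) * cutoff (e l) x) * cutoff p x = 0)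
    (t : ℤ) (i : Fin n → ℤ) :
    polySpan e (t + 1) i ≤ polySpan e t (fun l => i l / 2) ⊔ waveletSpan h t := by
  rw [polySpan, Submodule.span_le]
  rintro _ ⟨l, rfl⟩
  set c : Fin n → Fin 2 := fun r => ⟨(i r % 2).toNat, by omega⟩ with hc
  have hi : i = fun r => 2 * (i r / 2) + childIdx c r := by
    funext r
    simp only [childIdx, hc]
    omega
  set u : E n → ℝ := fun x => cutoff (e l) ((2 : ℝ) • x - latticePt (childIdx c)) with hu
  have hu2 : MemLp u 2 := by
    have := memLp_comp_affine (memLp_cutoff (e l) 2) 1 (latticePt (childIdx c))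
    simpa using this
  have h1 := hh.piecewise_mem hdeg hproj (childCutoff_mem_piecewisePoly (hdeg l) c) hu2 t
    (fun r => i r / 2)
  have h2 : realL2 (wavelet (cutoff (e l)) 0 (t + 1) i) =
      (((2 : ℝ) ^ ((n : ℝ) / 2) : ℝ) : ℂ) • realL2 (wavelet u 0 t fun r => i r / 2) := by
    rw [realL2, realL2, ← toL2_const_mul (memLp_ofReal (memLp_wavelet hu2 _ _))]
    congr 1; funext x
    conv_lhs => rw [hi]
    rw [wavelet_two_scale]
    push_cast; rfl
  change realL2 (wavelet (cutoff (e l)) 0 (t + 1) i) ∈ _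
  rw [h2]
  exact Submodule.smul_mem _ _ h1

end Completeness

/-! ### The Hilbert basis of Alpert wavelets -/

section HilbertBasis

variable {n κ : ℕ} {M : ℕ} {h : Fin M → E n → ℝ} {D : ℕ} {e : Fin D → MvPolynomial (Fin n) ℝ}

/-- Consequently the polynomial part of a function can be read off by pairing with the function
itself, the wavelet part contributing nothing. -/
theorem IsAlpertBasis.inner_waveletSpan_polySpan (hh : IsAlpertBasis κ h)
    (hdeg : ∀ l, (e l).totalDegree < κ) {t : ℤ} {i : Fin n → ℤ} {w : L2 n}
    (hw : w ∈ waveletSpan h t) (l : Fin D) :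
    inner ℂ (realL2 (wavelet (cutoff (e l)) 0 t i)) w = 0 := by
  induction hw using Submodule.span_induction with
  | mem w hw =>
    obtain ⟨t', ht, j, a, rfl⟩ := hw
    rw [inner_realL2 (memLp_wavelet (memLp_cutoff (e l) 2) _ _) (memLp_wavelet (hh.memLp a) _ _)]
    have := integral_wavelet_mul_cutoff (hh.mem a) (hdeg l) ht i j
    simp_rw [mul_comm] at this ⊢
    rw [this, Complex.ofReal_zero]
  | zero => simp
  | add x y _ _ hx hy => rw [inner_add_right, hx, hy, add_zero]
  | smul c x _ hx => rw [inner_smul_right, hx, mul_zero]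

theorem integral_wavelet_mul_same (f g : E n → ℝ) (t : ℤ) (i : Fin n → ℤ) :
    ∫ x, wavelet f 0 t i x * wavelet g 0 t i x = ∫ x, f x * g x := by
  rw [integral_wavelet_mul _ _ t t t, sub_self, wavelet_zero_eq, wavelet_zero_eq]
  simp only [Int.cast_zero, zero_mul, zero_div, Real.rpow_zero, one_mul, zpow_zero, one_smul]
  exact integral_sub_right_eq_self (fun x => f x * g x) _

theorem orthonormal_polynomial_wavelets
    (ho : ∀ l m, ∫ x, cutoff (e l) x * cutoff (e m) x = if l = m then 1 else 0) (t : ℤ)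
    (i : Fin n → ℤ) : Orthonormal ℂ fun l => realL2 (wavelet (cutoff (e l)) 0 t i) := by
  rw [orthonormal_iff_ite]
  intro l m
  rw [inner_realL2 (memLp_wavelet (memLp_cutoff (e l) 2) _ _)
    (memLp_wavelet (memLp_cutoff (e m) 2) _ _), integral_wavelet_mul_same, ho]
  split_ifs <;> simp

theorem totalDegree_one_lt (hκ : 0 < κ) : (1 : MvPolynomial (Fin n) ℝ).totalDegree < κ := by
  rwa [MvPolynomial.totalDegree_one]

/-- Sup norm against L¹ norm: the normalisation of the polynomial contributes 2^{tn/2} and the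
integral of the normalised indicator 2^{-sn/2}. The bound decays when the cube of the polynomial
grows. -/
theorem norm_inner_cutoff_le {p : MvPolynomial (Fin n) ℝ} {B : ℝ} (hB : ∀ x, ‖cutoff p x‖ ≤ B)
    (s t : ℤ) (i j : Fin n → ℤ) :
    ‖inner ℂ (realL2 (wavelet (cutoff p) 0 t i)) (realL2 (wavelet (cutoff 1) 0 s j))‖ ≤
      B * (2 : ℝ) ^ (((t : ℝ) - s) * n / 2) := by
  rw [inner_realL2 (memLp_wavelet (memLp_cutoff p 2) _ _) (memLp_wavelet (memLp_cutoff 1 2) _ _),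
    Complex.norm_real]
  have h1 : ∀ x, cutoff (1 : MvPolynomial (Fin n) ℝ) x = (unitCube n).indicator 1 x := fun x => by
    by_cases hx : x ∈ unitCube n
    · simp [cutoff, indicator_of_mem hx, polyEval]
    · simp [cutoff, indicator_of_notMem hx]
  have hw0 : ∀ x, 0 ≤ wavelet (cutoff (1 : MvPolynomial (Fin n) ℝ)) 0 s j x := fun x => by
    simp only [wavelet_zero_eq, h1]
    exact mul_nonneg (by positivity) (indicator_nonneg (fun _ _ => zero_le_one) _)
  have hi1 : ∫ x, wavelet (cutoff (1 : MvPolynomial (Fin n) ℝ)) 0 s j x =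
      (2 : ℝ) ^ (-(s : ℝ) * n / 2) := by
    rw [wavelet_zero_eq]
    rw [integral_const_mul, integral_comp_affine]
    simp_rw [h1]
    rw [integral_indicator_one measurableSet_unitCube, measureReal_def, volume_unitCube,
      ← two_rpow_half_sq, smul_eq_mul, ENNReal.toReal_one, mul_one, mul_inv, ← mul_assoc,
      mul_inv_cancel₀ (by positivity), one_mul, ← Real.rpow_neg (by norm_num)]
    congr 1; ring
  calc _ ≤ ∫ x, ((2 : ℝ) ^ ((t : ℝ) * n / 2) * B) *
        wavelet (cutoff (1 : MvPolynomial (Fin n) ℝ)) 0 s j x := by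
        refine norm_integral_le_of_norm_le ?_ (Filter.Eventually.of_forall fun x => ?_)
        · exact ((memLp_one_iff_integrable.1 (memLp_wavelet (memLp_cutoff 1 1) s j))).const_mul _
        · rw [norm_mul, Real.norm_of_nonneg (hw0 x)]
          refine mul_le_mul_of_nonneg_right ?_ (hw0 x)
          rw [wavelet_zero_eq, norm_mul, Real.norm_of_nonneg (by positivity)]
          exact mul_le_mul_of_nonneg_left (hB _) (by positivity)
    _ = _ := by
        rw [integral_const_mul, hi1, mul_assoc, mul_comm, mul_assoc,
          ← Real.rpow_add (by norm_num)]
        congr 2; ring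

/-- A function orthogonal to all the wavelets has mean zero over every dyadic cube. -/
theorem IsAlpertBasis.inner_indicator_eq_zero (hn : 0 < n) (hκ : 0 < κ) (hh : IsAlpertBasis κ h)
    {F : L2 n} (hF : ∀ t i a, inner ℂ (realL2 (wavelet (h a) 0 t i)) F = 0) (s : ℤ)
    (j : Fin n → ℤ) : inner ℂ (realL2 (wavelet (cutoff 1) 0 s j)) F = 0 := by
  obtain ⟨D, e, hdeg, ho, hproj⟩ := exists_orthonormal_polynomials n hκ
  -- Climbing k generations: modulo wavelets, the indicator is a polynomial on its k-th ancestor.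
  have htower : ∀ k : ℕ, ∃ i, realL2 (wavelet (cutoff 1) 0 s j) ∈
      polySpan e (s - k) i ⊔ waveletSpan h (s - k) := fun k => by
    induction k with
    | zero =>
      refine ⟨j, ?_⟩
      rw [Nat.cast_zero, sub_zero]
      exact hh.piecewise_mem hdeg hproj (cutoff_mem_piecewisePoly (totalDegree_one_lt hκ))
        (memLp_cutoff 1 2) s j
    | succ k ih =>
      obtain ⟨i, hi⟩ := ih
      have e1 : s - (k : ℤ) = s - (k + 1 : ℕ) + 1 := by push_cast; ring
      refine ⟨fun l => i l / 2, ?_⟩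
      refine SetLike.le_def.1 (sup_le ?_ ?_) hi
      · rw [e1]
        exact hh.polySpan_le hdeg hproj _ i
      · exact (waveletSpan_anti (by push_cast; omega)).trans le_sup_right
  have hspan : ∀ t, ∀ w ∈ waveletSpan h t, inner ℂ w F = 0 := fun t w hw => by
    induction hw using Submodule.span_induction with
    | mem w hw => obtain ⟨t', -, i, a, rfl⟩ := hw; exact hF t' i a
    | zero => simp
    | add x y _ _ hx hy => rw [inner_add_left, hx, hy, add_zero]
    | smul c x _ hx => rw [inner_smul_left, hx, mul_zero]
  choose B hB0 hB using fun l => exists_bound_cutoff (e l)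
  set C : ℝ := (∑ l, B l) * ‖F‖ with hC
  -- `F` sees only the polynomial part, whose coefficients in the orthonormal system are
  -- O(2^{-nk/2}). Since n > 0, letting k tend to infinity gives zero.
  have hbound : ∀ k : ℕ, ‖inner ℂ (realL2 (wavelet (cutoff 1) 0 s j)) F‖ ≤
      C * ((2 : ℝ) ^ (-(n : ℝ) / 2)) ^ k := fun k => by
    obtain ⟨i, hi⟩ := htower k
    obtain ⟨u, hu, w, hw, huw⟩ := Submodule.mem_sup.1 hi
    obtain ⟨c, rfl⟩ := (Submodule.mem_span_range_iff_exists_fun ℂ).1 hu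
    have hon := orthonormal_polynomial_wavelets ho (s - k) i
    have hc : ∀ l, ‖c l‖ ≤ B l * ((2 : ℝ) ^ (-(n : ℝ) / 2)) ^ k := fun l => by
      have h1 := hon.inner_right_fintype c l
      have h2 : inner ℂ (realL2 (wavelet (cutoff (e l)) 0 (s - k) i))
          (realL2 (wavelet (cutoff 1) 0 s j)) = c l := by
        rw [← huw, inner_add_right, h1, hh.inner_waveletSpan_polySpan hdeg hw l, add_zero]
      rw [← h2]
      refine (norm_inner_cutoff_le (hB l) s (s - k) i j).trans (le_of_eq ?_)
      rw [← Real.rpow_natCast, ← Real.rpow_mul (by norm_num)]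
      congr 2; push_cast; ring
    rw [← huw, inner_add_left, hspan _ w hw, add_zero, sum_inner]
    refine (norm_sum_le _ _).trans ?_
    rw [hC, Finset.sum_mul, Finset.sum_mul]
    refine Finset.sum_le_sum fun l _ => ?_
    rw [inner_smul_left, norm_mul, RCLike.norm_conj]
    have h3 : ‖inner ℂ (realL2 (wavelet (cutoff (e l)) 0 (s - k) i)) F‖ ≤ ‖F‖ := by
      have := norm_inner_le_norm (𝕜 := ℂ) (realL2 (wavelet (cutoff (e l)) 0 (s - k) i)) F
      have h4 := hon.1 l
      simp only at h4
      rwa [h4, one_mul] at this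
    calc _ ≤ (B l * ((2 : ℝ) ^ (-(n : ℝ) / 2)) ^ k) * ‖F‖ := by
          have := hB0 l
          gcongr
          exact hc l
      _ = _ := by ring
  have hq1 : (2 : ℝ) ^ (-(n : ℝ) / 2) < 1 := by
    refine Real.rpow_lt_one_of_one_lt_of_neg (by norm_num) ?_
    have : (0 : ℝ) < n := by exact_mod_cast hn
    linarith
  have hlim := (tendsto_pow_atTop_nhds_zero_of_lt_one (by positivity) hq1).const_mul C
  rw [mul_zero] at hlim
  exact norm_le_zero_iff.1 (ge_of_tendsto' hlim hbound)

/-- Step functions on dyadic cubes are dense in `L²`. -/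
theorem eq_zero_of_inner_cubes {F : L2 n}
    (hF : ∀ (s : ℤ) (j : Fin n → ℤ), inner ℂ (realL2 (wavelet (cutoff 1) 0 s j)) F = 0) :
    F = 0 := by
  have hloc : LocallyIntegrable F volume := (Lp.memLp F).locallyIntegrable (by norm_num)
  have hFm : AEStronglyMeasurable F := (Lp.memLp F).1
  set Q : ℕ → (Fin n → ℤ) → Set (E n) := fun s j =>
    {x | (2 : ℝ) ^ (s : ℤ) • x - latticePt j ∈ unitCube n} with hQ
  have hQm : ∀ s j, MeasurableSet (Q s j) := fun s j =>
    (by fun_prop : Measurable fun x : E n => (2 : ℝ) ^ (s : ℤ) • x - latticePt j)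
      measurableSet_unitCube
  have hQint : ∀ s j, ∫ x, (Q s j).indicator F x = 0 := fun s j => by
    have h1 := hF s j
    have hm := memLp_ofReal (memLp_wavelet (memLp_cutoff (1 : MvPolynomial (Fin n) ℝ) 2) (s : ℤ) j)
    rw [realL2, L2.inner_def] at h1
    have h2 : ∀ᵐ x, inner ℂ (toL2 (fun x => (wavelet (cutoff (1 : MvPolynomial (Fin n) ℝ)) 0 s j x : ℂ)) x)
        (F x) = (((2 : ℝ) ^ (((s : ℤ) : ℝ) * n / 2) : ℝ) : ℂ) * (Q s j).indicator F x := by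
      filter_upwards [coeFn_toL2 hm] with x hx
      rw [hx, RCLike.inner_apply, wavelet_zero_eq]
      beta_reduce
      by_cases hxQ : x ∈ Q s j
      · rw [indicator_of_mem hxQ]
        have : cutoff (1 : MvPolynomial (Fin n) ℝ) ((2 : ℝ) ^ (s : ℤ) • x - latticePt j) = 1 := by
          rw [cutoff, indicator_of_mem (s := unitCube n) hxQ]; simp [polyEval]
        rw [this, Complex.conj_ofReal, mul_one, mul_comm]
      · rw [indicator_of_notMem hxQ]
        have : cutoff (1 : MvPolynomial (Fin n) ℝ) ((2 : ℝ) ^ (s : ℤ) • x - latticePt j) = 0 := by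
          rw [cutoff, indicator_of_notMem (s := unitCube n) hxQ]
        rw [this]; simp
    rw [integral_congr_ae h2, integral_const_mul] at h1
    refine (mul_eq_zero.1 h1).resolve_left ?_
    norm_cast
    positivity
  refine (Lp.eq_zero_iff_ae_eq_zero).2 ?_
  refine ae_eq_zero_of_integral_contDiff_smul_eq_zero hloc fun g hg hgc => ?_
  obtain ⟨R, hR⟩ := hgc.isCompact.isBounded.subset_closedBall 0
  obtain ⟨B, hB⟩ := hgc.exists_bound_of_continuous hg.continuous
  -- `pt s (fl s x)` is the lower corner of the dyadic cube of side 2⁻ˢ containing x, so sampling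
  -- `g` there produces a step function.
  set fl : ℕ → E n → Fin n → ℤ := fun s x i => ⌊(2 : ℝ) ^ (s : ℤ) * x i⌋ with hfl
  set pt : ℕ → (Fin n → ℤ) → E n := fun s j => ((2 : ℝ) ^ (s : ℤ))⁻¹ • latticePt j with hpt
  have hmem : ∀ s x j, x ∈ Q s j ↔ j = fl s x := fun s x j => by
    rw [funext_iff]
    refine forall_congr' fun i => ?_
    simp only [PiLp.sub_apply, PiLp.smul_apply, smul_eq_mul, mem_Ico, hfl]
    rw [eq_comm, Int.floor_eq_iff]
    constructor <;> rintro ⟨h1, h2⟩ <;> constructor <;> linarith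
  have hdist : ∀ s x, ‖pt s (fl s x) - x‖ ≤ n * ((2 : ℝ)⁻¹) ^ s := fun s x => by
    refine norm_le_of_mem_box (by positivity) fun i => ?_
    have hp : (0 : ℝ) < 2 ^ (s : ℤ) := by positivity
    have h1 := Int.floor_le ((2 : ℝ) ^ (s : ℤ) * x i)
    have h2 := (Int.lt_floor_add_one ((2 : ℝ) ^ (s : ℤ) * x i)).le
    have e1 : (pt s (fl s x) - x) i =
        ((2 : ℝ) ^ (s : ℤ))⁻¹ * (⌊(2 : ℝ) ^ (s : ℤ) * x i⌋ - (2 : ℝ) ^ (s : ℤ) * x i) := by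
      simp only [hpt, hfl, PiLp.sub_apply, PiLp.smul_apply, smul_eq_mul]
      field_simp
    rw [e1, abs_mul, abs_of_pos (inv_pos.2 hp), inv_pow, zpow_natCast]
    rw [zpow_natCast] at h1 h2
    have : |(⌊(2 : ℝ) ^ s * x i⌋ : ℝ) - (2 : ℝ) ^ s * x i| ≤ 1 := by
      rw [abs_le]; constructor <;> linarith
    calc _ ≤ ((2 : ℝ) ^ s)⁻¹ * 1 := by gcongr
      _ = _ := mul_one _
  have hdist1 : ∀ s x, ‖pt s (fl s x) - x‖ ≤ n := fun s x => by
    refine (hdist s x).trans ?_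
    have : ((2 : ℝ)⁻¹) ^ s ≤ 1 := pow_le_one₀ (by norm_num) (by norm_num)
    calc (n : ℝ) * ((2 : ℝ)⁻¹) ^ s ≤ n * 1 := by gcongr
      _ = n := mul_one _
  have hgR : ∀ x, g x ≠ 0 → ‖x‖ ≤ R := fun x hx => by
    simpa using hR (subset_tsupport g hx)
  -- Compact support leaves finitely many cubes with a nonzero sample, and `F` integrates to zero
  -- over each.
  have hzero : ∀ s, ∫ x, g (pt s (fl s x)) • F x = 0 := fun s => by
    have hfin : {j : Fin n → ℤ | g (pt s j) ≠ 0}.Finite := by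
      refine (Set.Finite.pi (t := fun _ : Fin n => Icc (-⌈(2 : ℝ) ^ (s : ℤ) * R⌉)
        ⌈(2 : ℝ) ^ (s : ℤ) * R⌉) fun i => Set.finite_Icc _ _).subset fun j hj i _ => ?_
      have hp : (0 : ℝ) < 2 ^ (s : ℤ) := by positivity
      have h1 := (PiLp.norm_apply_le (pt s j) i).trans (hgR _ hj)
      simp only [hpt, PiLp.smul_apply, smul_eq_mul, norm_mul, norm_inv, Real.norm_eq_abs,
        abs_of_pos hp] at h1
      rw [inv_mul_le_iff₀ hp] at h1
      have h2 := abs_le.1 (h1.trans (Int.le_ceil _))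
      exact ⟨by exact_mod_cast h2.1, by exact_mod_cast h2.2⟩
    have e1 : ∀ x, g (pt s (fl s x)) • F x =
        ∑ j ∈ hfin.toFinset, g (pt s j) • (Q s j).indicator F x := fun x => by
      by_cases hx : g (pt s (fl s x)) = 0
      · rw [hx, zero_smul]
        refine (Finset.sum_eq_zero fun j hj => ?_).symm
        have : x ∉ Q s j := fun hxQ => by
          rw [(hmem s x j).1 hxQ] at hj
          exact (hfin.mem_toFinset.1 hj) hx
        rw [indicator_of_notMem this, smul_zero]
      · rw [Finset.sum_eq_single (fl s x), indicator_of_mem ((hmem s x _).2 rfl)]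
        · intro j _ hj
          rw [indicator_of_notMem (fun hxQ => hj ((hmem s x j).1 hxQ)), smul_zero]
        · intro hx'
          exact absurd (hfin.mem_toFinset.2 hx) hx'
    simp_rw [e1]
    rw [integral_finsetSum]
    · refine Finset.sum_eq_zero fun j _ => ?_
      rw [integral_smul, hQint, smul_zero]
    · intro j _
      refine Integrable.fun_smul _ ?_
      rw [integrable_indicator_iff (hQm s j)]
      refine (hloc.integrableOn_isCompact (isCompact_closedBall (pt s j) n)).mono_set fun x hx => ?_
      rw [(hmem s x j).1 hx, Metric.mem_closedBall, dist_comm, dist_eq_norm]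
      exact hdist1 s x
  -- A sample point lies within n of x, so all the step functions live in the ball of radius R + n,
  -- where `F` is integrable and dominates.
  have hlim : Filter.Tendsto (fun s : ℕ => ∫ x, g (pt s (fl s x)) • F x) Filter.atTop
      (nhds (∫ x, g x • F x)) := by
    refine tendsto_integral_of_dominated_convergence
      (fun x => (Metric.closedBall (0 : E n) (R + n)).indicator (fun x => B * ‖F x‖) x)
      (fun s => ?_) ?_ (fun s => Filter.Eventually.of_forall fun x => ?_)
      (Filter.Eventually.of_forall fun x => ?_)
    · refine AEStronglyMeasurable.fun_smul ?_ hFm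
      have hflm : Measurable fun x : E n => pt s (fl s x) := by
        have h0 : Measurable fun x : E n => latticePt (fl s x) := ?_
        · exact h0.const_smul ((2 : ℝ) ^ (s : ℤ))⁻¹
        refine (MeasurableEquiv.toLp 2 (Fin n → ℝ)).measurable.comp ?_
        refine measurable_pi_lambda _ fun i => ?_
        have h1 : Measurable fun x : E n => (2 : ℝ) ^ (s : ℤ) * x i := by fun_prop
        exact (measurable_from_top (f := fun z : ℤ => (z : ℝ))).comp h1.floor
      exact (hg.continuous.measurable.comp hflm).aestronglyMeasurable
    · rw [integrable_indicator_iff Metric.isClosed_closedBall.measurableSet]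
      exact ((hloc.integrableOn_isCompact (isCompact_closedBall _ _)).norm).const_mul B
    · by_cases hx : g (pt s (fl s x)) = 0
      · rw [hx, zero_smul, norm_zero]
        refine indicator_nonneg (fun y _ => mul_nonneg ((norm_nonneg _).trans (hB 0)) (norm_nonneg _)) _
      · have h1 : x ∈ Metric.closedBall (0 : E n) (R + n) := by
          rw [mem_closedBall_zero_iff]
          have e1 : x = pt s (fl s x) - (pt s (fl s x) - x) := by abel
          rw [e1]
          exact (norm_sub_le _ _).trans (add_le_add (hgR _ hx) (hdist1 s x))
        rw [indicator_of_mem h1, norm_smul]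
        gcongr
        exact hB _
    · refine Filter.Tendsto.smul_const ?_ _
      refine (hg.continuous.tendsto x).comp ?_
      rw [tendsto_iff_norm_sub_tendsto_zero]
      refine squeeze_zero (fun _ => norm_nonneg _) (hdist · x) ?_
      have := (tendsto_pow_atTop_nhds_zero_of_lt_one (r := (2 : ℝ)⁻¹) (by norm_num)
        (by norm_num)).const_mul (n : ℝ)
      rwa [mul_zero] at this
  simp_rw [hzero] at hlim
  exact tendsto_nhds_unique hlim tendsto_const_nhds

/-- Different scales are orthogonal by the vanishing moments, different cubes of one scale by
disjointness, and a single cube reduces to the given basis. -/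
theorem IsAlpertBasis.orthonormal_wavelets (hh : IsAlpertBasis κ h) :
    Orthonormal ℂ fun I : (ℤ × (Fin n → ℤ)) × Fin M =>
      realL2 (wavelet (h I.2) 0 I.1.1 I.1.2) := by
  rw [orthonormal_iff_ite]
  rintro ⟨⟨s, j⟩, a⟩ ⟨⟨t, i⟩, b⟩
  simp only
  rw [inner_realL2 (memLp_wavelet (hh.memLp a) _ _) (memLp_wavelet (hh.memLp b) _ _)]
  rcases lt_trichotomy s t with hst | rfl | hst
  · rw [if_neg (by simp [hst.ne])]
    have := integral_wavelet_mul_wavelet_of_lt (hh.mem b) (hh.mem a) hst j i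
    simp_rw [mul_comm] at this ⊢
    rw [this, Complex.ofReal_zero]
  · by_cases hij : j = i
    · subst hij
      rw [integral_wavelet_mul_same, hh.orthonormal]
      by_cases hab : a = b <;> simp [hab]
    · rw [if_neg (by simp [hij])]
      have : ∀ x, wavelet (h a) 0 s j x * wavelet (h b) 0 s i x = 0 := fun x => by
        simp only [wavelet_zero_eq]
        by_contra hx
        have h1 : h a ((2 : ℝ) ^ s • x - latticePt j) ≠ 0 := fun h0 => hx (by rw [h0]; ring)
        have h2 : h b ((2 : ℝ) ^ s • x - latticePt i) ≠ 0 := fun h0 => hx (by rw [h0]; ring)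
        exact Set.disjoint_left.1 (disjoint_unitCube_translates hij)
          (support_of_mem_alpertSpace (hh.mem a) h1) (support_of_mem_alpertSpace (hh.mem b) h2)
      simp_rw [this]
      simp
  · rw [if_neg (by simp [hst.ne'])]
    rw [integral_wavelet_mul_wavelet_of_lt (hh.mem a) (hh.mem b) hst i j, Complex.ofReal_zero]

/-- The Alpert wavelets form a Hilbert basis of `L²(ℝⁿ)`. -/
theorem IsAlpertBasis.exists_hilbertBasis (hn : 0 < n) (hκ : 0 < κ) (hh : IsAlpertBasis κ h) :
    ∃ b : HilbertBasis ((ℤ × (Fin n → ℤ)) × Fin M) ℂ (L2 n),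
      ∀ I, b I = realL2 (wavelet (h I.2) 0 I.1.1 I.1.2) := by
  refine ⟨HilbertBasis.mkOfOrthogonalEqBot hh.orthonormal_wavelets ?_, fun I => by
    rw [HilbertBasis.coe_mkOfOrthogonalEqBot]⟩
  rw [Submodule.eq_bot_iff]
  intro F hF
  refine eq_zero_of_inner_cubes fun s j => hh.inner_indicator_eq_zero hn hκ (fun t i a => ?_) s j
  exact (Submodule.mem_orthogonal _ _).1 hF _ (Submodule.subset_span ⟨((t, i), a), rfl⟩)

end HilbertBasis

/-! ### The frame operator of the standard grid -/

section Frame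

variable {n κ : ℕ} {M : ℕ} {h : Fin M → E n → ℝ}

theorem IsAlpertBasis.integral_mul_sum (hh : IsAlpertBasis κ h) (α : Fin M → ℝ) (a : Fin M) :
    ∫ x, h a x * ∑ b, α b * h b x = α a := by
  have h1 : ∀ b, Integrable fun x => h a x * h b x := fun b => (hh.memLp a).integrable_mul (hh.memLp b)
  have h2 : ∀ x, h a x * ∑ b, α b * h b x = ∑ b, α b * (h a x * h b x) := fun x => by
    rw [Finset.mul_sum]; exact Finset.sum_congr rfl fun b _ => by ring
  simp_rw [h2]
  rw [integral_finsetSum _ fun b _ => (h1 b).const_mul _]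
  simp_rw [integral_const_mul, hh.orthonormal]
  simp

theorem IsAlpertBasis.eq_sum (hh : IsAlpertBasis κ h) {g : E n → ℝ} (hg : g ∈ alpertSpace n κ) :
    g = fun x => ∑ a, (∫ y, h a y * g y) * h a x := by
  obtain ⟨α, rfl⟩ := hh.exists_sum hg
  simp_rw [hh.integral_mul_sum]

theorem IsAlpertBasis.integral_sq (hh : IsAlpertBasis κ h) {g : E n → ℝ}
    (hg : g ∈ alpertSpace n κ) : ∫ x, g x * g x = ∑ a, (∫ y, h a y * g y) ^ 2 := by
  obtain ⟨α, rfl⟩ := hh.exists_sum hg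
  simp_rw [hh.integral_mul_sum]
  have h1 : ∀ x, (∑ b, α b * h b x) * ∑ b, α b * h b x =
      ∑ a, α a * (h a x * ∑ b, α b * h b x) := fun x => by
    rw [Finset.sum_mul]; exact Finset.sum_congr rfl fun b _ => by ring
  have h2 : MemLp (fun x => ∑ b, α b * h b x) 2 :=
    memLp_finsetSum _ fun b _ => (hh.memLp b).const_mul _
  have h3 : ∀ a, Integrable fun x => h a x * ∑ b, α b * h b x := fun a =>
    (hh.memLp a).integrable_mul h2
  simp_rw [h1]
  rw [integral_finsetSum _ fun a _ => (h3 a).const_mul _]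
  simp_rw [integral_const_mul, hh.integral_mul_sum, sq]

theorem smoothing_sum {ι : Type*} {φ : E n → ℝ} (hφ : IsMollifier κ φ) {η : ℝ} (hη : 0 < η)
    (S : Finset ι) (α : ι → ℝ) {g : ι → E n → ℝ} (hg : ∀ i, g i ∈ alpertSpace n κ) :
    smoothing φ (fun x => ∑ i ∈ S, α i * g i x) η = fun x => ∑ i ∈ S, α i * smoothing φ (g i) η x := by
  funext x
  have hI : ∀ i, Integrable fun t => g i t * dilate φ η (x - t) := fun i => by
    obtain ⟨B, hB, hb⟩ := exists_bound_of_mem_alpertSpace (hg i)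
    refine (((integrable_dilate hφ hη).comp_sub_left x).bdd_mul
      (measurable_of_mem_alpertSpace (hg i)).aestronglyMeasurable (Filter.Eventually.of_forall hb))
  simp only [smoothing, convolution, ContinuousLinearMap.mul_apply']
  simp_rw [Finset.sum_mul, mul_assoc]
  rw [integral_finsetSum _ fun i _ => (hI i).const_mul _]
  simp_rw [integral_const_mul]

/-- The deviation of a smooth wavelet from the wavelet it is made of. -/
noncomputable def waveletError (φ g : E n → ℝ) (η : ℝ) (I : ℤ × (Fin n → ℤ)) : L2 n :=
  realL2 (smoothWavelet φ g η 0 I.1 I.2) - realL2 (wavelet g 0 I.1 I.2)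

theorem waveletError_sum {ι : Type*} {φ : E n → ℝ} (hφ : IsMollifier κ φ) {η : ℝ} (hη : 0 < η)
    (hη1 : η ≤ 1) (S : Finset ι) (α : ι → ℝ) {g : ι → E n → ℝ} (hg : ∀ i, g i ∈ alpertSpace n κ)
    (I : ℤ × (Fin n → ℤ)) :
    waveletError φ (fun x => ∑ i ∈ S, α i * g i x) η I =
      ∑ i ∈ S, (α i : ℂ) • waveletError φ (g i) η I := by
  simp only [waveletError, smoothWavelet_eq]
  rw [smoothing_sum hφ hη S α hg, realL2_wavelet_sum S α fun i => memLp_smoothing hφ hη hη1 (hg i) 2,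
    realL2_wavelet_sum S α fun i => memLp_of_mem_alpertSpace (hg i) 2, ← Finset.sum_sub_distrib]
  simp_rw [smul_sub]

/-- Smoothing is linear, so the errors of any basis are combinations, through an orthogonal change
of basis, of those of a fixed reference basis `h₀`. The constant depends on `h₀` alone, which makes
the threshold for η independent of `h`. -/
theorem IsAlpertBasis.norm_sq_sum_waveletError_le {φ : E n → ℝ} (hφ : IsMollifier κ φ)
    (hh : IsAlpertBasis κ h) {M₀ : ℕ} {h₀ : Fin M₀ → E n → ℝ} (hh₀ : IsAlpertBasis κ h₀)
    {η : ℝ} (hη : 0 < η) (hη1 : η ≤ 1) {C : Fin M₀ → ℝ}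
    (hC : ∀ b S (c : ℤ × (Fin n → ℤ) → ℂ),
      ‖∑ I ∈ S, c I • waveletError φ (h₀ b) η I‖ ^ 2 ≤ C b * √η * ∑ I ∈ S, ‖c I‖ ^ 2)
    (hC0 : ∀ b, 0 ≤ C b) (S : Finset ((ℤ × (Fin n → ℤ)) × Fin M))
    (c : (ℤ × (Fin n → ℤ)) × Fin M → ℂ) :
    ‖∑ I ∈ S, c I • waveletError φ (h I.2) η I.1‖ ^ 2 ≤
      (M₀ * ∑ b, C b) * √η * ∑ I ∈ S, ‖c I‖ ^ 2 := by
  classical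
  set O : Fin M → Fin M₀ → ℝ := fun a b => ∫ x, h a x * h₀ b x with hO
  set S₁ := S.image Prod.fst
  set c' : (ℤ × (Fin n → ℤ)) × Fin M → ℂ := fun p => if p ∈ S then c p else 0 with hc'
  have hsub : S ⊆ S₁ ×ˢ Finset.univ := fun p hp =>
    Finset.mem_product.2 ⟨Finset.mem_image_of_mem _ hp, Finset.mem_univ _⟩
  have h1 : ∑ p ∈ S, c p • waveletError φ (h p.2) η p.1 =
      ∑ b, ∑ I ∈ S₁, (∑ a, c' (I, a) * O a b) • waveletError φ (h₀ b) η I := by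
    have h2 : ∀ a I, waveletError φ (h a) η I = ∑ b, (O a b : ℂ) • waveletError φ (h₀ b) η I := by
      intro a I
      conv_lhs => rw [hh₀.eq_sum (hh.mem a)]
      rw [waveletError_sum hφ hη hη1 _ _ hh₀.mem]
      simp_rw [hO, mul_comm (h a _)]
    rw [Finset.sum_comm]
    simp_rw [Finset.sum_smul]
    calc _ = ∑ p ∈ S₁ ×ˢ Finset.univ, c' p • waveletError φ (h p.2) η p.1 := by
            rw [← Finset.sum_subset hsub]
            · exact Finset.sum_congr rfl fun p hp => by simp [hc', hp]
            · intro p _ hp; simp [hc', hp]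
      _ = ∑ I ∈ S₁, ∑ a, c' (I, a) • waveletError φ (h a) η I := Finset.sum_product _ _ _
      _ = _ := by
            refine Finset.sum_congr rfl fun I _ => ?_
            rw [Finset.sum_comm]
            refine Finset.sum_congr rfl fun a _ => ?_
            rw [h2, Finset.smul_sum]
            simp_rw [smul_smul]
  have hsum : ∑ I ∈ S₁, ∑ a, ‖c' (I, a)‖ ^ 2 = ∑ p ∈ S, ‖c p‖ ^ 2 := by
    rw [← Finset.sum_product S₁ Finset.univ fun p => ‖c' p‖ ^ 2, ← Finset.sum_subset hsub]
    · exact Finset.sum_congr rfl fun p hp => by simp [hc', hp]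
    · intro p _ hp; simp [hc', hp]
  -- Parseval for `h₀ b` in the basis `h`: the columns of the change of basis are unit vectors, so
  -- the new coefficients have no larger square sum.
  have hOb : ∀ b, ∑ a, (O a b) ^ 2 = 1 := fun b => by
    rw [← hh.integral_sq (hh₀.mem b), hh₀.orthonormal, if_pos rfl]
  have hcb : ∀ b, ∑ I ∈ S₁, ‖∑ a, c' (I, a) * O a b‖ ^ 2 ≤ ∑ p ∈ S, ‖c p‖ ^ 2 := fun b => by
    rw [← hsum]
    refine Finset.sum_le_sum fun I _ => ?_
    calc _ ≤ (∑ a, ‖c' (I, a)‖ * |O a b|) ^ 2 := by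
            gcongr
            refine (norm_sum_le _ _).trans (le_of_eq ?_)
            exact Finset.sum_congr rfl fun a _ => by rw [norm_mul, Complex.norm_real, Real.norm_eq_abs]
      _ ≤ (∑ a, ‖c' (I, a)‖ ^ 2) * ∑ a, |O a b| ^ 2 := Finset.sum_mul_sq_le_sq_mul_sq _ _ _
      _ = _ := by simp_rw [sq_abs]; rw [hOb, mul_one]
  rw [h1]
  calc _ ≤ (∑ b, ‖∑ I ∈ S₁, (∑ a, c' (I, a) * O a b) • waveletError φ (h₀ b) η I‖) ^ 2 := by
          gcongr; exact norm_sum_le _ _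
    _ ≤ M₀ * ∑ b, ‖∑ I ∈ S₁, (∑ a, c' (I, a) * O a b) • waveletError φ (h₀ b) η I‖ ^ 2 := by
          have := sq_sum_le_card_mul_sum_sq (s := (Finset.univ : Finset (Fin M₀)))
            (f := fun b => ‖∑ I ∈ S₁, (∑ a, c' (I, a) * O a b) • waveletError φ (h₀ b) η I‖)
          simpa using this
    _ ≤ M₀ * ∑ b, C b * √η * ∑ p ∈ S, ‖c p‖ ^ 2 := by
          gcongr with b
          refine (hC b _ _).trans ?_
          exact mul_le_mul_of_nonneg_left (hcb b) (mul_nonneg (hC0 b) (Real.sqrt_nonneg _))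
    _ = _ := by rw [← Finset.sum_mul, ← Finset.sum_mul]; ring

/-- For small `η` the frame operator of the standard grid is a bounded invertible operator, with a
threshold independent of the basis. -/
theorem exists_frame_zero (hn : 0 < n) (hκ : 0 < κ) {φ : E n → ℝ} (hφ : IsMollifier κ φ) :
    ∃ η₀ : ℝ, 0 < η₀ ∧ η₀ ≤ 1 ∧ ∀ (M : ℕ) (h : Fin M → E n → ℝ), IsAlpertBasis κ h →
      ∀ η, 0 < η → η < η₀ → ∃ T : L2 n ≃L[ℂ] L2 n, ∀ F, HasSum (frameTerm φ h η 0 F) (T F) := by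
  -- Any Alpert basis serves as reference; if there is none, the claim is vacuous.
  by_cases hex : ∃ (M₀ : ℕ) (h₀ : Fin M₀ → E n → ℝ), IsAlpertBasis κ h₀
  swap
  · exact ⟨1, one_pos, le_rfl, fun M h hh => absurd ⟨M, h, hh⟩ hex⟩
  obtain ⟨M₀, h₀, hh₀⟩ := hex
  choose C hC0 hC using fun b => exists_perturbation_bound hκ hφ (hh₀.mem b)
  set K : ℝ := M₀ * ∑ b, C b with hK
  have hK0 : 0 ≤ K := mul_nonneg (Nat.cast_nonneg _) (Finset.sum_nonneg fun b _ => hC0 b)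
  -- The threshold makes K√η ≤ 1/4 = ε² with ε = 1/2 in the perturbation theorem.
  refine ⟨min 1 ((1 / (4 * (K + 1))) ^ 2), lt_min one_pos (by positivity), min_le_left _ _,
    fun M h hh η hη hlt => ?_⟩
  have hη1 : η ≤ 1 := (hlt.trans_le (min_le_left _ _)).le
  have hsq : √η ≤ 1 / (4 * (K + 1)) := by
    rw [Real.sqrt_le_left (by positivity)]
    exact (hlt.trans_le (min_le_right _ _)).le
  have hKη : K * √η ≤ (1 / 2) ^ 2 := by
    calc K * √η ≤ K * (1 / (4 * (K + 1))) := by gcongr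
      _ ≤ (1 / 2) ^ 2 := by
        rw [mul_one_div, div_le_iff₀ (by positivity)]; linarith
  obtain ⟨b, hb⟩ := hh.exists_hilbertBasis hn hκ
  refine exists_frame_of_near_hilbertBasis b (x := fun I : (ℤ × (Fin n → ℤ)) × Fin M =>
    smoothWaveletL2 φ (h I.2) η 0 I.1.1 I.1.2) (ε := 1 / 2) (by norm_num) (by norm_num)
    fun S c => ?_
  simp_rw [hb]
  refine (hh.norm_sq_sum_waveletError_le hφ hh₀ hη hη1 (fun b => hC b η hη hη1) hC0 S c).trans ?_
  exact mul_le_mul_of_nonneg_right hKη (Finset.sum_nonneg fun _ _ => by positivity)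

end Frame

/-! ### Translations on L² -/

section Translation

variable {n κ : ℕ}

/-- Translation by `v` on `L²`. -/
noncomputable def translateL2 (v : E n) : L2 n →ₗᵢ[ℂ] L2 n :=
  Lp.compMeasurePreservingₗᵢ ℂ (fun x => x - v) (measurePreserving_sub_right volume v)

theorem memLp_translate {f : E n → ℂ} (hf : MemLp f 2) (v : E n) :
    MemLp (fun x => f (x - v)) 2 :=
  hf.comp_measurePreserving (measurePreserving_sub_right volume v)

theorem translateL2_toL2 {f : E n → ℂ} (hf : MemLp f 2) (v : E n) :
    translateL2 v (toL2 f) = toL2 fun x => f (x - v) := by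
  rw [toL2_eq hf, toL2_eq (memLp_translate hf v)]
  rfl

theorem toL2_coeFn (F : L2 n) : toL2 F = F := by
  rw [toL2_eq (Lp.memLp F)]; exact Lp.toLp_coeFn F _

theorem translateL2_translateL2 (v w : E n) (F : L2 n) :
    translateL2 v (translateL2 w F) = translateL2 (v + w) F := by
  rw [← toL2_coeFn F, translateL2_toL2 (Lp.memLp F), translateL2_toL2 (Lp.memLp F),
    translateL2_toL2 (memLp_translate (Lp.memLp F) w)]
  simp_rw [sub_sub]

theorem translateL2_zero (F : L2 n) : translateL2 0 F = F := by
  rw [← toL2_coeFn F, translateL2_toL2 (Lp.memLp F)]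
  simp_rw [sub_zero]

/-- Translation as a unitary operator. -/
noncomputable def translateEquiv (v : E n) : L2 n ≃ₗᵢ[ℂ] L2 n :=
  LinearIsometryEquiv.ofSurjective (translateL2 v) fun F => ⟨translateL2 (-v) F, by
    rw [translateL2_translateL2, add_neg_cancel, translateL2_zero]⟩

theorem translateEquiv_apply (v : E n) (F : L2 n) : translateEquiv v F = translateL2 v F := rfl

theorem translateEquiv_symm_apply (v : E n) (F : L2 n) :
    (translateEquiv v).symm F = translateL2 (-v) F := by
  rw [LinearIsometryEquiv.symm_apply_eq, translateEquiv_apply, translateL2_translateL2,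
    add_neg_cancel, translateL2_zero]

theorem continuous_translateL2_apply (F : L2 n) : Continuous fun v => translateL2 v F := by
  have hc : Continuous fun v : E n => (⟨fun x => x - v, by fun_prop⟩ : C(E n, E n)) :=
    ContinuousMap.continuous_of_continuous_uncurry _ (by
      change Continuous fun p : E n × E n => p.2 - p.1
      fun_prop)
  exact Continuous.compMeasurePreservingLp (continuous_const (y := F)) hc
    (fun v => measurePreserving_sub_right volume v) (by norm_num)

theorem norm_translateL2 (v : E n) (F : L2 n) : ‖translateL2 v F‖ = ‖F‖ :=
  (translateL2 v).norm_map F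

theorem inner_translateL2_left (v : E n) (F G : L2 n) :
    inner ℂ (translateL2 v F) G = inner ℂ F (translateL2 (-v) G) := by
  rw [← (translateL2 (-v)).inner_map_map, translateL2_translateL2, neg_add_cancel, translateL2_zero]

end Translation

/-! ### Frame operators of the translated grids -/

section FrameTranslate

variable {n κ M : ℕ} {φ : E n → ℝ} {h : Fin M → E n → ℝ} {η : ℝ}

theorem memLp_smoothWavelet (hφ : IsMollifier κ φ) (hh : IsAlpertBasis κ h) (hη : 0 < η)
    (hη1 : η ≤ 1) (a : Fin M) (s : ℤ) (j : Fin n → ℤ) :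
    MemLp (smoothWavelet φ (h a) η 0 s j) 2 := by
  rw [smoothWavelet_eq]; exact memLp_wavelet (memLp_smoothing hφ hη hη1 (hh.mem a) 2) s j

theorem smoothWavelet_eq_translate (φ g : E n → ℝ) (η : ℝ) (v : E n) (s : ℤ) (j : Fin n → ℤ)
    (x : E n) : smoothWavelet φ g η v s j x = smoothWavelet φ g η 0 s j (x - v) := by
  rw [smoothWavelet_eq, smoothWavelet_eq, wavelet_eq_translate]

theorem smoothWaveletL2_eq_translate (hφ : IsMollifier κ φ) (hh : IsAlpertBasis κ h) (hη : 0 < η)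
    (hη1 : η ≤ 1) (a : Fin M) (v : E n) (s : ℤ) (j : Fin n → ℤ) :
    smoothWaveletL2 φ (h a) η v s j = translateL2 v (smoothWaveletL2 φ (h a) η 0 s j) := by
  rw [smoothWaveletL2, smoothWaveletL2,
    translateL2_toL2 (memLp_ofReal (memLp_smoothWavelet hφ hh hη hη1 a s j))]
  congr 1; funext x; rw [smoothWavelet_eq_translate]

/-- T_{𝓓+v} = τ_v T_𝓓 τ_{-v}: one threshold for η and one norm of the inverse serve every grid. -/
theorem hasSum_frameTerm_translate (hφ : IsMollifier κ φ) (hh : IsAlpertBasis κ h) (hη : 0 < η)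
    (hη1 : η ≤ 1) {T : L2 n ≃L[ℂ] L2 n} (hT : ∀ F, HasSum (frameTerm φ h η 0 F) (T F)) (v : E n)
    (F : L2 n) :
    HasSum (frameTerm φ h η v F) (translateL2 v (T (translateL2 (-v) F))) := by
  have h1 := (hT (translateL2 (-v) F)).mapL (translateL2 v).toContinuousLinearMap
  refine h1.congr_fun ?_
  intro I
  simp only [frameTerm, LinearIsometry.coe_toContinuousLinearMap, map_smul]
  rw [smoothWaveletL2_eq_translate hφ hh hη hη1 I.2 v, inner_translateL2_left]

theorem exists_frame (hφ : IsMollifier κ φ) (hh : IsAlpertBasis κ h) (hη : 0 < η)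
    (hη1 : η ≤ 1) {T : L2 n ≃L[ℂ] L2 n} (hT : ∀ F, HasSum (frameTerm φ h η 0 F) (T F)) (v : E n) :
    ∃ T' : L2 n ≃L[ℂ] L2 n, (∀ F, HasSum (frameTerm φ h η v F) (T' F)) ∧
      ∀ F, T'.symm F = translateL2 v (T.symm (translateL2 (-v) F)) := by
  refine ⟨((translateEquiv v).symm.toContinuousLinearEquiv.trans T).trans
    (translateEquiv v).toContinuousLinearEquiv, fun F => ?_, fun F => ?_⟩
  · convert hasSum_frameTerm_translate hφ hh hη hη1 hT v F using 1
    change translateEquiv v (T ((translateEquiv v).symm F)) = _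
    rw [translateEquiv_symm_apply, translateEquiv_apply]
  · change translateEquiv v (T.symm ((translateEquiv v).symm F)) = _
    rw [translateEquiv_symm_apply, translateEquiv_apply]

theorem frameInv_eq (hφ : IsMollifier κ φ) (hh : IsAlpertBasis κ h) (hη : 0 < η)
    (hη1 : η ≤ 1) {T : L2 n ≃L[ℂ] L2 n} (hT : ∀ F, HasSum (frameTerm φ h η 0 F) (T F)) (v : E n)
    (F : L2 n) : frameInv φ h η v F = translateL2 v (T.symm (translateL2 (-v) F)) := by
  obtain ⟨T', h1, h2⟩ := exists_frame hφ hh hη hη1 hT v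
  -- The frame operator is bijective, so `Function.invFun` is its genuine inverse.
  have h3 : frameOp φ h η v = T' := funext fun F => (h1 F).tsum_eq
  rw [← h2, frameInv, h3]
  exact Function.invFun_eq_of_injective_of_rightInverse T'.injective T'.apply_symm_apply ▸ rfl

theorem inner_frameInv (hφ : IsMollifier κ φ) (hh : IsAlpertBasis κ h) (hη : 0 < η)
    (hη1 : η ≤ 1) {T : L2 n ≃L[ℂ] L2 n} (hT : ∀ F, HasSum (frameTerm φ h η 0 F) (T F)) (v : E n)
    (F : L2 n) (a : Fin M) (s : ℤ) (j : Fin n → ℤ) :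
    inner ℂ (smoothWaveletL2 φ (h a) η v s j) (frameInv φ h η v F) =
      inner ℂ (smoothWaveletL2 φ (h a) η 0 s j) (T.symm (translateL2 (-v) F)) := by
  rw [frameInv_eq hφ hh hη hη1 hT, smoothWaveletL2_eq_translate hφ hh hη hη1,
    LinearIsometry.inner_map_map]

/-- The coefficient equals that of τ_{-v} F on the standard grid, so v enters only through a
strongly continuous translation. This gives measurability in the grid. -/
theorem continuous_inner_frameInv (hφ : IsMollifier κ φ) (hh : IsAlpertBasis κ h) (hη : 0 < η)
    (hη1 : η ≤ 1) {T : L2 n ≃L[ℂ] L2 n} (hT : ∀ F, HasSum (frameTerm φ h η 0 F) (T F))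
    (F : L2 n) (a : Fin M) (s : ℤ) (j : Fin n → ℤ) :
    Continuous fun v => inner ℂ (smoothWaveletL2 φ (h a) η v s j) (frameInv φ h η v F) := by
  simp_rw [inner_frameInv hφ hh hη hη1 hT]
  exact continuous_const.inner
    (T.symm.continuous.comp ((continuous_translateL2_apply F).comp continuous_neg))

theorem sum_sq_inner_frameInv_le (hφ : IsMollifier κ φ) (hh : IsAlpertBasis κ h) (hη : 0 < η)
    (hη1 : η ≤ 1) {T : L2 n ≃L[ℂ] L2 n} (hT : ∀ F, HasSum (frameTerm φ h η 0 F) (T F)) (v : E n)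
    (F : L2 n) (a : Fin M) (s : ℤ) (S : Finset (Fin n → ℤ)) :
    ∑ j ∈ S, ‖inner ℂ (smoothWaveletL2 φ (h a) η v s j) (frameInv φ h η v F)‖ ^ 2 ≤
      ‖(T.symm : L2 n →L[ℂ] L2 n)‖ * ‖F‖ ^ 2 := by
  simp_rw [inner_frameInv hφ hh hη hη1 hT]
  rw [← norm_translateL2 (-v) F]
  have h1 := sum_sq_inner_frame_inv_le (x := fun I : (ℤ × (Fin n → ℤ)) × Fin M =>
    smoothWaveletL2 φ (h I.2) η 0 I.1.1 I.1.2) T hT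
    (S.map ⟨fun j => ((s, j), a), fun j k hjk => by simpa using hjk⟩) (translateL2 (-v) F)
  rwa [Finset.sum_map] at h1

end FrameTranslate

/-! ### The coefficients and their modulations -/

section Coefficients

variable {n κ M : ℕ} {φ : E n → ℝ} {h : Fin M → E n → ℝ} {η : ℝ}

theorem mem_cubesMeeting {v : E n} {s : ℤ} {j : Fin n → ℤ} :
    j ∈ cubesMeeting v s ↔ (gridCube v s j ∩ cubeU n).Nonempty := by
  simp [cubesMeeting]

/-- An explicit description, needed because the set of shifts v for which a given index occurs must
be Borel. The half-open cube and the closed `U` account for one weak and one strict inequality. -/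
theorem mem_cubesMeeting_iff {v : E n} {s : ℤ} {j : Fin n → ℤ} :
    j ∈ cubesMeeting v s ↔ ∀ i, (j i : ℝ) ≤ (2 : ℝ) ^ s * (1 / 8 - v i) ∧
      (2 : ℝ) ^ s * (-(1 / 8) - v i) < j i + 1 := by
  have hp : (0 : ℝ) < (2 : ℝ) ^ s := by positivity
  rw [mem_cubesMeeting]
  constructor
  · rintro ⟨x, hx, hU⟩ i
    have h1 := hx i
    have h2 := abs_le.1 (hU i)
    rw [mem_Ico] at h1
    have h3 : (2 : ℝ) ^ s * (-(1 / 8) - v i) ≤ (2 : ℝ) ^ s * (x i - v i) := by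
      apply mul_le_mul_of_nonneg_left _ hp.le; linarith [h2.1]
    have h4 : (2 : ℝ) ^ s * (x i - v i) ≤ (2 : ℝ) ^ s * (1 / 8 - v i) := by
      apply mul_le_mul_of_nonneg_left _ hp.le; linarith [h2.2]
    constructor <;> linarith
  · intro hj
    -- The witness has the least coordinates allowed by both the cube and `U`.
    refine ⟨WithLp.toLp 2 fun i => max (-(1 / 8)) (v i + ((2 : ℝ) ^ s)⁻¹ * j i), fun i => ?_,
      fun i => ?_⟩
    · obtain ⟨h1, h2⟩ := hj i
      have h3 : (2 : ℝ) ^ s * (max (-(1 / 8)) (v i + ((2 : ℝ) ^ s)⁻¹ * j i) - v i) =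
          max ((2 : ℝ) ^ s * (-(1 / 8) - v i)) (j i) := by
        rw [← max_sub_sub_right, mul_max_of_nonneg _ _ hp.le]
        congr 1; field_simp; ring
      simp only [mem_Ico, h3]
      refine ⟨sub_nonneg.2 (le_max_right _ _), ?_⟩
      rw [sub_lt_iff_lt_add, max_lt_iff]
      constructor <;> linarith
    · obtain ⟨h1, h2⟩ := hj i
      refine abs_le.2 ⟨le_max_left _ _, max_le (by norm_num) ?_⟩
      have h3 : ((2 : ℝ) ^ s)⁻¹ * j i ≤ 1 / 8 - v i := by
        rw [inv_mul_le_iff₀ hp]; exact h1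
      linarith

theorem measurableSet_mem_cubesMeeting (s : ℤ) (j : Fin n → ℤ) :
    MeasurableSet {v : E n | j ∈ cubesMeeting v s} := by
  simp_rw [mem_cubesMeeting_iff, Set.ofPred_forall]
  refine MeasurableSet.iInter fun i => ?_
  have h1 : Measurable fun v : E n => (2 : ℝ) ^ s * (1 / 8 - v i) := by fun_prop
  have h2 : Measurable fun v : E n => (2 : ℝ) ^ s * (-(1 / 8) - v i) := by fun_prop
  exact (measurableSet_le measurable_const h1).inter (measurableSet_lt h2 measurable_const)

/-- The lattice points with coordinates bounded by `L`. -/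
noncomputable def latticeBox (n L : ℕ) : Finset (Fin n → ℤ) :=
  Fintype.piFinset fun _ => Finset.Icc (-(L : ℤ)) L

theorem mem_latticeBox {L : ℕ} {j : Fin n → ℤ} : j ∈ latticeBox n L ↔ ∀ i, |j i| ≤ L := by
  simp [latticeBox, abs_le]

theorem card_latticeBox (n L : ℕ) : (latticeBox n L).card = (2 * L + 1) ^ n := by
  simp [latticeBox]
  congr 1; omega

/-- For |v_i| ≤ 1 an occurring index has |j_i| ≤ (9/8) 2ˢ + 1 ≤ 3 · 2ˢ, so one finite index box
serves all grids. -/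
theorem cubesMeeting_subset {v : E n} (hv : v ∈ shifts n) (s : ℕ) :
    cubesMeeting v s ⊆ latticeBox n (3 * 2 ^ s) := by
  intro j hj
  rw [mem_latticeBox]
  intro i
  obtain ⟨h1, h2⟩ := mem_cubesMeeting_iff.1 hj i
  obtain ⟨h3, h4⟩ := hv i
  have hp : (1 : ℝ) ≤ (2 : ℝ) ^ s := one_le_pow₀ (by norm_num)
  rw [zpow_natCast] at h1 h2
  have h5 : (j i : ℝ) ≤ 3 * 2 ^ s := by nlinarith
  have h6 : (-(3 * 2 ^ s) : ℝ) ≤ j i := by nlinarith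
  rw [abs_le]
  constructor
  · push_cast; exact_mod_cast h6
  · push_cast; exact_mod_cast h5

theorem norm_modulation (s : ℕ) (m v : E n) (j : Fin n → ℤ) :
    ‖modulation s m v j‖ = ((2 * (2 : ℝ) ^ s + 1) ^ ((n : ℝ) / 2))⁻¹ := by
  rw [modulation, norm_div, Complex.norm_real, Real.norm_of_nonneg (by positivity)]
  rw [show (2 * Real.pi * Complex.I * ((inner ℝ ((2 : ℝ) ^ s • gridCenter v s j)
    ((2 : ℝ) ^ s • m) : ℝ) : ℂ)) = ((2 * Real.pi * inner ℝ ((2 : ℝ) ^ s • gridCenter v s j)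
    ((2 : ℝ) ^ s • m) : ℝ) : ℂ) * Complex.I by push_cast; ring, Complex.norm_exp_ofReal_mul_I,
    one_div]

theorem norm_modulation_sq (s : ℕ) (m v : E n) (j : Fin n → ℤ) :
    ‖modulation s m v j‖ ^ 2 = ((2 * (2 : ℝ) ^ s + 1) ^ n)⁻¹ := by
  rw [norm_modulation, inv_pow, ← Real.rpow_natCast, ← Real.rpow_mul (by positivity)]
  norm_num

/-- The box has (6 · 2ˢ + 1)^n indices and each modulation has square (2 · 2ˢ + 1)^{-n}, so the
ratio is bounded uniformly in `s`. -/
theorem sum_norm_modulation_sq_le (s : ℕ) (m v : E n) {S : Finset (Fin n → ℤ)}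
    (hS : S ⊆ latticeBox n (3 * 2 ^ s)) : ∑ j ∈ S, ‖modulation s m v j‖ ^ 2 ≤ 7 ^ n := by
  refine (Finset.sum_le_sum_of_subset_of_nonneg hS fun _ _ _ => by positivity).trans ?_
  simp_rw [norm_modulation_sq]
  rw [Finset.sum_const, card_latticeBox, nsmul_eq_mul, ← div_eq_mul_inv, div_le_iff₀ (by positivity),
    ← mul_pow]
  push_cast
  gcongr
  linarith [pow_pos (two_pos : (0 : ℝ) < 2) s]

/-- Cauchy–Schwarz between the dual frame coefficients, which are square summable uniformly in the
grid, and the modulations, whose squares have bounded sum. -/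
theorem norm_modCoeff_le (hφ : IsMollifier κ φ) (hh : IsAlpertBasis κ h) (hη : 0 < η)
    (hη1 : η ≤ 1) {T : L2 n ≃L[ℂ] L2 n} (hT : ∀ F, HasSum (frameTerm φ h η 0 F) (T F)) (s : ℕ)
    (m : E n) (f : E n → ℂ) {v : E n} (hv : v ∈ shifts n) (a : Fin M) :
    ‖modCoeff φ h η s m f v a‖ ≤
      √(‖(T.symm : L2 n →L[ℂ] L2 n)‖ * 7 ^ n) * ‖toL2 ((cubeU n).indicator f)‖ := by
  set F := toL2 ((cubeU n).indicator f)
  refine le_of_sq_le_sq ?_ (by positivity)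
  rw [mul_pow, Real.sq_sqrt (by positivity)]
  calc _ ≤ (∑ j ∈ cubesMeeting v s, ‖inner ℂ (smoothWaveletL2 φ (h a) η v s j)
            (frameInv φ h η v F)‖ * ‖modulation s m v j‖) ^ 2 := by
          gcongr
          refine (norm_sum_le _ _).trans (le_of_eq ?_)
          exact Finset.sum_congr rfl fun j _ => by rw [norm_mul, RCLike.norm_conj]
    _ ≤ _ := Finset.sum_mul_sq_le_sq_mul_sq _ _ _
    _ ≤ (‖(T.symm : L2 n →L[ℂ] L2 n)‖ * ‖F‖ ^ 2) * 7 ^ n := by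
          gcongr
          · exact sum_sq_inner_frameInv_le hφ hh hη hη1 hT v F a s _
          · exact sum_norm_modulation_sq_le s m v (cubesMeeting_subset hv s)
    _ = _ := by ring

theorem continuous_modulation (s : ℕ) (m : E n) (j : Fin n → ℤ) :
    Continuous fun v => modulation s m v j := by
  have h1 : Continuous fun v : E n => gridCenter v s j := by unfold gridCenter; fun_prop
  unfold modulation
  fun_prop

/-- The set of cubes meeting `U` jumps with v, so the coefficient is only piecewise continuous: a
sum over a fixed box of continuous functions cut off to Borel sets. -/
theorem exists_measurable_modCoeff (hφ : IsMollifier κ φ) (hh : IsAlpertBasis κ h) (hη : 0 < η)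
    (hη1 : η ≤ 1) {T : L2 n ≃L[ℂ] L2 n} (hT : ∀ F, HasSum (frameTerm φ h η 0 F) (T F)) (s : ℕ)
    (m : E n) (f : E n → ℂ) (a : Fin M) :
    ∃ A : E n → ℂ, Measurable A ∧ ∀ v ∈ shifts n, modCoeff φ h η s m f v a = A v := by
  classical
  refine ⟨fun v => ∑ j ∈ latticeBox n (3 * 2 ^ s), {v : E n | j ∈ cubesMeeting v s}.indicator
    (fun v => inner ℂ (smoothWaveletL2 φ (h a) η v s j)
      (frameInv φ h η v (toL2 ((cubeU n).indicator f))) * (starRingEnd ℂ) (modulation s m v j)) v,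
    ?_, fun v hv => ?_⟩
  · refine Finset.measurable_sum _ fun j _ => Measurable.indicator ?_
      (measurableSet_mem_cubesMeeting _ j)
    exact ((continuous_inner_frameInv hφ hh hη hη1 hT _ a s j).mul
      (Complex.continuous_conj.comp (continuous_modulation s m j))).measurable
  · simp_rw [indicator_apply, Set.mem_ofPred_eq]
    rw [← Finset.sum_filter, modCoeff]
    congr 1
    ext j
    rw [Finset.mem_filter]
    exact ⟨fun hj => ⟨cubesMeeting_subset hv s hj, hj⟩, fun hj => hj.2⟩

theorem measurableSet_cubeU (n : ℕ) : MeasurableSet (cubeU n) := measurableSet_box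

theorem volume_cubeU_le (n : ℕ) : volume (cubeU n) ≤ 1 := by
  have : cubeU n = box n (1 / 8) := rfl
  rw [this, volume_box]
  exact pow_le_one₀ zero_le (by rw [ENNReal.ofReal_le_one]; norm_num)

theorem norm_toL2_indicator_le {q : ENNReal} (hq : 2 ≤ q) {f : E n → ℂ}
    (hf : MemLp f q (volume.restrict (cubeU n))) :
    ‖toL2 ((cubeU n).indicator f)‖ ≤ (eLpNorm f q (volume.restrict (cubeU n))).toReal := by
  have hfin : IsFiniteMeasure (volume.restrict (cubeU n)) :=
    ⟨by rw [Measure.restrict_apply_univ]; exact (volume_cubeU_le n).trans_lt ENNReal.one_lt_top⟩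
  have h2 : MemLp ((cubeU n).indicator f) 2 :=
    (memLp_indicator_iff_restrict (measurableSet_cubeU n)).2 (hf.mono_exponent hq)
  rw [toL2_eq h2, Lp.norm_toLp]
  refine ENNReal.toReal_mono hf.2.ne ?_
  rw [eLpNorm_indicator_eq_eLpNorm_restrict (measurableSet_cubeU n)]
  refine (eLpNorm_le_eLpNorm_mul_rpow_measure_univ hq hf.1).trans ?_
  refine mul_le_of_le_one_right' (ENNReal.rpow_le_one ?_ ?_)
  · rw [Measure.restrict_apply_univ]; exact volume_cubeU_le n
  · rw [sub_nonneg]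
    by_cases hq' : q = ⊤
    · simp [hq']
    · exact one_div_le_one_div_of_le (by norm_num) (ENNReal.toReal_mono hq' hq)

end Coefficients

/-! ### The extension operator -/

section Extension

variable {n : ℕ}

/-- The phase `e^{-i ξ · (x, |x|²)}`. -/
noncomputable def phase (ξ : E n × ℝ) (x : E n) : ℂ :=
  Complex.exp (-Complex.I * ((inner ℝ ξ.1 x + ξ.2 * ‖x‖ ^ 2 : ℝ) : ℂ))

theorem ext_eq (g : E n → ℂ) (ξ : E n × ℝ) : ext g ξ = ∫ x, phase ξ x * g x := rfl

theorem norm_phase (ξ : E n × ℝ) (x : E n) : ‖phase ξ x‖ = 1 := by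
  rw [phase, neg_mul, mul_comm, ← neg_mul, ← Complex.ofReal_neg, Complex.norm_exp_ofReal_mul_I]

theorem continuous_phase : Continuous fun p : (E n × ℝ) × E n => phase p.1 p.2 := by
  unfold phase; fun_prop

theorem continuous_phase_right (ξ : E n × ℝ) : Continuous (phase ξ) :=
  continuous_phase.comp (by fun_prop : Continuous fun x => (ξ, x))

/-- Galilean symmetry of the paraboloid: expanding |y + z|² shows that a translation by y shears the
frequency to ξ' + 2ξ_d y. -/
theorem phase_add (ξ : E n × ℝ) (y z : E n) :
    phase ξ (z + y) = phase ξ y * phase (ξ.1 + (2 * ξ.2) • y, ξ.2) z := by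
  rw [phase, phase, phase, ← Complex.exp_add, ← mul_add, ← Complex.ofReal_add]
  congr 3
  rw [norm_add_sq_real, inner_add_left, inner_add_right, inner_smul_left, real_inner_comm y z]
  simp only [conj_trivial]
  ring

theorem integrable_phase_mul {g : E n → ℂ} (hg : Integrable g) (ξ : E n × ℝ) :
    Integrable fun x => phase ξ x * g x :=
  hg.bdd_mul (continuous_phase_right ξ).aestronglyMeasurable
    (Filter.Eventually.of_forall fun x => (norm_phase ξ x).le)

theorem norm_ext_le (g : E n → ℂ) (ξ : E n × ℝ) : ‖ext g ξ‖ ≤ ∫ x, ‖g x‖ := by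
  refine (norm_integral_le_integral_norm _).trans (le_of_eq ?_)
  refine integral_congr_ae (Filter.Eventually.of_forall fun x => ?_)
  change ‖phase ξ x * g x‖ = _
  rw [norm_mul, norm_phase, one_mul]

theorem continuous_ext {g : E n → ℂ} (hg : Integrable g) : Continuous (ext g) := by
  refine continuous_of_dominated (F := fun ξ x => phase ξ x * g x) (bound := fun x => ‖g x‖)
    (fun ξ => (integrable_phase_mul hg ξ).1) (fun ξ => Filter.Eventually.of_forall fun x => ?_)
    hg.norm (Filter.Eventually.of_forall fun x => ?_)
  · rw [norm_mul, norm_phase, one_mul]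
  · exact (continuous_phase.comp (by fun_prop : Continuous fun ξ : E n × ℝ => (ξ, x))).mul
      continuous_const

theorem ext_const_mul (c : ℂ) (g : E n → ℂ) (ξ : E n × ℝ) :
    ext (fun x => c * g x) ξ = c * ext g ξ := by
  rw [ext_eq, ext_eq, ← integral_const_mul]
  congr 1; funext x; ring

theorem ext_sum {ι : Type*} (S : Finset ι) {g : ι → E n → ℂ} (hg : ∀ i ∈ S, Integrable (g i))
    (ξ : E n × ℝ) : ext (fun x => ∑ i ∈ S, g i x) ξ = ∑ i ∈ S, ext (g i) ξ := by
  simp_rw [ext_eq, Finset.mul_sum]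
  exact integral_finsetSum _ fun i hi => integrable_phase_mul (hg i hi) ξ

theorem lintegral_comp_smul_add {f : E n → ENNReal} (hf : Measurable f) {r : ℝ} (hr : r ≠ 0)
    (b : E n) : ∫⁻ x, f (b + r • x) = ENNReal.ofReal (|r| ^ n)⁻¹ * ∫⁻ x, f x := by
  have h1 : ∫⁻ x, f (b + r • x) = ∫⁻ y, f (b + y) ∂(Measure.map (r • ·) volume) := by
    rw [lintegral_map (by fun_prop) (by fun_prop)]
  rw [h1, Measure.map_addHaar_smul _ hr, lintegral_smul_measure, lintegral_add_left_eq_self,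
    finrank_euclideanSpace_fin, abs_inv, abs_pow, smul_eq_mul]

theorem ext_eq_fourier (g : E n → ℂ) (x : E n) (t : ℝ) :
    ext g (x, t) = FourierTransform.fourier (fun y => phase (0, t) y * g y) ((2 * Real.pi)⁻¹ • x) := by
  rw [ext_eq, Real.fourier_eq']
  refine integral_congr_ae (Filter.Eventually.of_forall fun y => ?_)
  simp only [phase, smul_eq_mul]
  rw [← mul_assoc, ← Complex.exp_add]
  congr 2
  rw [inner_smul_right, real_inner_comm x y, inner_zero_left]
  push_cast
  field_simp
  ring

/-- Plancherel's identity on the slices of constant `ξ_d`. -/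
theorem lintegral_enorm_ext_sq {g : E n → ℂ} (hg : ContDiff ℝ ∞ g) (hc : HasCompactSupport g)
    (t : ℝ) : ∫⁻ x, ‖ext g (x, t)‖ₑ ^ 2 = ENNReal.ofReal ((2 * Real.pi) ^ n) * l2sq g := by
  have hs : ContDiff ℝ ∞ fun y : E n => phase (0, t) y * g y := by
    refine ContDiff.mul ?_ hg
    unfold phase
    refine Complex.contDiff_exp.comp (contDiff_const.mul ?_)
    refine Complex.ofRealCLM.contDiff.comp ?_
    exact (contDiff_const.inner ℝ contDiff_id).add (contDiff_const.mul (contDiff_norm_sq ℝ))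
  have hcs : HasCompactSupport fun y : E n => phase (0, t) y * g y := hc.mul_left
  let Φ := hcs.toSchwartzMap hs
  have h1 : ∀ x, ext g (x, t) = FourierTransform.fourier Φ ((2 * Real.pi)⁻¹ • x) := fun x =>
    ext_eq_fourier g x t
  have h2 := SchwartzMap.integral_norm_sq_fourier Φ
  have hconv : ∀ Ψ : SchwartzMap (E n) ℂ, l2sq Ψ = ENNReal.ofReal (∫ x, ‖Ψ x‖ ^ 2) := fun Ψ => by
    have hm : MemLp Ψ 2 := Ψ.memLp 2
    rw [ofReal_integral_eq_lintegral_ofReal]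
    · rw [l2sq]; congr 1; funext x
      rw [ENNReal.ofReal_pow (norm_nonneg _), ofReal_norm]
    · exact hm.integrable_norm_pow (by norm_num)
    · exact Filter.Eventually.of_forall fun x => by positivity
  have h3 : l2sq Φ = l2sq g := by
    rw [l2sq, l2sq]
    congr 1; funext x
    change ‖phase (0, t) x * g x‖ₑ ^ 2 = _
    rw [enorm_mul, ← ofReal_norm (phase _ _), norm_phase, ENNReal.ofReal_one, one_mul]
  have hm : Measurable fun x => ‖FourierTransform.fourier Φ x‖ₑ ^ 2 :=
    ((FourierTransform.fourier Φ).continuous.enorm.measurable).pow_const 2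
  calc _ = ∫⁻ x, ‖FourierTransform.fourier Φ (0 + (2 * Real.pi)⁻¹ • x)‖ₑ ^ 2 := by
          simp_rw [h1, zero_add]
    _ = ENNReal.ofReal (|(2 * Real.pi)⁻¹| ^ n)⁻¹ * l2sq (FourierTransform.fourier Φ) :=
          lintegral_comp_smul_add hm (by positivity) 0
    _ = _ := by
          rw [hconv, h2, ← hconv, h3, abs_of_pos (by positivity), inv_pow, inv_inv]

/-- Convolution turns into a superposition of translates along the paraboloid. -/
theorem ext_convolution {u w : E n → ℂ} (hu : Integrable u) (hw : Integrable w) (ξ : E n × ℝ) :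
    ext (fun x => ∫ y, u y * w (x - y)) ξ =
      ∫ y, phase ξ y * u y * ext w (ξ.1 + (2 * ξ.2) • y, ξ.2) := by
  have hI : Integrable (Function.uncurry fun x y => phase ξ x * (u y * w (x - y)))
      ((volume : Measure (E n)).prod (volume : Measure (E n))) := by
    have h1 := hu.convolution_integrand (ContinuousLinearMap.mul ℝ ℂ) hw
    exact Integrable.bdd_mul (c := 1) h1
      ((continuous_phase_right ξ).comp continuous_fst).aestronglyMeasurable
      (Filter.Eventually.of_forall fun p => (norm_phase ξ p.1).le)
  rw [ext_eq]
  simp_rw [← integral_const_mul]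
  rw [integral_integral_swap hI]
  refine integral_congr_ae (Filter.Eventually.of_forall fun y => ?_)
  beta_reduce
  rw [← integral_add_right_eq_self _ y, ext_eq, ← integral_const_mul]
  refine integral_congr_ae (Filter.Eventually.of_forall fun z => ?_)
  beta_reduce
  rw [phase_add, add_sub_cancel_right]
  ring

/-- The dispersive estimate in bilinear form. -/
theorem enorm_ext_convolution_sq_le {u w : E n → ℂ} (hu : Integrable u) (hw : ContDiff ℝ ∞ w)
    (hc : HasCompactSupport w) {ξ : E n × ℝ} (hξ : ξ.2 ≠ 0) :
    ‖ext (fun x => ∫ y, u y * w (x - y)) ξ‖ₑ ^ 2 ≤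
      ENNReal.ofReal ((Real.pi / |ξ.2|) ^ n) * l2sq u * l2sq w := by
  have hwi : Integrable w := hw.continuous.integrable_of_hasCompactSupport hc
  have hm : Measurable fun x => ‖ext w (x, ξ.2)‖ₑ ^ 2 :=
    ((continuous_ext hwi).comp
      (by fun_prop : Continuous fun x : E n => (x, ξ.2))).enorm.measurable.pow_const 2
  rw [ext_convolution hu hwi]
  -- Cauchy–Schwarz in y, then the substitution x = ξ' + 2ξ_d y with Jacobian |2ξ_d|^{-n}, then
  -- Plancherel with (2π)^n; together (π/|ξ_d|)^n.
  calc _ ≤ (∫⁻ y, ‖u y‖ₑ * ‖ext w (ξ.1 + (2 * ξ.2) • y, ξ.2)‖ₑ) ^ 2 := by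
          gcongr
          refine (enorm_integral_le_lintegral_enorm _).trans (le_of_eq ?_)
          congr 1; funext y
          rw [enorm_mul, enorm_mul, ← ofReal_norm (phase _ _), norm_phase, ENNReal.ofReal_one,
            one_mul]
    _ ≤ _ := sq_lintegral_mul_le hu.1.enorm (((continuous_ext hwi).comp
          (by fun_prop : Continuous fun y : E n =>
            (ξ.1 + (2 * ξ.2) • y, ξ.2))).enorm.measurable.aemeasurable)
    _ = l2sq u * (ENNReal.ofReal (|2 * ξ.2| ^ n)⁻¹ *
          (ENNReal.ofReal ((2 * Real.pi) ^ n) * l2sq w)) := by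
          rw [lintegral_comp_smul_add (f := fun x => ‖ext w (x, ξ.2)‖ₑ ^ 2) hm
            (mul_ne_zero two_ne_zero hξ), lintegral_enorm_ext_sq hw hc]
          rfl
    _ = _ := by
          rw [← mul_assoc (ENNReal.ofReal _), ← ENNReal.ofReal_mul (by positivity),
            mul_left_comm, mul_assoc]
          congr 2
          have : 0 < |ξ.2| := abs_pos.2 hξ
          rw [abs_mul, abs_two, ← inv_pow, ← mul_pow]
          congr 1
          field_simp

end Extension

/-! ### Characters, Fourier inversion and sums over index boxes -/

section Characters

variable {n κ : ℕ}

theorem l2sq_translate {f : E n → ℂ} (v : E n) : l2sq (fun x => f (x - v)) = l2sq f :=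
  lintegral_sub_right_eq_self (fun x => ‖f x‖ₑ ^ 2) v

theorem l2sq_sum_wavelet_le {u : E n → ℝ} (hu : MemLp u 2) {R : ℕ}
    (hR : Function.support u ⊆ box n R) (v : E n) (s : ℤ) (S : Finset (Fin n → ℤ))
    (c : (Fin n → ℤ) → ℂ) :
    l2sq (fun x => ∑ j ∈ S, c j * (wavelet u v s j x : ℂ)) ≤
      ENNReal.ofReal ((2 * R + 1) ^ n * ‖realL2 u‖ ^ 2 * ∑ j ∈ S, ‖c j‖ ^ 2) := by
  have h1 : ∀ j ∈ S, MemLp (fun x => (wavelet u 0 s j x : ℂ)) 2 := fun j _ =>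
    memLp_ofReal (memLp_wavelet hu s j)
  have h2 : MemLp (fun x => ∑ j ∈ S, c j * (wavelet u 0 s j x : ℂ)) 2 :=
    memLp_finsetSum _ fun j hj => (h1 j hj).const_mul _
  calc _ = l2sq (fun x => ∑ j ∈ S, c j * (wavelet u 0 s j x : ℂ)) := by
          simp_rw [wavelet_eq_translate u v]
          exact l2sq_translate (f := fun x => ∑ j ∈ S, c j * (wavelet u 0 s j x : ℂ)) v
    _ = ENNReal.ofReal (‖∑ j ∈ S, c j • realL2 (wavelet u 0 s j)‖ ^ 2) := by
          rw [← ofReal_norm_toL2_sq h2, toL2_sum S c h1]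
    _ ≤ _ := ENNReal.ofReal_le_ofReal (norm_sq_sum_wavelet_le hu hR s S c)

/-- The character `e^{2πi μ · c}`. -/
noncomputable def chr (μ c : E n) : ℂ := Complex.exp (((2 * Real.pi * inner ℝ μ c : ℝ) : ℂ) * Complex.I)

theorem norm_chr (μ c : E n) : ‖chr μ c‖ = 1 := Complex.norm_exp_ofReal_mul_I _

theorem chr_add_right (μ c c' : E n) : chr μ (c + c') = chr μ c * chr μ c' := by
  rw [chr, chr, chr, ← Complex.exp_add, inner_add_right]
  congr 1; push_cast; ring

theorem chr_add_left (μ μ' c : E n) : chr (μ + μ') c = chr μ c * chr μ' c := by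
  rw [chr, chr, chr, ← Complex.exp_add, inner_add_left]
  congr 1; push_cast; ring

theorem continuous_chr_left (c : E n) : Continuous fun μ => chr μ c := by
  unfold chr; fun_prop

/-- As a function of the centre, the modulation is a constant times a character. The parameter `m`
is only a frequency, and estimates uniform over characters are uniform in `m`. -/
theorem modulation_eq (s : ℕ) (m v : E n) (j : Fin n → ℤ) :
    modulation s m v j = chr ((2 : ℝ) ^ s • (2 : ℝ) ^ s • m) (gridCenter v s j) *
      (((2 * (2 : ℝ) ^ s + 1) ^ ((n : ℝ) / 2))⁻¹ : ℝ) := by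
  rw [modulation, chr, div_eq_mul_inv, Complex.ofReal_inv]
  congr 2
  rw [inner_smul_left, inner_smul_left, inner_smul_left, inner_smul_right, real_inner_comm]
  simp only [conj_trivial]
  push_cast; ring

theorem gridCenter_add (v : E n) (s : ℤ) (k l : Fin n → ℤ) :
    gridCenter v s (k + l) = gridCenter v s l + (2 : ℝ) ^ (-s) • latticePt k := by
  ext i
  simp [gridCenter]
  ring

/-- Fourier inversion for a smooth compactly supported function. -/
theorem exists_fourier_inversion {ψ : E n → ℝ} (hψ : ContDiff ℝ ∞ ψ) (hc : HasCompactSupport ψ) :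
    ∃ Ψ : E n → ℂ, Integrable Ψ ∧ ∀ c, (ψ c : ℂ) = ∫ w, chr w c * Ψ w := by
  have h1 : ContDiff ℝ ∞ fun x => (ψ x : ℂ) := Complex.ofRealCLM.contDiff.comp hψ
  have h2 : HasCompactSupport fun x => (ψ x : ℂ) :=
    hc.comp_left (g := fun r : ℝ => (r : ℂ)) Complex.ofReal_zero
  let S := h2.toSchwartzMap h1
  refine ⟨FourierTransform.fourier S, (FourierTransform.fourier S).integrable, fun c => ?_⟩
  have h3 : FourierTransformInv.fourierInv (FourierTransform.fourier S) = S :=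
    FourierTransform.fourierInv_fourier_eq S
  have h4 : (ψ c : ℂ) = FourierTransformInv.fourierInv (FourierTransform.fourier S) c := by
    rw [h3]; rfl
  rw [h4, SchwartzMap.fourierInv_coe, Real.fourierInv_eq']
  rfl

/-- For k and j in the smaller box, j - k lies in the larger one, so every j is hit exactly once for
each k. Replacing a single sum by this average over k creates the convolution structure. -/
theorem sum_latticeBox_add {a : (Fin n → ℤ) → ℂ} {N : ℕ} (ha : ∀ j ∉ latticeBox n N, a j = 0) :
    ∑ k ∈ latticeBox n N, ∑ l ∈ latticeBox n (2 * N), a (k + l) =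
      ((2 * N + 1) ^ n : ℕ) * ∑ j ∈ latticeBox n N, a j := by
  classical
  have h1 : ∀ k ∈ latticeBox n N, ∑ l ∈ latticeBox n (2 * N), a (k + l) =
      ∑ j ∈ latticeBox n N, a j := fun k hk => by
    have h2 : ∑ l ∈ latticeBox n (2 * N), a (k + l) =
        ∑ j ∈ (latticeBox n (2 * N)).map (addLeftEmbedding k), a j := by
      rw [Finset.sum_map]; rfl
    rw [h2]
    refine (Finset.sum_subset (fun j hj => ?_) fun j _ hj => ha j hj).symm
    rw [Finset.mem_map]
    refine ⟨j - k, ?_, by simp⟩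
    rw [mem_latticeBox] at hj hk ⊢
    intro i
    have := abs_sub (j i) (k i)
    have := hj i; have := hk i
    rw [Pi.sub_apply]; push_cast; linarith
  rw [Finset.sum_congr rfl h1, Finset.sum_const, card_latticeBox, nsmul_eq_mul]

end Characters

theorem hasCompactSupport_sum {X ι : Type*} [TopologicalSpace X] (S : Finset ι) {f : ι → X → ℂ}
    (hf : ∀ i ∈ S, HasCompactSupport (f i)) : HasCompactSupport fun x => ∑ i ∈ S, f i x := by
  classical
  induction S using Finset.induction_on with
  | empty => simp only [Finset.sum_empty]; exact HasCompactSupport.zero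
  | insert k K hk ih =>
    simp_rw [Finset.sum_insert hk]
    exact (hf k (Finset.mem_insert_self k K)).add
      (ih fun i hi => hf i (Finset.mem_insert_of_mem hi))

/-! ### Sums of smooth wavelets as convolutions -/

section Convolution

variable {n κ : ℕ} {φ : E n → ℝ} {η : ℝ} {g : E n → ℝ}

/-- Up to a factor the lattice translates of the mollifier are themselves wavelets, with mother
function `dilate φ η`, so the bounded overlap estimate applies to them. -/
theorem translate_dilate_eq (φ : E n → ℝ) (η : ℝ) (s : ℤ) (k : Fin n → ℤ) (x : E n) :
    dilate φ (η * (2 : ℝ) ^ (-s)) (x - (2 : ℝ) ^ (-s) • latticePt k) =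
      (2 : ℝ) ^ ((s : ℝ) * n / 2) * wavelet (dilate φ η) 0 s k x := by
  have h2 : (2 : ℝ) ^ s ≠ 0 := by positivity
  rw [dilate_mul_zpow, wavelet_zero_eq, ← mul_assoc, two_rpow_half_sq, smul_sub, smul_smul,
    zpow_neg, mul_inv_cancel₀ h2, one_smul]

/-- Part of the index shift is moved from the wavelet onto the mollifier. -/
theorem smoothWavelet_add (φ g : E n → ℝ) (η : ℝ) (v : E n) (s : ℤ) (k l : Fin n → ℤ) (x : E n) :
    smoothWavelet φ g η v s (k + l) x = ∫ y, wavelet g v s l y *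
      dilate φ (η * (2 : ℝ) ^ (-s)) (x - y - (2 : ℝ) ^ (-s) • latticePt k) := by
  have h2 : (2 : ℝ) ^ s ≠ 0 := by positivity
  simp only [smoothWavelet, convolution_def, ContinuousLinearMap.mul_apply']
  rw [← integral_add_right_eq_self _ ((2 : ℝ) ^ (-s) • latticePt k)]
  congr 1; funext y
  congr 1
  · simp only [wavelet]
    congr 2
    ext i
    simp only [PiLp.sub_apply, PiLp.smul_apply, PiLp.add_apply, smul_eq_mul, Pi.add_apply,
      Int.cast_add, zpow_neg]
    field_simp
    ring
  · rw [sub_sub]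

/-- The sum of smooth wavelets with a character as coefficients is a convolution. -/
theorem sum_chr_smoothWavelet_eq (hφ : IsMollifier κ φ) (hη : 0 < η) (hg : g ∈ alpertSpace n κ)
    (μ v : E n) (s : ℤ) (K L : Finset (Fin n → ℤ)) (x : E n) :
    ∑ k ∈ K, ∑ l ∈ L, chr μ (gridCenter v s (k + l)) * (smoothWavelet φ g η v s (k + l) x : ℂ) =
      ∫ y, (∑ l ∈ L, chr μ (gridCenter v s l) * (wavelet g v s l y : ℂ)) *
        ∑ k ∈ K, chr μ ((2 : ℝ) ^ (-s) • latticePt k) *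
          (dilate φ (η * (2 : ℝ) ^ (-s)) (x - y - (2 : ℝ) ^ (-s) • latticePt k) : ℂ) := by
  have hη' : 0 < η * (2 : ℝ) ^ (-s) := by positivity
  have hW : ∀ l, Integrable (wavelet g v s l) := fun l => by
    have h1 : wavelet g v s l = fun x => wavelet g 0 s l (x - v) :=
      funext (wavelet_eq_translate g v s l)
    rw [h1]
    exact (memLp_one_iff_integrable.1
      (memLp_wavelet (memLp_of_mem_alpertSpace hg 1) s l)).comp_sub_right v
  have hI : ∀ k l, Integrable fun y => wavelet g v s l y *
      dilate φ (η * (2 : ℝ) ^ (-s)) (x - y - (2 : ℝ) ^ (-s) • latticePt k) := fun k l => by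
    obtain ⟨B, hB⟩ := (continuous_dilate (η := η * (2 : ℝ) ^ (-s)) hφ).bounded_above_of_compact_support
      (hasCompactSupport_dilate hφ hη')
    refine (hW l).mul_bdd ?_ (Filter.Eventually.of_forall fun y => hB _)
    exact ((continuous_dilate hφ).comp (by fun_prop)).aestronglyMeasurable
  have hIc : ∀ k l, Integrable fun y => (chr μ (gridCenter v s l) * (wavelet g v s l y : ℂ)) *
      (chr μ ((2 : ℝ) ^ (-s) • latticePt k) *
        (dilate φ (η * (2 : ℝ) ^ (-s)) (x - y - (2 : ℝ) ^ (-s) • latticePt k) : ℂ)) := fun k l => by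
    refine ((hI k l).ofReal (𝕜 := ℂ) |>.const_mul
      (chr μ (gridCenter v s l) * chr μ ((2 : ℝ) ^ (-s) • latticePt k))).congr
      (Filter.Eventually.of_forall fun y => ?_)
    simp only [RCLike.ofReal_mul]
    change _ * ((wavelet g v s l y : ℂ) * (dilate φ (η * (2 : ℝ) ^ (-s)) (x - y - (2 : ℝ) ^ (-s) • latticePt k) : ℂ)) = _
    ring
  simp_rw [Finset.sum_mul, Finset.mul_sum]
  rw [integral_finsetSum _ fun l _ => integrable_finsetSum _ fun k _ => hIc k l]
  rw [Finset.sum_comm]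
  refine Finset.sum_congr rfl fun l _ => ?_
  rw [integral_finsetSum _ fun k _ => hIc k l]
  refine Finset.sum_congr rfl fun k _ => ?_
  rw [gridCenter_add, chr_add_right, smoothWavelet_add, ← integral_complex_ofReal,
    ← integral_const_mul]
  congr 1; funext y; push_cast; ring

/-- The dispersive estimate for u * w, with u a sum of wavelets over L and w a sum of mollifiers
over K. Characters are unimodular and overlaps bounded, so the squared norms are O(|L|) and
O(2^{sn}|K|), uniformly in μ. -/
theorem exists_ext_sum_chr_le (hφ : IsMollifier κ φ) (hη : 0 < η) (hη1 : η ≤ 1)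
    (hg : g ∈ alpertSpace n κ) : ∃ C : ℝ, 0 ≤ C ∧ ∀ (μ v : E n) (s : ℕ) (K L : Finset (Fin n → ℤ))
      (ξ : E n × ℝ), ξ.2 ≠ 0 →
      ‖ext (fun x => ∑ k ∈ K, ∑ l ∈ L, chr μ (gridCenter v s (k + l)) *
        (smoothWavelet φ g η v s (k + l) x : ℂ)) ξ‖ ^ 2 ≤
        C * |ξ.2|⁻¹ ^ n * ((2 : ℝ) ^ s) ^ n * K.card * L.card := by
  have hd2 : MemLp (dilate φ η) 2 :=
    (continuous_dilate hφ).memLp_of_hasCompactSupport (hasCompactSupport_dilate hφ hη)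
  have hg2 : MemLp g 2 := memLp_of_mem_alpertSpace hg 2
  have hdR : Function.support (dilate φ η) ⊆ box n (1 : ℕ) := fun x hx i => by
    have := norm_le_of_dilate_ne_zero hφ hη hx
    have h3 := PiLp.norm_apply_le x i
    rw [Real.norm_eq_abs] at h3
    push_cast; linarith
  have hgR : Function.support g ⊆ box n (1 : ℕ) := fun x hx i => by
    have := support_of_mem_alpertSpace hg hx i
    rw [mem_Ico] at this
    rw [abs_of_nonneg this.1]; push_cast; exact this.2.le
  set A := (2 * ((1 : ℕ) : ℝ) + 1) ^ n * ‖realL2 g‖ ^ 2 with hA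
  set D := (2 * ((1 : ℕ) : ℝ) + 1) ^ n * ‖realL2 (dilate φ η)‖ ^ 2 with hD
  refine ⟨Real.pi ^ n * A * D, by positivity, fun μ v s K L ξ hξ => ?_⟩
  have hη' : 0 < η * (2 : ℝ) ^ (-(s : ℤ)) := by positivity
  set u : E n → ℂ := fun y => ∑ l ∈ L, chr μ (gridCenter v s l) * (wavelet g v s l y : ℂ) with hu
  set w : E n → ℂ := fun z => ∑ k ∈ K, chr μ ((2 : ℝ) ^ (-(s : ℤ)) • latticePt k) *
    (dilate φ (η * (2 : ℝ) ^ (-(s : ℤ))) (z - (2 : ℝ) ^ (-(s : ℤ)) • latticePt k) : ℂ) with hw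
  have hui : Integrable u := by
    refine integrable_finsetSum _ fun l _ => Integrable.const_mul ?_ _
    have h1 : ∀ y, wavelet g v s l y = wavelet g 0 s l (y - v) := wavelet_eq_translate g v s l
    simp_rw [h1]
    exact ((memLp_one_iff_integrable.1
      (memLp_wavelet (memLp_of_mem_alpertSpace hg 1) s l)).comp_sub_right v).ofReal
  have hwc : ContDiff ℝ ∞ w := by
    refine ContDiff.sum fun k _ => contDiff_const.mul (Complex.ofRealCLM.contDiff.comp ?_)
    exact (contDiff_dilate hφ).comp (contDiff_id.sub contDiff_const)
  have hws : HasCompactSupport w := by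
    have h1 : ∀ k, HasCompactSupport fun z => chr μ ((2 : ℝ) ^ (-(s : ℤ)) • latticePt k) *
        (dilate φ (η * (2 : ℝ) ^ (-(s : ℤ))) (z - (2 : ℝ) ^ (-(s : ℤ)) • latticePt k) : ℂ) := fun k => by
      refine HasCompactSupport.mul_left ?_
      refine HasCompactSupport.comp_left (g := fun r : ℝ => (r : ℂ)) ?_ Complex.ofReal_zero
      exact (hasCompactSupport_dilate hφ hη').comp_homeomorph (Homeomorph.subRight _)
    exact hasCompactSupport_sum K fun k _ => h1 k
  have hu2 : l2sq u ≤ ENNReal.ofReal (A * L.card) := by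
    refine (l2sq_sum_wavelet_le hg2 hgR v s L _).trans (le_of_eq ?_)
    simp [norm_chr, hA]
  have hw2 : l2sq w ≤ ENNReal.ofReal (D * (((2 : ℝ) ^ s) ^ n * K.card)) := by
    have h1 : w = fun z => ∑ k ∈ K, (chr μ ((2 : ℝ) ^ (-(s : ℤ)) • latticePt k) *
        ((2 : ℝ) ^ (((s : ℤ) : ℝ) * n / 2) : ℝ)) * (wavelet (dilate φ η) 0 s k z : ℂ) := by
      funext z
      refine Finset.sum_congr rfl fun k _ => ?_
      rw [translate_dilate_eq]; push_cast; ring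
    rw [h1]
    refine (l2sq_sum_wavelet_le hd2 hdR 0 s K _).trans (le_of_eq ?_)
    congr 2
    simp_rw [norm_mul, norm_chr, one_mul, Complex.norm_real, Real.norm_eq_abs, sq_abs, sq,
      two_rpow_half_sq]
    rw [Finset.sum_const, nsmul_eq_mul, mul_comm, zpow_natCast]
  have h1 := enorm_ext_convolution_sq_le hui hwc hws hξ
  have h2 : (fun x => ∑ k ∈ K, ∑ l ∈ L, chr μ (gridCenter v s (k + l)) *
      (smoothWavelet φ g η v s (k + l) x : ℂ)) = fun x => ∫ y, u y * w (x - y) := by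
    funext x; exact sum_chr_smoothWavelet_eq hφ hη hg μ v s K L x
  rw [h2]
  have h3 := h1.trans (mul_le_mul' (mul_le_mul' le_rfl hu2) hw2)
  rw [← ENNReal.ofReal_mul (by positivity), ← ENNReal.ofReal_mul (by positivity), ← ofReal_norm,
    ← ENNReal.ofReal_pow (norm_nonneg _), ENNReal.ofReal_le_ofReal_iff (by positivity)] at h3
  refine h3.trans (le_of_eq ?_)
  rw [div_pow, inv_pow]
  ring

end Convolution

/-! ### The modulated pieces: L¹, L² and dispersive bounds -/

section ModPiece

variable {n κ M : ℕ} {φ ψ : E n → ℝ} {h : Fin M → E n → ℝ} {η : ℝ}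

/-- The centre belongs to its cube, so the weight ψ(c_J) allows the sum to be extended to an index
box independent of the grid. -/
theorem cutoff_center_eq_zero (hψ : tsupport ψ ⊆ cubeU n) {v : E n} {s : ℤ} {j : Fin n → ℤ}
    (hj : j ∉ cubesMeeting v s) : ψ (gridCenter v s j) = 0 := by
  by_contra hne
  refine hj (mem_cubesMeeting.2 ⟨gridCenter v s j, fun i => ?_, hψ (subset_tsupport ψ hne)⟩)
  have h2 : (2 : ℝ) ^ s ≠ 0 := by positivity
  have h3 : (2 : ℝ) ^ s * (gridCenter v s j i - v i) - j i = 1 / 2 := by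
    simp only [gridCenter, zpow_neg]
    field_simp
    ring
  rw [h3]; constructor <;> norm_num

theorem hasCompactSupport_of_tsupport_subset (hψ : tsupport ψ ⊆ cubeU n) : HasCompactSupport ψ :=
  hasCompactSupport_of_box (R := 1 / 8) (by norm_num) ((subset_tsupport ψ).trans hψ)

theorem modPiece_eq (hψ : tsupport ψ ⊆ cubeU n) (s : ℕ) (m : E n) {v : E n} (hv : v ∈ shifts n)
    (a : Fin M) (x : E n) : modPiece φ h η ψ s m v a x =
      ∑ j ∈ latticeBox n (3 * 2 ^ s), (ψ (gridCenter v s j) : ℂ) * modulation s m v j *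
        (smoothWavelet φ (h a) η v s j x : ℂ) := by
  refine Finset.sum_subset (cubesMeeting_subset hv s) fun j _ hj => ?_
  rw [cutoff_center_eq_zero hψ hj]; simp

theorem contDiff_smoothWavelet (hφ : IsMollifier κ φ) (hη : 0 < η) {g : E n → ℝ}
    (hg : g ∈ alpertSpace n κ) (v : E n) (s : ℤ) (j : Fin n → ℤ) :
    ContDiff ℝ ∞ fun x => (smoothWavelet φ g η v s j x : ℂ) := by
  rw [smoothWavelet_eq]
  refine Complex.ofRealCLM.contDiff.comp (contDiff_const.mul ((contDiff_smoothing hφ hη hg).comp ?_))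
  exact ((contDiff_id.sub contDiff_const).const_smul _).sub contDiff_const

theorem hasCompactSupport_smoothWavelet (hφ : IsMollifier κ φ) (hη : 0 < η) (hη1 : η ≤ 1)
    {g : E n → ℝ} (hg : g ∈ alpertSpace n κ) (v : E n) (s : ℤ) (j : Fin n → ℤ) :
    HasCompactSupport fun x => (smoothWavelet φ g η v s j x : ℂ) := by
  have h2 : (2 : ℝ) ^ s ≠ 0 := by positivity
  rw [smoothWavelet_eq]
  refine HasCompactSupport.comp_left (g := fun r : ℝ => (r : ℂ)) ?_ Complex.ofReal_zero
  refine HasCompactSupport.mul_left ?_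
  exact (hasCompactSupport_smoothing hφ hη hη1 hg).comp_homeomorph
    (((Homeomorph.subRight v).trans (Homeomorph.smulOfNeZero _ h2)).trans
      (Homeomorph.subRight (latticePt j)))

theorem contDiff_modPiece (hφ : IsMollifier κ φ) (hη : 0 < η) (s : ℕ) (m v : E n) {a : Fin M}
    (hg : h a ∈ alpertSpace n κ) : ContDiff ℝ ∞ (modPiece φ h η ψ s m v a) :=
  ContDiff.sum fun j _ => contDiff_const.mul (contDiff_smoothWavelet hφ hη hg v s j)

theorem hasCompactSupport_modPiece (hφ : IsMollifier κ φ) (hη : 0 < η) (hη1 : η ≤ 1) (s : ℕ)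
    (m v : E n) {a : Fin M} (hg : h a ∈ alpertSpace n κ) :
    HasCompactSupport (modPiece φ h η ψ s m v a) :=
  hasCompactSupport_sum _ fun j _ =>
    (hasCompactSupport_smoothWavelet hφ hη hη1 hg v s j).mul_left

theorem integrable_modPiece (hφ : IsMollifier κ φ) (hη : 0 < η) (hη1 : η ≤ 1) (s : ℕ)
    (m v : E n) {a : Fin M} (hg : h a ∈ alpertSpace n κ) :
    Integrable (modPiece φ h η ψ s m v a) :=
  (contDiff_modPiece hφ hη s m v hg).continuous.integrable_of_hasCompactSupport
    (hasCompactSupport_modPiece hφ hη hη1 s m v hg)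

theorem exists_l2sq_modPiece_le (hφ : IsMollifier κ φ) (hη : 0 < η) (hη1 : η ≤ 1) {a : Fin M}
    (hg : h a ∈ alpertSpace n κ) (hψc : Continuous ψ) (hψ : tsupport ψ ⊆ cubeU n) :
    ∃ C : ℝ, 0 ≤ C ∧ ∀ (s : ℕ) (m : E n), ∀ v ∈ shifts n,
      l2sq (modPiece φ h η ψ s m v a) ≤ ENNReal.ofReal C := by
  obtain ⟨B, hB⟩ := hψc.bounded_above_of_compact_support (hasCompactSupport_of_tsupport_subset hψ)
  refine ⟨(2 * ((2 : ℕ) : ℝ) + 1) ^ n * ‖realL2 (smoothing φ (h a) η)‖ ^ 2 * (B ^ 2 * 7 ^ n),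
    by positivity, fun s m v hv => ?_⟩
  have he : modPiece φ h η ψ s m v a = fun x => ∑ j ∈ cubesMeeting v s,
      (ψ (gridCenter v s j) : ℂ) * modulation s m v j *
        (wavelet (smoothing φ (h a) η) v s j x : ℂ) := by
    funext x; simp only [modPiece, smoothWavelet_eq]
  rw [he]
  refine (l2sq_sum_wavelet_le (memLp_smoothing hφ hη hη1 hg 2)
    (support_smoothing_subset hφ hη hη1 hg) v s (cubesMeeting v s) _).trans ?_
  refine ENNReal.ofReal_le_ofReal (mul_le_mul_of_nonneg_left ?_ (by positivity))
  calc _ ≤ ∑ j ∈ cubesMeeting v s, B ^ 2 * ‖modulation s m v j‖ ^ 2 := by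
          refine Finset.sum_le_sum fun j _ => ?_
          rw [norm_mul, mul_pow, Complex.norm_real]
          gcongr
          exact hB _
    _ ≤ _ := by
          rw [← Finset.mul_sum]
          gcongr
          exact sum_norm_modulation_sq_le s m v (cubesMeeting_subset hv s)

theorem integral_norm_wavelet (u : E n → ℝ) (v : E n) (s : ℤ) (j : Fin n → ℤ) :
    ∫ x, ‖wavelet u v s j x‖ =
      (2 : ℝ) ^ ((s : ℝ) * n / 2) * ((((2 : ℝ) ^ s) ^ n)⁻¹ * ∫ x, ‖u x‖) := by
  simp_rw [wavelet_eq_translate u v]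
  rw [integral_sub_right_eq_self (fun x => ‖wavelet u 0 s j x‖), wavelet_zero_eq]
  simp_rw [norm_mul]
  rw [integral_const_mul, integral_comp_affine (fun x => ‖u x‖), smul_eq_mul,
    Real.norm_of_nonneg (by positivity)]

/-- A normalised wavelet has L¹ norm O(2^{-sn/2}), its modulation contributes another 2^{-sn/2}, and
there are O(2^{sn}) cubes. -/
theorem exists_integral_norm_modPiece_le (hφ : IsMollifier κ φ) (hη : 0 < η) (hη1 : η ≤ 1)
    {a : Fin M} (hg : h a ∈ alpertSpace n κ) (hψc : Continuous ψ) (hψ : tsupport ψ ⊆ cubeU n) :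
    ∃ C : ℝ, 0 ≤ C ∧ ∀ (s : ℕ) (m : E n), ∀ v ∈ shifts n,
      ∫ x, ‖modPiece φ h η ψ s m v a x‖ ≤ C := by
  obtain ⟨B, hB⟩ := hψc.bounded_above_of_compact_support (hasCompactSupport_of_tsupport_subset hψ)
  have hB0 : 0 ≤ B := (norm_nonneg _).trans (hB 0)
  set I := ∫ x, ‖smoothing φ (h a) η x‖ with hI
  have hI0 : 0 ≤ I := integral_nonneg fun x => norm_nonneg _
  refine ⟨7 ^ n * (B * I), by positivity, fun s m v hv => ?_⟩
  set p : ℝ := (2 : ℝ) ^ s with hp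
  have hp0 : 0 < p := by positivity
  have hSW : ∀ j, Integrable fun x => (smoothWavelet φ (h a) η v s j x : ℂ) := fun j =>
    (contDiff_smoothWavelet hφ hη hg v s j).continuous.integrable_of_hasCompactSupport
      (hasCompactSupport_smoothWavelet hφ hη hη1 hg v s j)
  set b : ℝ := B * ((2 * p + 1) ^ ((n : ℝ) / 2))⁻¹ *
    ((2 : ℝ) ^ (((s : ℤ) : ℝ) * n / 2) * ((p ^ n)⁻¹ * I)) with hb
  have hb1 : b ≤ B * ((p ^ n)⁻¹ * I) := by
    have h1 : (2 : ℝ) ^ (((s : ℤ) : ℝ) * n / 2) ≤ (2 * p + 1) ^ ((n : ℝ) / 2) := by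
      rw [mul_div_assoc, Real.rpow_mul (by norm_num), Int.cast_natCast, Real.rpow_natCast]
      exact Real.rpow_le_rpow hp0.le (by linarith) (by positivity)
    rw [hb, mul_assoc]
    refine mul_le_mul_of_nonneg_left ?_ hB0
    rw [inv_mul_le_iff₀ (by positivity)]
    exact mul_le_mul_of_nonneg_right h1 (by positivity)
  have hb0 : 0 ≤ b := by positivity
  have hterm : ∀ j, ∫ x, ‖(ψ (gridCenter v s j) : ℂ) * modulation s m v j *
      (smoothWavelet φ (h a) η v s j x : ℂ)‖ ≤ b := fun j => by
    simp_rw [norm_mul, Complex.norm_real, norm_modulation, smoothWavelet_eq]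
    rw [integral_const_mul, integral_norm_wavelet, zpow_natCast, hb]
    gcongr
    exact hB _
  calc _ ≤ ∫ x, ∑ j ∈ cubesMeeting v s, ‖(ψ (gridCenter v s j) : ℂ) * modulation s m v j *
            (smoothWavelet φ (h a) η v s j x : ℂ)‖ := by
          refine integral_mono (integrable_modPiece hφ hη hη1 s m v hg).norm
            (integrable_finsetSum _ fun j _ => ((hSW j).const_mul _).norm) fun x => ?_
          exact norm_sum_le _ _
    _ = ∑ j ∈ cubesMeeting v s, ∫ x, ‖(ψ (gridCenter v s j) : ℂ) * modulation s m v j *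
            (smoothWavelet φ (h a) η v s j x : ℂ)‖ :=
          integral_finsetSum _ fun j _ => ((hSW j).const_mul _).norm
    _ ≤ (cubesMeeting v s).card * b := by
          rw [← nsmul_eq_mul]; exact Finset.sum_le_card_nsmul _ _ _ fun j _ => hterm j
    _ ≤ (7 * p) ^ n * (B * ((p ^ n)⁻¹ * I)) := by
          gcongr
          have h1 : ((cubesMeeting v s).card : ℝ) ≤ ((2 * (3 * 2 ^ s) + 1) ^ n : ℕ) := by
            rw [← card_latticeBox]; exact_mod_cast Finset.card_le_card (cubesMeeting_subset hv s)
          refine h1.trans ?_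
          push_cast
          gcongr
          have : (1 : ℝ) ≤ p := one_le_pow₀ (by norm_num)
          linarith
    _ = _ := by rw [mul_pow]; field_simp

/-- The dispersive estimate for the modulated pieces. -/
theorem exists_ext_modPiece_le (hφ : IsMollifier κ φ) (hη : 0 < η) (hη1 : η ≤ 1)
    {a : Fin M} (hg : h a ∈ alpertSpace n κ) (hψs : ContDiff ℝ ∞ ψ) (hψ : tsupport ψ ⊆ cubeU n) :
    ∃ C : ℝ, 0 ≤ C ∧ ∀ (s : ℕ) (m : E n), ∀ v ∈ shifts n, ∀ ξ : E n × ℝ, ξ.2 ≠ 0 →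
      ‖ext (modPiece φ h η ψ s m v a) ξ‖ ^ 2 ≤ C * |ξ.2|⁻¹ ^ n := by
  obtain ⟨Ψ, hΨ, hinv⟩ := exists_fourier_inversion hψs (hasCompactSupport_of_tsupport_subset hψ)
  obtain ⟨C, hC0, hC⟩ := exists_ext_sum_chr_le hφ hη hη1 hg
  set I := ∫ w, ‖Ψ w‖ with hI
  refine ⟨I ^ 2 * C * 2 ^ n, by positivity, fun s m v hv ξ hξ => ?_⟩
  set N : ℕ := 3 * 2 ^ s with hN
  set p : ℝ := (2 : ℝ) ^ s with hp
  have hp0 : 0 < p := by positivity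
  set D : ℝ := ((2 * p + 1) ^ ((n : ℝ) / 2))⁻¹ with hD
  set μ : E n := (2 : ℝ) ^ s • (2 : ℝ) ^ s • m with hμ
  set X : (Fin n → ℤ) → ℂ := fun j => ext (fun x => (smoothWavelet φ (h a) η v s j x : ℂ)) ξ with hX
  have hSW : ∀ j, Integrable fun x => (smoothWavelet φ (h a) η v s j x : ℂ) := fun j =>
    (contDiff_smoothWavelet hφ hη hg v s j).continuous.integrable_of_hasCompactSupport
      (hasCompactSupport_smoothWavelet hφ hη hη1 hg v s j)
  have h1 : ext (modPiece φ h η ψ s m v a) ξ = ∑ j ∈ latticeBox n N,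
      (ψ (gridCenter v s j) : ℂ) * modulation s m v j * X j := by
    rw [show modPiece φ h η ψ s m v a = _ from funext (modPiece_eq hψ s m hv a),
      ext_sum _ fun j _ => (hSW j).const_mul _]
    simp_rw [ext_const_mul]
    rfl
  -- The passage to the double sum is made while ψ is still present, since ψ removes the indices
  -- outside the box.
  have h2 := sum_latticeBox_add (a := fun j => (ψ (gridCenter v s j) : ℂ) * modulation s m v j * X j)
    (N := N) fun j hj => by
      rw [cutoff_center_eq_zero hψ fun h => hj (cubesMeeting_subset hv s h)]; simp
  rw [← h1] at h2
  -- Once ψ is opened by Fourier inversion, the coefficients are pure characters of frequency w + μ,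
  -- and the bound for `Y w` is uniform in w.
  set Y : E n → ℂ := fun w => ∑ k ∈ latticeBox n N, ∑ l ∈ latticeBox n (2 * N),
    chr (w + μ) (gridCenter v s (k + l)) * X (k + l) with hY
  have hYext : ∀ w, Y w = ext (fun x => ∑ k ∈ latticeBox n N, ∑ l ∈ latticeBox n (2 * N),
      chr (w + μ) (gridCenter v s (k + l)) * (smoothWavelet φ (h a) η v s (k + l) x : ℂ)) ξ :=
    fun w => by
      rw [ext_sum _ fun k _ => integrable_finsetSum _ fun l _ => (hSW (k + l)).const_mul _]
      refine Finset.sum_congr rfl fun k _ => ?_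
      rw [ext_sum _ fun l _ => (hSW (k + l)).const_mul _]
      simp_rw [ext_const_mul]
      rfl
  set Q : ℝ := C * |ξ.2|⁻¹ ^ n * p ^ n * (latticeBox n N).card * (latticeBox n (2 * N)).card with hQ
  have hQ0 : 0 ≤ Q := by positivity
  have hYle : ∀ w, ‖Y w‖ ≤ √Q := fun w => by
    refine Real.le_sqrt_of_sq_le ?_
    rw [hYext]
    exact hC (w + μ) v s _ _ ξ hξ
  have hint : ∀ j, Integrable fun w => chr (w + μ) (gridCenter v s j) * X j * Ψ w := fun j => by
    refine hΨ.bdd_mul (c := ‖X j‖) ?_ (Filter.Eventually.of_forall fun w => ?_)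
    · exact (((continuous_chr_left _).comp (continuous_id.add continuous_const)).mul
        continuous_const).aestronglyMeasurable
    · rw [norm_mul, norm_chr, one_mul]
  have h3 : ∑ k ∈ latticeBox n N, ∑ l ∈ latticeBox n (2 * N), (ψ (gridCenter v s (k + l)) : ℂ) *
      modulation s m v (k + l) * X (k + l) = D * ∫ w, Y w * Ψ w := by
    have h4 : ∀ j, (ψ (gridCenter v s j) : ℂ) * modulation s m v j * X j =
        D * ∫ w, chr (w + μ) (gridCenter v s j) * X j * Ψ w := fun j => by
      rw [hinv, modulation_eq, mul_assoc, ← integral_mul_const, ← integral_const_mul]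
      congr 1; funext w
      rw [chr_add_left]; ring
    simp_rw [h4, ← Finset.mul_sum]
    congr 1
    simp_rw [hY, Finset.sum_mul]
    rw [integral_finsetSum _ fun k _ => integrable_finsetSum _ fun l _ => hint (k + l)]
    refine Finset.sum_congr rfl fun k _ => ?_
    rw [integral_finsetSum _ fun l _ => hint (k + l)]
  have h5 : ‖∫ w, Y w * Ψ w‖ ≤ √Q * I := by
    rw [hI, ← integral_const_mul]
    refine norm_integral_le_of_norm_le (hΨ.norm.const_mul _)
      (Filter.Eventually.of_forall fun w => ?_)
    rw [norm_mul]
    gcongr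
    exact hYle w
  set c : ℝ := (2 * N + 1) ^ n with hc
  have hc0 : 0 < c := by positivity
  have h6 : c * ‖ext (modPiece φ h η ψ s m v a) ξ‖ ≤ D * (√Q * I) := by
    have h7 := congrArg norm (h2.symm.trans h3)
    rw [norm_mul, norm_mul, Complex.norm_real, Real.norm_of_nonneg (by positivity),
      Complex.norm_natCast] at h7
    push_cast at h7
    rw [h7]
    gcongr
  -- The normalisation of the modulations absorbs the factor 2^{sn} coming from the mollifiers; the
  -- cardinalities are balanced by the overcounting factor `c`, squared.
  have hD2 : D ^ 2 * p ^ n ≤ 1 := by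
    rw [hD, inv_pow, ← Real.rpow_natCast ((2 * p + 1) ^ _), ← Real.rpow_mul (by positivity),
      inv_mul_le_iff₀ (by positivity)]
    norm_num
    gcongr
    linarith
  have hcard : ((latticeBox n (2 * N)).card : ℝ) ≤ 2 ^ n * c := by
    rw [card_latticeBox, hc, ← mul_pow]
    push_cast
    gcongr
    linarith
  have h8 : c ^ 2 * ‖ext (modPiece φ h η ψ s m v a) ξ‖ ^ 2 ≤
      c ^ 2 * (I ^ 2 * C * 2 ^ n * |ξ.2|⁻¹ ^ n) := by
    calc _ = (c * ‖ext (modPiece φ h η ψ s m v a) ξ‖) ^ 2 := by ring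
      _ ≤ (D * (√Q * I)) ^ 2 := by gcongr
      _ = D ^ 2 * p ^ n * (I ^ 2 * C * |ξ.2|⁻¹ ^ n * c * (latticeBox n (2 * N)).card) := by
          rw [mul_pow, mul_pow, Real.sq_sqrt hQ0, hQ, card_latticeBox, hc]
          push_cast
          ring
      _ ≤ 1 * (I ^ 2 * C * |ξ.2|⁻¹ ^ n * c * (2 ^ n * c)) := by gcongr
      _ = _ := by ring
  exact le_of_mul_le_mul_left h8 (by positivity)

end ModPiece

/-! ### Interpolation on slices and passage to averages -/

section Slices

variable {n : ℕ}

/-- Interpolation of a supremum bound and an `L²` bound on the slices of constant `ξ_d`. -/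
theorem eLpNorm_le_of_slices {F : E n × ℝ → ℂ} (hF : Measurable F) {S : Set ℝ}
    (hS : MeasurableSet S) {R : Set (E n × ℝ)} (hR : ∀ ξ ∈ R, ξ.2 ∈ S) {r : ℝ} (hr : 2 ≤ r)
    {B : ENNReal} {β : ℝ → ENNReal} (hβ : Measurable β)
    (h1 : ∀ t ∈ S, ∀ x, ‖F (x, t)‖ₑ ≤ B * β t)
    (h2 : ∀ t ∈ S, ∫⁻ x, ‖F (x, t)‖ₑ ^ 2 ≤ B ^ 2) :
    eLpNorm F (ENNReal.ofReal r) (volume.restrict R) ≤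
      B * (∫⁻ t in S, β t ^ (r - 2)) ^ (1 / r) := by
  have hr0 : 0 < r := by linarith
  have hr2 : 0 ≤ r - 2 := by linarith
  have hsplit : ∀ y : ENNReal, y ^ r = y ^ (r - 2) * y ^ 2 := fun y => by
    rw [← ENNReal.rpow_two, ← ENNReal.rpow_add_of_nonneg _ _ hr2 (by norm_num)]
    congr 1; ring
  have hFt : ∀ t, Measurable fun x => ‖F (x, t)‖ₑ ^ 2 := fun t =>
    (hF.comp measurable_prodMk_right).enorm.pow_const 2
  have hslice : ∀ t ∈ S, ∫⁻ x, ‖F (x, t)‖ₑ ^ r ≤ B ^ r * β t ^ (r - 2) := fun t ht => by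
    calc _ ≤ ∫⁻ x, (B * β t) ^ (r - 2) * ‖F (x, t)‖ₑ ^ 2 := by
            refine lintegral_mono fun x => ?_
            rw [hsplit]
            gcongr
            exact h1 t ht x
      _ = (B * β t) ^ (r - 2) * ∫⁻ x, ‖F (x, t)‖ₑ ^ 2 := lintegral_const_mul _ (hFt t)
      _ ≤ (B * β t) ^ (r - 2) * B ^ 2 := by gcongr; exact h2 t ht
      _ = _ := by rw [hsplit B, ENNReal.mul_rpow_of_nonneg _ _ hr2]; ring
  have hne : ENNReal.ofReal r ≠ 0 := by simpa using hr0
  rw [eLpNorm_eq_lintegral_rpow_enorm_toReal hne ENNReal.ofReal_ne_top, ENNReal.toReal_ofReal hr0.le]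
  have hmain : ∫⁻ ξ in R, ‖F ξ‖ₑ ^ r ≤ B ^ r * ∫⁻ t in S, β t ^ (r - 2) := by
    calc _ ≤ ∫⁻ ξ in univ ×ˢ S, ‖F ξ‖ₑ ^ r :=
            lintegral_mono_set fun ξ hξ => ⟨mem_univ _, hR ξ hξ⟩
      _ = ∫⁻ t in S, ∫⁻ x, ‖F (x, t)‖ₑ ^ r := by
            rw [Measure.volume_eq_prod, ← Measure.prod_restrict, Measure.restrict_univ,
              lintegral_prod_symm' _ (hF.enorm.pow_const r)]
      _ ≤ ∫⁻ t in S, B ^ r * β t ^ (r - 2) := setLIntegral_mono' hS fun t ht => hslice t ht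
      _ = _ := lintegral_const_mul _ (hβ.pow_const _)
  calc _ ≤ (B ^ r * ∫⁻ t in S, β t ^ (r - 2)) ^ (1 / r) := by gcongr
    _ = _ := by
        rw [ENNReal.mul_rpow_of_nonneg _ _ (by positivity), ← ENNReal.rpow_mul,
          mul_one_div_cancel hr0.ne', ENNReal.rpow_one]

/-- Pointwise bounds pass to averages. -/
theorem enorm_integral_le_of_forall {P : Measure (E n)} [IsProbabilityMeasure P] {g : E n → ℂ}
    {b : ENNReal} (hb : ∀ᵐ v ∂P, ‖g v‖ₑ ≤ b) : ‖∫ v, g v ∂P‖ₑ ≤ b := by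
  refine (enorm_integral_le_lintegral_enorm _).trans ((lintegral_mono_ae hb).trans ?_)
  rw [lintegral_const, measure_univ, mul_one]

/-- `L²` bounds pass to averages. -/
theorem lintegral_enorm_integral_sq_le {P : Measure (E n)} [IsProbabilityMeasure P]
    {G : E n × E n → ℂ} (hG : Measurable G) {σ : ENNReal}
    (hσ : ∀ᵐ v ∂P, ∫⁻ x, ‖G (v, x)‖ₑ ^ 2 ≤ σ) :
    ∫⁻ x, ‖∫ v, G (v, x) ∂P‖ₑ ^ 2 ≤ σ := by
  calc _ ≤ ∫⁻ x, ∫⁻ v, ‖G (v, x)‖ₑ ^ 2 ∂P := by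
          refine lintegral_mono fun x => ?_
          have h1 : ‖∫ v, G (v, x) ∂P‖ₑ ≤ ∫⁻ v, ‖G (v, x)‖ₑ * 1 ∂P := by
            simp_rw [mul_one]; exact enorm_integral_le_lintegral_enorm _
          calc _ ≤ (∫⁻ v, ‖G (v, x)‖ₑ * 1 ∂P) ^ 2 := by gcongr
            _ ≤ _ := sq_lintegral_mul_le (hG.comp measurable_prodMk_right).enorm.aemeasurable
                aemeasurable_const
            _ = _ := by simp
    _ = ∫⁻ v, (∫⁻ x, ‖G (v, x)‖ₑ ^ 2) ∂P :=
          lintegral_lintegral_swap ((hG.comp measurable_swap).enorm.pow_const 2).aemeasurable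
    _ ≤ ∫⁻ _, σ ∂P := lintegral_mono_ae hσ
    _ = _ := by rw [lintegral_const, measure_univ, mul_one]

end Slices

/-! ### The logarithmic size of the range of ξ_d -/

section Ranges

theorem lintegral_inv_Icc_le {a b : ℝ} (ha : 0 < a) (hab : a ≤ b) :
    ∫⁻ t in Icc a b, ENNReal.ofReal t⁻¹ = ENNReal.ofReal (Real.log (b / a)) := by
  have h0 : (0 : ℝ) ∉ uIcc a b := by rw [uIcc_of_le hab]; exact fun h => absurd h.1 (not_le.2 ha)
  have hi : IntegrableOn (fun t : ℝ => t⁻¹) (Icc a b) :=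
    (continuousOn_inv₀.mono fun t ht => (ha.trans_le ht.1).ne').integrableOn_Icc
  rw [← integral_inv h0, intervalIntegral.integral_of_le hab, ← integral_Icc_eq_integral_Ioc,
    ofReal_integral_eq_lintegral_ofReal hi]
  exact (ae_restrict_iff' measurableSet_Icc).2
    (Filter.Eventually.of_forall fun t ht => inv_nonneg.2 (ha.le.trans ht.1))

/-- The crude log x ≤ x suffices, because 1/(1-δ) - (1-δ) ≤ 4δ for δ ≤ 1/2. This is the source of
the exponent 4δs, and no constant depends on δ. -/
theorem log_range_le {δ : ℝ} (hδ : 0 < δ) (hδ' : δ ≤ 1 / 2) (s : ℕ) :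
    Real.log ((2 : ℝ) ^ ((s : ℝ) / (1 - δ)) / (2 : ℝ) ^ ((1 - δ) * s)) ≤ (2 : ℝ) ^ (4 * δ * s) := by
  have h1 : 0 < 1 - δ := by linarith
  have h2 : 1 / (1 - δ) ≤ 1 - δ + 4 * δ := by
    rw [div_le_iff₀ h1]; nlinarith
  rw [← Real.rpow_sub (by norm_num)]
  refine (Real.log_le_self (by positivity)).trans ?_
  refine Real.rpow_le_rpow_of_exponent_le (by norm_num) ?_
  have h3 : (s : ℝ) / (1 - δ) = s * (1 / (1 - δ)) := by ring
  have h4 : (s : ℝ) * (1 / (1 - δ)) ≤ s * (1 - δ + 4 * δ) := by gcongr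
  rw [h3]; linarith

end Ranges

/-! ### Uniform bounds for the extended pieces -/

section Bounds

variable {n κ M : ℕ} {φ ψ : E n → ℝ} {h : Fin M → E n → ℝ} {η : ℝ}

/-- `⟨𝐚, φ^m⟩ 𝓔 g_m`. -/
noncomputable def extPiece (φ : E n → ℝ) (h : Fin M → E n → ℝ) (η : ℝ) (ψ : E n → ℝ) (s : ℕ)
    (m : E n) (f : E n → ℂ) (v : E n) (ξ : E n × ℝ) : ℂ :=
  ∑ a, modCoeff φ h η s m f v a * ext (modPiece φ h η ψ s m v a) ξ

theorem ext_sum_modPiece (hφ : IsMollifier κ φ) (hh : IsAlpertBasis κ h) (hη : 0 < η) (hη1 : η ≤ 1)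
    (s : ℕ) (m : E n) (f : E n → ℂ) (v : E n) (ξ : E n × ℝ) :
    ext (fun x => ∑ a, modCoeff φ h η s m f v a * modPiece φ h η ψ s m v a x) ξ =
      extPiece φ h η ψ s m f v ξ := by
  rw [ext_sum _ fun a _ => (integrable_modPiece hφ hη hη1 s m v (hh.mem a)).const_mul _]
  simp_rw [ext_const_mul]
  rfl

theorem continuous_extPiece (hφ : IsMollifier κ φ) (hh : IsAlpertBasis κ h) (hη : 0 < η)
    (hη1 : η ≤ 1) (s : ℕ) (m : E n) (f : E n → ℂ) (v : E n) :
    Continuous (extPiece φ h η ψ s m f v) :=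
  continuous_finsetSum _ fun a _ =>
    continuous_const.mul (continuous_ext (integrable_modPiece hφ hη hη1 s m v (hh.mem a)))

theorem lintegral_extPiece_sq_le (hφ : IsMollifier κ φ) (hh : IsAlpertBasis κ h) (hη : 0 < η)
    (hη1 : η ≤ 1) {K : ℝ} (hK : 0 ≤ K) {C : Fin M → ℝ} (s : ℕ) (m : E n) (f : E n → ℂ) (v : E n)
    (hA : ∀ a, ‖modCoeff φ h η s m f v a‖ ≤ K)
    (hC : ∀ a, l2sq (modPiece φ h η ψ s m v a) ≤ ENNReal.ofReal (C a)) (hC0 : ∀ a, 0 ≤ C a) (t : ℝ) :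
    ∫⁻ x, ‖extPiece φ h η ψ s m f v (x, t)‖ₑ ^ 2 ≤
      ENNReal.ofReal ((K * (√((2 * Real.pi) ^ n) * ∑ a, √(C a))) ^ 2) := by
  have hm : ∀ a, MemLp (modPiece φ h η ψ s m v a) 2 := fun a =>
    (contDiff_modPiece hφ hη s m v (hh.mem a)).continuous.memLp_of_hasCompactSupport
      (hasCompactSupport_modPiece hφ hη hη1 s m v (hh.mem a))
  have hs : ContDiff ℝ ∞ fun x => ∑ a, modCoeff φ h η s m f v a * modPiece φ h η ψ s m v a x :=
    ContDiff.sum fun a _ => contDiff_const.mul (contDiff_modPiece hφ hη s m v (hh.mem a))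
  have hc : HasCompactSupport fun x =>
      ∑ a, modCoeff φ h η s m f v a * modPiece φ h η ψ s m v a x :=
    hasCompactSupport_sum _ fun a _ =>
      (hasCompactSupport_modPiece hφ hη hη1 s m v (hh.mem a)).mul_left
  simp_rw [← ext_sum_modPiece hφ hh hη hη1]
  rw [lintegral_enorm_ext_sq hs hc,
    ← ofReal_norm_toL2_sq (memLp_finsetSum _ fun a _ => (hm a).const_mul _),
    toL2_sum _ _ fun a _ => hm a, ← ENNReal.ofReal_mul (by positivity)]
  refine ENNReal.ofReal_le_ofReal ?_
  have h1 : ∀ a, ‖toL2 (modPiece φ h η ψ s m v a)‖ ≤ √(C a) := fun a => by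
    refine Real.le_sqrt_of_sq_le ?_
    have := hC a
    rwa [← ofReal_norm_toL2_sq (hm a), ENNReal.ofReal_le_ofReal_iff (hC0 a)] at this
  have h2 : ‖∑ a, modCoeff φ h η s m f v a • toL2 (modPiece φ h η ψ s m v a)‖ ≤
      K * ∑ a, √(C a) := by
    rw [Finset.mul_sum]
    refine norm_sum_le_of_le _ fun a _ => ?_
    rw [norm_smul]
    exact mul_le_mul (hA a) (h1 a) (norm_nonneg _) hK
  calc _ ≤ (2 * Real.pi) ^ n * (K * ∑ a, √(C a)) ^ 2 := by gcongr
    _ = _ := by rw [mul_pow K, mul_pow K, mul_pow √((2 * Real.pi) ^ n), Real.sq_sqrt (by positivity)]; ring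

theorem norm_extPiece_le {K : ℝ} (hK : 0 ≤ K) {C : Fin M → ℝ} (s : ℕ) (m : E n) (f : E n → ℂ)
    (v : E n) (ξ : E n × ℝ) (hA : ∀ a, ‖modCoeff φ h η s m f v a‖ ≤ K)
    (hC : ∀ a, ‖ext (modPiece φ h η ψ s m v a) ξ‖ ≤ C a) :
    ‖extPiece φ h η ψ s m f v ξ‖ ≤ K * ∑ a, C a := by
  rw [Finset.mul_sum]
  refine norm_sum_le_of_le _ fun a _ => ?_
  rw [norm_mul]
  exact mul_le_mul (hA a) (hC a) (norm_nonneg _) hK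

/-- The L¹, dispersive and Plancherel bounds with a common constant that does not depend on the
grid, so that all three survive averaging. -/
theorem exists_extPiece_bounds (hφ : IsMollifier κ φ) (hh : IsAlpertBasis κ h) (hη : 0 < η)
    (hη1 : η ≤ 1) {T : L2 n ≃L[ℂ] L2 n} (hT : ∀ F, HasSum (frameTerm φ h η 0 F) (T F))
    (hψs : ContDiff ℝ ∞ ψ) (hψ : tsupport ψ ⊆ cubeU n) {q : ENNReal} (hq : 2 ≤ q) :
    ∃ K : ℝ, 0 ≤ K ∧ ∀ (s : ℕ) (m : E n) (f : E n → ℂ),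
      MemLp f q (volume.restrict (cubeU n)) → ∀ v ∈ shifts n,
        (∀ ξ, ‖extPiece φ h η ψ s m f v ξ‖ ≤
          K * (eLpNorm f q (volume.restrict (cubeU n))).toReal) ∧
        (∀ ξ, 0 < ξ.2 → ‖extPiece φ h η ψ s m f v ξ‖ ≤
          K * (eLpNorm f q (volume.restrict (cubeU n))).toReal * √(ξ.2⁻¹ ^ n)) ∧
        ∀ t, ∫⁻ x, ‖extPiece φ h η ψ s m f v (x, t)‖ₑ ^ 2 ≤
          ENNReal.ofReal (K * (eLpNorm f q (volume.restrict (cubeU n))).toReal) ^ 2 := by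
  choose C₁ hC₁ h₁ using fun a =>
    exists_integral_norm_modPiece_le hφ hη hη1 (hh.mem a) hψs.continuous hψ
  choose C₂ hC₂ h₂ using fun a => exists_ext_modPiece_le hφ hη hη1 (hh.mem a) hψs hψ
  choose C₃ hC₃ h₃ using fun a => exists_l2sq_modPiece_le hφ hη hη1 (hh.mem a) hψs.continuous hψ
  set A : ℝ := √(‖(T.symm : L2 n →L[ℂ] L2 n)‖ * 7 ^ n) with hA
  set D₁ : ℝ := ∑ a, C₁ a with hD₁
  set D₂ : ℝ := ∑ a, √(C₂ a) with hD₂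
  set D₃ : ℝ := √((2 * Real.pi) ^ n) * ∑ a, √(C₃ a) with hD₃
  have hA0 : 0 ≤ A := Real.sqrt_nonneg _
  have hD₁0 : 0 ≤ D₁ := Finset.sum_nonneg fun a _ => hC₁ a
  have hD₂0 : 0 ≤ D₂ := Finset.sum_nonneg fun a _ => Real.sqrt_nonneg _
  have hD₃0 : 0 ≤ D₃ := by positivity
  refine ⟨A * (D₁ + D₂ + D₃), by positivity, fun s m f hf v hv => ?_⟩
  set Φ := (eLpNorm f q (volume.restrict (cubeU n))).toReal with hΦ
  have hΦ0 : 0 ≤ Φ := ENNReal.toReal_nonneg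
  have hco : ∀ a, ‖modCoeff φ h η s m f v a‖ ≤ A * Φ := fun a =>
    (norm_modCoeff_le hφ hh hη hη1 hT s m f hv a).trans (by
      gcongr; exact norm_toL2_indicator_le hq hf)
  refine ⟨fun ξ => ?_, fun ξ hξ => ?_, fun t => ?_⟩
  · refine (norm_extPiece_le (by positivity) s m f v ξ hco fun a =>
      (norm_ext_le _ ξ).trans (h₁ a s m v hv)).trans ?_
    have : A * Φ * D₁ ≤ A * Φ * (D₁ + D₂ + D₃) := by gcongr; linarith
    linarith
  · refine (norm_extPiece_le (C := fun a => √(C₂ a) * √(ξ.2⁻¹ ^ n)) (by positivity) s m f v ξ hco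
      fun a => ?_).trans ?_
    · rw [← Real.sqrt_mul (hC₂ a)]
      refine Real.le_sqrt_of_sq_le ?_
      have := h₂ a s m v hv ξ hξ.ne'
      rwa [abs_of_pos hξ] at this
    · rw [← Finset.sum_mul, ← mul_assoc]
      gcongr ?_ * _
      have : A * Φ * D₂ ≤ A * Φ * (D₁ + D₂ + D₃) := by gcongr; linarith
      linarith
  · refine (lintegral_extPiece_sq_le hφ hh hη hη1 (by positivity) s m f v hco
      (fun a => h₃ a s m v hv) hC₃ t).trans ?_
    rw [← ENNReal.ofReal_pow (by positivity)]
    refine ENNReal.ofReal_le_ofReal ?_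
    gcongr ?_ ^ 2
    have : A * Φ * D₃ ≤ A * Φ * (D₁ + D₂ + D₃) := by gcongr; linarith
    linarith

theorem ext_translate {g : E n → ℂ} (v : E n) (ξ : E n × ℝ) :
    ext (fun x => g (x - v)) ξ = phase ξ v * ext g (ξ.1 + (2 * ξ.2) • v, ξ.2) := by
  rw [ext_eq, ext_eq, ← integral_add_right_eq_self _ v, ← integral_const_mul]
  congr 1; funext x
  rw [phase_add, add_sub_cancel_right, mul_assoc]

/-- Joint measurability in the grid and the frequency. -/
theorem exists_measurable_extPiece (hφ : IsMollifier κ φ) (hh : IsAlpertBasis κ h) (hη : 0 < η)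
    (hη1 : η ≤ 1) {T : L2 n ≃L[ℂ] L2 n} (hT : ∀ F, HasSum (frameTerm φ h η 0 F) (T F))
    (hψs : ContDiff ℝ ∞ ψ) (hψ : tsupport ψ ⊆ cubeU n) (s : ℕ) (m : E n) (f : E n → ℂ) :
    ∃ G : E n × (E n × ℝ) → ℂ, Measurable G ∧
      ∀ v ∈ shifts n, ∀ ξ, extPiece φ h η ψ s m f v ξ = G (v, ξ) := by
  choose A hA hAe using fun a => exists_measurable_modCoeff hφ hh hη hη1 hT s m f a
  have hSW : ∀ a v j, Integrable fun x => (smoothWavelet φ (h a) η v (s : ℤ) j x : ℂ) :=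
    fun a v j =>
      (contDiff_smoothWavelet hφ hη (hh.mem a) v s j).continuous.integrable_of_hasCompactSupport
        (hasCompactSupport_smoothWavelet hφ hη hη1 (hh.mem a) v s j)
  -- Writing each wavelet as a translate of one on the standard grid moves v into a phase and a
  -- shear of the frequency; apart from the coefficients everything is then jointly continuous.
  refine ⟨fun p => ∑ a, A a p.1 * ∑ j ∈ latticeBox n (3 * 2 ^ s),
    (ψ (gridCenter p.1 s j) : ℂ) * modulation s m p.1 j * (phase p.2 p.1 *
      ext (fun x => (smoothWavelet φ (h a) η 0 (s : ℤ) j x : ℂ))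
        (p.2.1 + (2 * p.2.2) • p.1, p.2.2)), ?_, fun v hv ξ => ?_⟩
  · refine Finset.measurable_sum _ fun a _ => ((hA a).comp measurable_fst).mul ?_
    refine Finset.measurable_sum _ fun j _ => Continuous.measurable ?_
    have h1 : Continuous fun p : E n × (E n × ℝ) => gridCenter p.1 (s : ℤ) j := by
      unfold gridCenter; fun_prop
    have h2 : Continuous fun p : E n × (E n × ℝ) => phase p.2 p.1 :=
      continuous_phase.comp (by fun_prop : Continuous fun p : E n × (E n × ℝ) => (p.2, p.1))
    have h3 : Continuous fun p : E n × (E n × ℝ) => modulation s m p.1 j :=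
      (continuous_modulation s m j).comp continuous_fst
    have h4 : Continuous fun p : E n × (E n × ℝ) =>
        ext (fun x => (smoothWavelet φ (h a) η 0 (s : ℤ) j x : ℂ))
          (p.2.1 + (2 * p.2.2) • p.1, p.2.2) :=
      (continuous_ext (hSW a 0 j)).comp (by fun_prop)
    exact ((Complex.continuous_ofReal.comp (hψs.continuous.comp h1)).mul h3).mul (h2.mul h4)
  · refine Finset.sum_congr rfl fun a _ => ?_
    rw [hAe a v hv]
    congr 1
    rw [show modPiece φ h η ψ s m v a = _ from funext (modPiece_eq hψ s m hv a),
      ext_sum _ fun j _ => (hSW a v j).const_mul _]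
    refine Finset.sum_congr rfl fun j _ => ?_
    rw [ext_const_mul]
    congr 1
    simp_rw [smoothWavelet_eq_translate φ (h a) η v]
    exact ext_translate (g := fun x => (smoothWavelet φ (h a) η 0 (s : ℤ) j x : ℂ)) v ξ

end Bounds

/-! ### The two ranges of ξ_d -/

section Main

variable {n κ M : ℕ} {φ ψ : E n → ℝ} {h : Fin M → E n → ℝ} {η : ℝ}

theorem shifts_eq_box (n : ℕ) : shifts n = box n 1 := by
  ext v; simp [shifts, box, abs_le]

theorem volume_shifts (n : ℕ) : volume (shifts n) = ENNReal.ofReal 2 ^ n := by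
  rw [shifts_eq_box, volume_box, mul_one]

theorem measurableSet_shifts (n : ℕ) : MeasurableSet (shifts n) := by
  rw [shifts_eq_box]; exact measurableSet_box

/-- With q = 2 + 2/n the decay t^{-n/2} raised to q - 2 is exactly 1/t; this criticality is why only
a logarithm is lost. -/
theorem sqrt_inv_pow_rpow (hn : 0 < n) {t : ℝ} (ht : 0 < t) :
    ENNReal.ofReal √(t⁻¹ ^ n) ^ (2 + 2 / (n : ℝ) - 2) = ENNReal.ofReal t⁻¹ := by
  have hn' : (n : ℝ) ≠ 0 := by positivity
  have hi : 0 < t⁻¹ := inv_pos.2 ht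
  rw [ENNReal.ofReal_rpow_of_pos (Real.sqrt_pos.2 (by positivity)), Real.sqrt_eq_rpow,
    ← Real.rpow_natCast, ← Real.rpow_mul hi.le, ← Real.rpow_mul hi.le]
  congr 1
  rw [show (n : ℝ) * (1 / 2) * (2 + 2 / n - 2) = 1 by field_simp; ring, Real.rpow_one]

/-- No decay is needed on the slices [-1, 1], of total length 2, and 2^{1/r} ≤ 2. -/
theorem eLpNorm_small_range_le (hφ : IsMollifier κ φ) (hh : IsAlpertBasis κ h) (hη : 0 < η)
    (hη1 : η ≤ 1) {s : ℕ} {m : E n} {f : E n → ℂ} {v : E n} {r : ℝ} (hr : 2 ≤ r)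
    {B : ℝ} (h1 : ∀ ξ, ‖extPiece φ h η ψ s m f v ξ‖ ≤ B)
    (h2 : ∀ t, ∫⁻ x, ‖extPiece φ h η ψ s m f v (x, t)‖ₑ ^ 2 ≤ ENNReal.ofReal B ^ 2)
    {R : Set (E n × ℝ)} (hR : ∀ ξ ∈ R, |ξ.2| ≤ 1) :
    eLpNorm (extPiece φ h η ψ s m f v) (ENNReal.ofReal r) (volume.restrict R) ≤
      2 * ENNReal.ofReal B := by
  have h3 := eLpNorm_le_of_slices (continuous_extPiece hφ hh hη hη1 s m f v).measurable
    (measurableSet_Icc (a := (-1 : ℝ)) (b := 1)) (R := R) (fun ξ hξ => abs_le.1 (hR ξ hξ)) hr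
    (B := ENNReal.ofReal B) (β := fun _ => 1) measurable_const (fun t _ x => by
      rw [mul_one, ← ofReal_norm]; exact ENNReal.ofReal_le_ofReal (h1 _)) fun t _ => h2 t
  refine h3.trans ?_
  rw [mul_comm]
  gcongr
  simp only [ENNReal.one_rpow, setLIntegral_const, one_mul, Real.volume_Icc]
  norm_num
  calc (2 : ENNReal) ^ r⁻¹ ≤ 2 ^ (1 : ℝ) := by
        refine ENNReal.rpow_le_rpow_of_exponent_le (by norm_num) ?_
        exact inv_le_one_of_one_le₀ (by linarith)
    _ = 2 := ENNReal.rpow_one 2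

/-- The bounds hold for almost every v, hence for the average, and the slices contribute ∫ dt/t ≤ L.
The condition 1 ≤ L allows the power 1/q of `L` to be replaced by `L`. -/
theorem eLpNorm_large_range_le (hn : 0 < n) {P : Measure (E n)} [IsProbabilityMeasure P]
    {G : E n × (E n × ℝ) → ℂ} (hG : Measurable G) {B : ℝ} (hB : 0 ≤ B)
    (h1 : ∀ᵐ v ∂P, ∀ ξ : E n × ℝ, 0 < ξ.2 → ‖G (v, ξ)‖ ≤ B * √(ξ.2⁻¹ ^ n))
    (h2 : ∀ᵐ v ∂P, ∀ t, ∫⁻ x, ‖G (v, (x, t))‖ₑ ^ 2 ≤ ENNReal.ofReal B ^ 2)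
    {a b : ℝ} (ha : 0 < a) (hab : a ≤ b) {L : ℝ} (hL : Real.log (b / a) ≤ L) (hL1 : 1 ≤ L)
    {R : Set (E n × ℝ)} (hR : ∀ ξ ∈ R, ξ.2 ∈ Icc a b) :
    eLpNorm (fun ξ => ∫ v, G (v, ξ) ∂P) (ENNReal.ofReal (2 + 2 / (n : ℝ))) (volume.restrict R) ≤
      ENNReal.ofReal B * ENNReal.ofReal L := by
  have hr : (2 : ℝ) ≤ 2 + 2 / (n : ℝ) := by
    have : 0 ≤ 2 / (n : ℝ) := by positivity
    linarith
  have hF : Measurable fun ξ => ∫ v, G (v, ξ) ∂P :=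
    (hG.stronglyMeasurable.comp_measurable measurable_swap).integral_prod_right'.measurable
  refine (eLpNorm_le_of_slices hF measurableSet_Icc hR hr (B := ENNReal.ofReal B)
    (β := fun t => ENNReal.ofReal √(t⁻¹ ^ n)) (by fun_prop) (fun t ht x => ?_)
    fun t ht => ?_).trans ?_
  · refine enorm_integral_le_of_forall (h1.mono fun v hv => ?_)
    rw [← ENNReal.ofReal_mul hB, ← ofReal_norm]
    exact ENNReal.ofReal_le_ofReal (hv (x, t) (ha.trans_le ht.1))
  · have hGt : Measurable fun p : E n × E n => G (p.1, (p.2, t)) :=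
      hG.comp (measurable_fst.prodMk (measurable_snd.prodMk measurable_const))
    exact lintegral_enorm_integral_sq_le (G := fun p : E n × E n => G (p.1, (p.2, t))) hGt
      (h2.mono fun v hv => hv t)
  · gcongr
    rw [setLIntegral_congr_fun measurableSet_Icc fun t ht =>
      sqrt_inv_pow_rpow hn (ha.trans_le ht.1), lintegral_inv_Icc_le ha hab]
    calc _ ≤ ENNReal.ofReal L ^ (1 / (2 + 2 / (n : ℝ))) := by gcongr
      _ ≤ ENNReal.ofReal L ^ (1 : ℝ) := by
          refine ENNReal.rpow_le_rpow_of_exponent_le ?_ ?_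
          · rw [← ENNReal.ofReal_one]; exact ENNReal.ofReal_le_ofReal hL1
          · rw [div_le_one (by linarith)]; linarith
      _ = _ := ENNReal.rpow_one _

theorem qExp_succ (hn : 0 < n) : qExp (n + 1) = ENNReal.ofReal (2 + 2 / (n : ℝ)) := by
  have hn' : (n : ℝ) ≠ 0 := by positivity
  rw [qExp]
  congr 1
  push_cast
  rw [add_sub_cancel_right]
  field_simp

end Main

end AlpertExtension

theorem mainTheorem10 (d : ℕ) (hd : 2 ≤ d) :
    ∃ Cd : ℝ, ∀ (κ : ℕ), d < κ →
    ∀ φ : E (d - 1) → ℝ, IsMollifier κ φ →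
    ∃ η₀ : ℝ, 0 < η₀ ∧
    ∀ (M : ℕ) (h : Fin M → E (d - 1) → ℝ), IsAlpertBasis κ h →
    ∀ η : ℝ, 0 < η → η < η₀ →
      -- `T_𝓖` is a bounded invertible operator for every grid `𝓖 ∈ 𝔾`
      (∀ v ∈ shifts (d - 1), ∃ T : L2 (d - 1) ≃L[ℂ] L2 (d - 1),
        ∀ F, HasSum (frameTerm φ h η v F) (T F)) ∧
      ∀ ψ : E (d - 1) → ℝ, ContDiff ℝ ∞ ψ → tsupport ψ ⊆ cubeU (d - 1) →
      ∃ C : ℝ, ∀ δ : ℝ, 0 < δ → δ ≤ 1 / 2 → ∀ (s : ℕ) (m : E (d - 1)) (f : E (d - 1) → ℂ),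
        MemLp f (qExp d) (volume.restrict (cubeU (d - 1))) →
        -- small range of `ξ_d`, for each grid
        (∀ v ∈ shifts (d - 1),
          eLpNorm (ext fun x => ∑ a, modCoeff φ h η s m f v a * modPiece φ h η ψ s m v a x)
              (qExp d)
              (volume.restrict (ball' (d - 1) ((2 : ℝ) ^ ((s : ℝ) / (1 - δ))) ∩
                {ξ | |ξ.2| ≤ (2 : ℝ) ^ (-((d : ℝ) * s))}))
            ≤ ENNReal.ofReal C * eLpNorm f (qExp d) (volume.restrict (cubeU (d - 1)))) ∧
        -- large range of `ξ_d`, averaged over grids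
        (∀ ξ : E (d - 1) × ℝ, IntegrableOn
          (fun v => ∑ a, modCoeff φ h η s m f v a * ext (modPiece φ h η ψ s m v a) ξ)
          (shifts (d - 1))) ∧
        eLpNorm (fun ξ => ⨍ v in shifts (d - 1),
              ∑ a, modCoeff φ h η s m f v a * ext (modPiece φ h η ψ s m v a) ξ)
            (qExp d)
            (volume.restrict (ball' (d - 1) ((2 : ℝ) ^ ((s : ℝ) / (1 - δ))) ∩
              {ξ | (2 : ℝ) ^ ((1 - δ) * s) ≤ ξ.2 ∧ ξ.2 ≤ (2 : ℝ) ^ ((s : ℝ) / (1 - δ))}))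
          ≤ ENNReal.ofReal (C * (2 : ℝ) ^ (Cd * δ * s)) *
              eLpNorm f (qExp d) (volume.restrict (cubeU (d - 1))) := by
  -- The value 4 is the exponent of `log_range_le`.
  refine ⟨4, fun κ hκ φ hφ => ?_⟩
  obtain ⟨n, rfl⟩ : ∃ n, d = n + 1 := ⟨d - 1, by omega⟩
  have hn : 0 < n := by omega
  change IsMollifier (n := n) κ φ at hφ
  obtain ⟨η₀, hη₀, hη₀1, hframe⟩ := exists_frame_zero hn (by omega : 0 < κ) hφ
  refine ⟨η₀, hη₀, fun M h hh η hη hlt => ?_⟩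
  change IsAlpertBasis (n := n) κ h at hh
  have hη1 : η ≤ 1 := hlt.le.trans hη₀1
  obtain ⟨T, hT⟩ := hframe M h hh η hη hlt
  refine ⟨fun v _ => (exists_frame hφ hh hη hη1 hT v).imp fun _ hT' => hT'.1,
    fun ψ hψs hψ => ?_⟩
  have hr : (2 : ℝ) ≤ 2 + 2 / (n : ℝ) := by
    have : 0 ≤ 2 / (n : ℝ) := by positivity
    linarith
  have hq : (2 : ENNReal) ≤ qExp (n + 1) := by
    rw [qExp_succ hn]
    simpa using ENNReal.ofReal_le_ofReal hr
  obtain ⟨K, hK, hbounds⟩ := exists_extPiece_bounds hφ hh hη hη1 hT hψs hψ hq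
  refine ⟨2 * K, fun δ hδ hδ' s m f hf => ?_⟩
  have hbd := hbounds s m f hf
  set Φ := eLpNorm f (qExp (n + 1)) (volume.restrict (cubeU n)) with hΦ
  have hΦtop : Φ ≠ ⊤ := hf.2.ne
  have hΦ0 : 0 ≤ Φ.toReal := ENNReal.toReal_nonneg
  have hKΦ : 0 ≤ K * Φ.toReal := by positivity
  have hofReal : ENNReal.ofReal (K * Φ.toReal) = ENNReal.ofReal K * Φ := by
    rw [ENNReal.ofReal_mul hK, ENNReal.ofReal_toReal hΦtop]
  obtain ⟨G, hG, hGe⟩ := exists_measurable_extPiece hφ hh hη hη1 hT hψs hψ s m f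
  have hvol : volume (shifts n) ≠ ⊤ := by
    rw [volume_shifts]; exact ENNReal.pow_ne_top ENNReal.ofReal_ne_top
  have hvol0 : volume (shifts n) ≠ 0 := by
    rw [volume_shifts]; exact pow_ne_zero _ (by simp)
  refine ⟨fun v hv => ?_, fun ξ => ?_, ?_⟩
  · rw [show ext (fun x => ∑ a, modCoeff φ h η s m f v a * modPiece φ h η ψ s m v a x) =
      extPiece φ h η ψ s m f v from funext (ext_sum_modPiece hφ hh hη hη1 s m f v)]
    obtain ⟨hb1, -, hb3⟩ := hbd v hv
    have h3 := eLpNorm_small_range_le hφ hh hη hη1 hr hb1 hb3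
      (R := ball' n ((2 : ℝ) ^ ((s : ℝ) / (1 - δ))) ∩
        {ξ | |ξ.2| ≤ (2 : ℝ) ^ (-(((n + 1 : ℕ) : ℝ) * s))}) fun ξ hξ =>
      le_trans hξ.2 (Real.rpow_le_one_of_one_le_of_nonpos (by norm_num)
        (neg_nonpos.2 (by positivity)))
    rw [← qExp_succ hn] at h3
    refine h3.trans (le_of_eq ?_)
    rw [hofReal, ENNReal.ofReal_mul (by norm_num), ENNReal.ofReal_ofNat, mul_assoc]
    rfl
  · change IntegrableOn (fun v => extPiece φ h η ψ s m f v ξ) (shifts n)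
    refine IntegrableOn.congr_fun (f := fun v => G (v, ξ)) ?_ (fun v hv => (hGe v hv ξ).symm)
      (measurableSet_shifts n)
    refine Measure.integrableOn_of_bounded (M := K * Φ.toReal) hvol
      (hG.comp measurable_prodMk_right).aestronglyMeasurable ?_
    refine (ae_restrict_iff' (measurableSet_shifts n)).2 (Filter.Eventually.of_forall fun v hv => ?_)
    rw [← hGe v hv]
    exact (hbd v hv).1 ξ
  · have hne : NeZero (volume.restrict (shifts n)) :=
      ⟨fun h0 => hvol0 (Measure.restrict_eq_zero.1 h0)⟩
    have hfin : IsFiniteMeasure (volume.restrict (shifts n)) :=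
      ⟨by rw [Measure.restrict_apply_univ]; exact hvol.lt_top⟩
    have hae : ∀ᵐ v ∂((volume.restrict (shifts n)) univ)⁻¹ • volume.restrict (shifts n),
        v ∈ shifts n := Measure.ae_smul_measure (ae_restrict_mem (measurableSet_shifts n)) _
    -- The average is an integral against the normalised measure, which is carried by the shifts, so
    -- the integrand may be replaced by the jointly measurable `G`.
    have havg : ∀ ξ, ⨍ v in shifts n,
        ∑ a, modCoeff φ h η s m f v a * ext (modPiece φ h η ψ s m v a) ξ =
        ∫ v, G (v, ξ) ∂(((volume.restrict (shifts n)) univ)⁻¹ • volume.restrict (shifts n)) :=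
      fun ξ => integral_congr_ae (hae.mono fun v hv => hGe v hv ξ)
    have h1δ : 0 < 1 - δ := by linarith
    have hab : (2 : ℝ) ^ ((1 - δ) * s) ≤ (2 : ℝ) ^ ((s : ℝ) / (1 - δ)) := by
      refine Real.rpow_le_rpow_of_exponent_le (by norm_num) ?_
      rw [le_div_iff₀ h1δ]
      have : (0 : ℝ) ≤ s := Nat.cast_nonneg s
      nlinarith [mul_nonneg this h1δ.le, mul_nonneg (mul_nonneg this h1δ.le) hδ.le,
        mul_nonneg this hδ.le]
    have h3 := eLpNorm_large_range_le hn hG hKΦ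
      (P := ((volume.restrict (shifts n)) univ)⁻¹ • volume.restrict (shifts n))
      (hae.mono fun v hv ξ hξ => by rw [← hGe v hv]; exact (hbd v hv).2.1 ξ hξ)
      (hae.mono fun v hv t => by simp_rw [← hGe v hv]; exact (hbd v hv).2.2 t)
      (by positivity) hab (log_range_le hδ hδ' s)
      (Real.one_le_rpow (by norm_num) (by positivity))
      (R := ball' n ((2 : ℝ) ^ ((s : ℝ) / (1 - δ))) ∩
        {ξ | (2 : ℝ) ^ ((1 - δ) * s) ≤ ξ.2 ∧ ξ.2 ≤ (2 : ℝ) ^ ((s : ℝ) / (1 - δ))})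
      fun ξ hξ => hξ.2
    rw [← qExp_succ hn] at h3
    simp_rw [← havg] at h3
    refine h3.trans ?_
    rw [hofReal, mul_right_comm, ← ENNReal.ofReal_mul hK]
    refine mul_le_mul' (ENNReal.ofReal_le_ofReal ?_) le_rfl
    gcongr
    linarith
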